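/- Let $\mathbb F$ be a field. An $\mathbb F$-represented matroid on a finite set $E$ is a class of matrices over $\mathbb F$ with columns indexed by $E$, taken up to row equivalence, adding or removing zero rows, and column scaling; we write $M(A)$ for the class of $A$ as well as for its vector matroid. It is a represented frame matroid if some representation matrix has at most two nonzero entries in each column, and it is confined to a proper subfield if some representation matrix has all entries in a proper subfield of $\mathbb F$. The dual $N^*$ of $N$ is the represented matroid whose row space is the orthogonal complement of the row space of $N$. A represented matroid $M_2$ is a rank-$(\le t)$ perturbation of $M_1$ if there are matrices $A,P$ over $\mathbb F$ with $M(A)=M_1$, $\operatorname{rank}P\le t$ and $M(A+P)=M_2$. A matroid $M$ on $E$ is vertically $k$-connected if for every partition $(A,B)$ of $E$ with $r(A)+r(B)-r(M)+1<k$, one of $A$ and $B$ spans $M$. A matroid is dyadic if it is representable over both $\mathrm{GF}(3)$ and $\mathrm{GF}(5)$. For a finite field $\mathbb F$, the perturbation conjecture over $\mathbb F$ (announced by Geelen, Gerards and Whittle) states: for every proper minor-closed class $\mathcal M$ of $\mathbb F$-represented matroids there exist positive integers $k,t$ such that each vertically $k$-connected member of $\mathcal M$ is a rank-$(\le t)$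 perturbation of an $\mathbb F$-represented matroid $N$ such that (i) $N$ is a represented frame matroid, or (ii) $N^*$ is a represented frame matroid, or (iii) $N$ is confined to a proper subfield of $\mathbb F$. **Corollary 3.5.** The dyadic matroids, regarded as $\mathrm{GF}(3)$-represented matroids, form a proper minor-closed class. For all positive integers $k$ and $t$ there is a vertically $k$-connected dyadic $\mathrm{GF}(3)$-represented matroid that is not a rank-$(\le t)$ perturbation of any $\mathrm{GF}(3)$-represented matroid $N$ satisfying (i), (ii) or (iii). Consequently the perturbation conjecture is false over $\mathbb F=\mathrm{GF}(3)$. -/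

import Mathlib

/-! # Represented matroids, bounded-rank perturbations, and vertical connectivity -/

noncomputable section

/-! ## Vector matroids -/

/-- The matroid on `E` of a finite family of vectors `v`: a set of indices is independent
when the vectors that it indexes are linearly independent. -/
def linearMatroid {K E W : Type*} [Field K] [Finite E] [AddCommGroup W] [Module K W]
    (v : E → W) : Matroid E :=
  (IndepMatroid.ofFinite (E := (Set.univ : Set E)) Set.finite_univ
    (fun I => LinearIndepOn K v I)
    (linearIndepOn_empty K v)
    (fun _ _ hJ h => hJ.mono h)
    (by
      intro I J hI hJ hlt
      by_contra! hcon
      have hsub : v '' J ⊆ Submodule.span K (v '' I) := by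
        rintro _ ⟨e, heJ, rfl⟩
        by_contra hne
        by_cases heI : e ∈ I
        · exact hne (Submodule.subset_span ⟨e, heI, rfl⟩)
        · exact hcon e heJ heI (hI.insert hne)
      have hle : Submodule.span K (v '' J) ≤ Submodule.span K (v '' I) :=
        Submodule.span_le.2 hsub
      have : FiniteDimensional K (Submodule.span K (v '' I)) :=
        FiniteDimensional.span_of_finite K ((Set.toFinite I).image v)
      have hrank : ∀ S : Set E, LinearIndepOn K v S →
          Module.finrank K (Submodule.span K (v '' S)) = S.ncard := by
        intro S hS
        have := Fintype.ofFinite S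
        have h := finrank_span_eq_card (R := K) (b := fun x : S => v x) hS
        rw [Set.image_eq_range, h, ← Nat.card_eq_fintype_card]
        rfl
      have := Submodule.finrank_mono hle
      rw [hrank I hI, hrank J hJ] at this
      omega)
    (fun _ _ => Set.subset_univ _)).matroid

@[simp] theorem linearMatroid_indep {K E W : Type*} [Field K] [Finite E] [AddCommGroup W]
    [Module K W] (v : E → W) (I : Set E) :
    (linearMatroid (K := K) v).Indep I ↔ LinearIndepOn K v I := Iff.rfl

@[simp] theorem linearMatroid_ground {K E W : Type*} [Field K] [Finite E] [AddCommGroup W]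
    [Module K W] (v : E → W) : (linearMatroid (K := K) v).E = Set.univ := rfl

/-- The vector matroid `M(A)`, on the set of columns of the matrix `A`. -/
def vectorMatroid {K E : Type*} [Field K] [Finite E] {n : ℕ} (A : Matrix (Fin n) E K) :
    Matroid E :=
  linearMatroid (K := K) (fun e => A.col e)

/-- A matroid is `K`-representable if it is the vector matroid of a matrix over `K`. -/
def IsRepresentable (K : Type*) [Field K] {E : Type*} [Finite E] (M : Matroid E) : Prop :=
  ∃ (n : ℕ) (A : Matrix (Fin n) E K), vectorMatroid A = M

instance fact_nat_prime_five : Fact (Nat.Prime 5) := ⟨Nat.prime_five⟩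

/-- A matroid is dyadic if it is representable over both `GF(3)` and `GF(5)`. -/
def IsDyadic {E : Type*} [Finite E] (M : Matroid E) : Prop :=
  IsRepresentable (ZMod 3) M ∧ IsRepresentable (ZMod 5) M

/-- Vertical `k`-connectivity: for every separation `(A, B)` of order less than `k`, one of
`A` and `B` is spanning. The order of a partition `(A, B)` of the ground set is
`r(A) + r(B) - r(M) + 1`; the inequality is written without subtraction. -/
def IsVerticallyConnected {E : Type*} (M : Matroid E) (k : ℕ) : Prop :=
  ∀ A ⊆ M.E, M.eRk A + M.eRk (M.E \ A) + 1 < M.eRank + k →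
    M.Spanning A ∨ M.Spanning (M.E \ A)

/-! ## Represented matroids -/

/-- Two row spaces agree up to column scaling. -/
def ScaleEquiv {F E : Type*} [Field F] (U V : Submodule F (E → F)) : Prop :=
  ∃ d : E → Fˣ, ∀ u : E → F, u ∈ U ↔ (fun e => (d e : F) * u e) ∈ V

theorem ScaleEquiv.refl {F E : Type*} [Field F] (U : Submodule F (E → F)) : ScaleEquiv U U :=
  ⟨1, fun u => by simp⟩

theorem ScaleEquiv.symm {F E : Type*} [Field F] {U V : Submodule F (E → F)}
    (h : ScaleEquiv U V) : ScaleEquiv V U := by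
  obtain ⟨d, hd⟩ := h
  refine ⟨d⁻¹, fun u => ?_⟩
  rw [hd]
  simp

theorem ScaleEquiv.trans {F E : Type*} [Field F] {U V W : Submodule F (E → F)}
    (h : ScaleEquiv U V) (h' : ScaleEquiv V W) : ScaleEquiv U W := by
  obtain ⟨d, hd⟩ := h
  obtain ⟨d', hd'⟩ := h'
  refine ⟨d' * d, fun u => ?_⟩
  rw [hd, hd']
  simp [mul_assoc]

/-- The equivalence relation on row spaces given by column scaling. -/
instance scaleSetoid (F E : Type*) [Field F] : Setoid (Submodule F (E → F)) where
  r := ScaleEquiv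
  iseqv := ⟨ScaleEquiv.refl, ScaleEquiv.symm, ScaleEquiv.trans⟩

/-- An `F`-represented matroid on `E`: a class of matrices over `F` with columns indexed by
`E`, up to row equivalence, removal (or insertion) of zero rows, and column scaling. Two
matrices are related by row operations and zero rows exactly when they have the same row
space, so such a class is the same thing as a subspace of `F^E` up to column scaling. -/
def RepMatroid (F E : Type*) [Field F] : Type _ := Quotient (scaleSetoid F E)

namespace RepMatroid

variable {F E E' : Type*} [Field F]

/-- The represented matroid with row space `U`. -/
def ofSpace (U : Submodule F (E → F)) : RepMatroid F E := Quotient.mk (scaleSetoid F E) U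

/-- The represented matroid of a matrix. -/
def ofMatrix {n : ℕ} (A : Matrix (Fin n) E F) : RepMatroid F E :=
  ofSpace (Submodule.span F (Set.range A.row))

/-- The `e`-th coordinate functional on a row space. -/
def coord (U : Submodule F (E → F)) (e : E) : U →ₗ[F] F :=
  (LinearMap.proj e).comp U.subtype

theorem linearIndepOn_coord_of_scaleEquiv {U V : Submodule F (E → F)} (h : ScaleEquiv U V)
    {I : Set E} (hI : LinearIndepOn F (coord U) I) : LinearIndepOn F (coord V) I := by
  obtain ⟨d, hd⟩ := h
  let φ : U →ₗ[F] V :=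
    { toFun := fun u => ⟨fun e => (d e : F) * u.1 e, (hd u.1).1 u.2⟩
      map_add' := fun u w => by ext e; simp [mul_add]
      map_smul' := fun c u => by ext e; simp [mul_left_comm] }
  let L : (V →ₗ[F] F) →ₗ[F] (U →ₗ[F] F) := LinearMap.lcomp F F φ
  have h1 : LinearIndependent F (fun e : I => d e • coord U e) := by
    have h0 := LinearIndependent.units_smul hI (fun e : I => d e)
    exact h0
  refine LinearIndependent.of_comp L ?_
  have h2 : (L ∘ fun e : I => coord V e) = fun e : I => d e • coord U e := by
    funext e
    refine LinearMap.ext fun u => ?_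
    rfl
  rw [h2]
  exact h1

/-- The matroid underlying a represented matroid: a set of elements is independent when the
corresponding columns of a representation matrix are linearly independent; in terms of the
row space, when the corresponding coordinate functionals on it are
(see `toMatroid_ofMatrix`). -/
def toMatroid [Finite E] (M : RepMatroid F E) : Matroid E :=
  Quotient.lift (s := scaleSetoid F E) (fun U => linearMatroid (K := F) (coord U))
    (fun U V (h : ScaleEquiv U V) => by
      refine Matroid.ext_indep rfl fun I _ => ?_
      exact ⟨linearIndepOn_coord_of_scaleEquiv h, linearIndepOn_coord_of_scaleEquiv h.symm⟩) M

/-- The underlying matroid of the represented matroid of `A` is the vector matroid of `A`. -/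
theorem toMatroid_ofMatrix [Finite E] {n : ℕ} (A : Matrix (Fin n) E F) :
    (ofMatrix A).toMatroid = vectorMatroid A := by
  set U := Submodule.span F (Set.range A.row) with hU
  have hrow : ∀ i, A.row i ∈ U := fun i => Submodule.subset_span ⟨i, rfl⟩
  let L : (U →ₗ[F] F) →ₗ[F] (Fin n → F) :=
    LinearMap.pi fun i => LinearMap.applyₗ (⟨A.row i, hrow i⟩ : U)
  have hL : Function.Injective L := by
    intro f g hfg
    ext ⟨u, hu⟩
    induction hu using Submodule.span_induction with
    | mem x hx =>
      obtain ⟨i, rfl⟩ := hx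
      exact congrFun hfg i
    | zero => exact (map_zero f).trans (map_zero g).symm
    | add x y hx hy ihx ihy =>
      exact (map_add f ⟨x, hx⟩ ⟨y, hy⟩).trans
        ((congrArg₂ (· + ·) ihx ihy).trans (map_add g ⟨x, hx⟩ ⟨y, hy⟩).symm)
    | smul a x hx ih =>
      exact (map_smul f a ⟨x, hx⟩).trans
        ((congrArg (a • ·) ih).trans (map_smul g a ⟨x, hx⟩).symm)
  refine Matroid.ext_indep rfl fun I _ => ?_
  have := LinearMap.linearIndependent_iff (v := fun e : I => coord U e) L
    (LinearMap.ker_eq_bot.2 hL)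
  exact this.symm

/-- The dual represented matroid: its row space is the orthogonal complement, for the
standard bilinear form, of the row space of `M`. -/
def dual [Fintype E] (M : RepMatroid F E) : RepMatroid F E :=
  Quotient.lift (s := scaleSetoid F E)
    (fun U => ofSpace
      ({ carrier := {w | ∀ u ∈ U, w ⬝ᵥ u = 0}
         add_mem' := fun {a b} ha hb u hu => by rw [add_dotProduct, ha u hu, hb u hu, add_zero]
         zero_mem' := fun u _ => zero_dotProduct u
         smul_mem' := fun c w hw u hu => by rw [smul_dotProduct, hw u hu, smul_zero] } :
        Submodule F (E → F)))
    (fun U V (h : ScaleEquiv U V) => by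
      refine Quotient.sound (s := scaleSetoid F E) ?_
      obtain ⟨d, hd⟩ := h
      refine ⟨d⁻¹, fun w => ?_⟩
      have key : ∀ u : E → F,
          (fun e => (((d⁻¹ : E → Fˣ) e : Fˣ) : F) * w e) ⬝ᵥ (fun e => (d e : F) * u e)
            = w ⬝ᵥ u := by
        intro u
        refine Finset.sum_congr rfl fun e _ => ?_
        have : (((d e)⁻¹ : Fˣ) : F) * (d e : F) = 1 := Units.inv_mul _
        simp only [Pi.inv_apply]
        linear_combination (w e * u e) * this
      constructor
      · intro hw v hv
        have hv' : (fun e => (d e : F) * ((((d e)⁻¹ : Fˣ) : F) * v e)) = v := by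
          funext e; simp
        rw [← hv', key]
        exact hw _ ((hd _).2 (by rwa [hv']))
      · intro hw u hu
        rw [← key u]
        exact hw _ ((hd u).1 hu)) M

/-- Deletion of a set `X` of elements: the columns indexed by `X` are removed. -/
def delete (M : RepMatroid F E) (X : Set E) : RepMatroid F {e : E // e ∉ X} :=
  Quotient.lift (s := scaleSetoid F E)
    (fun U => ofSpace (U.map (LinearMap.funLeft F F (Subtype.val : {e : E // e ∉ X} → E))))
    (fun U V (h : ScaleEquiv U V) => by
      refine Quotient.sound (s := scaleSetoid F _) ?_
      obtain ⟨d, hd⟩ := h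
      refine ⟨fun e => d e.1, fun w => ?_⟩
      simp only [Submodule.mem_map]
      constructor
      · rintro ⟨u, hu, rfl⟩
        exact ⟨_, (hd u).1 hu, rfl⟩
      · rintro ⟨v, hv, hvw⟩
        refine ⟨fun e => (((d e)⁻¹ : Fˣ) : F) * v e, (hd _).2 (by simpa using hv), ?_⟩
        funext e
        have := congrFun hvw e
        simp only [LinearMap.funLeft_apply] at this ⊢
        rw [this]; simp) M

/-- Contraction of a set `X` of elements: the vectors of the row space that vanish on `X`
are kept, and the columns indexed by `X` are then removed. -/
def contract (M : RepMatroid F E) (X : Set E) : RepMatroid F {e : E // e ∉ X} :=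
  Quotient.lift (s := scaleSetoid F E)
    (fun U => ofSpace
      ((U ⊓ ({ carrier := {u | ∀ e ∈ X, u e = 0}
               add_mem' := fun {a b} ha hb e he => by
                 rw [Pi.add_apply, ha e he, hb e he, add_zero]
               zero_mem' := fun _ _ => rfl
               smul_mem' := fun c u hu e he => by
                 rw [Pi.smul_apply, hu e he, smul_zero] } : Submodule F (E → F))).map
        (LinearMap.funLeft F F (Subtype.val : {e : E // e ∉ X} → E))))
    (fun U V (h : ScaleEquiv U V) => by
      refine Quotient.sound (s := scaleSetoid F _) ?_
      obtain ⟨d, hd⟩ := h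
      refine ⟨fun e => d e.1, fun w => ?_⟩
      simp only [Submodule.mem_map, Submodule.mem_inf]
      constructor
      · rintro ⟨u, ⟨hu, hu0⟩, rfl⟩
        refine ⟨_, ⟨(hd u).1 hu, fun e he => ?_⟩, rfl⟩
        rw [hu0 e he, mul_zero]
      · rintro ⟨v, ⟨hv, hv0⟩, hvw⟩
        refine ⟨fun e => (((d e)⁻¹ : Fˣ) : F) * v e,
          ⟨(hd _).2 (by simpa using hv), fun e he => by
            show (((d e)⁻¹ : Fˣ) : F) * v e = 0
            rw [show v e = 0 from hv0 e he, mul_zero]⟩, ?_⟩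
        funext e
        have := congrFun hvw e
        simp only [LinearMap.funLeft_apply] at this ⊢
        rw [this]; simp) M

/-- Relabelling of the elements along a bijection. -/
def relabel (σ : E ≃ E') (M : RepMatroid F E) : RepMatroid F E' :=
  Quotient.lift (s := scaleSetoid F E)
    (fun U => ofSpace (U.comap (LinearMap.funLeft F F σ)))
    (fun U V (h : ScaleEquiv U V) => by
      refine Quotient.sound (s := scaleSetoid F E') ?_
      obtain ⟨d, hd⟩ := h
      refine ⟨fun e => d (σ.symm e), fun w => ?_⟩
      simp only [Submodule.mem_comap]
      rw [hd]
      have : (fun e => (d e : F) * (LinearMap.funLeft F F σ) w e) =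
          (LinearMap.funLeft F F σ) (fun e => (d (σ.symm e) : F) * w e) := by
        funext e; simp [LinearMap.funLeft_apply]
      rw [this]) M

/-- A represented frame matroid: some representation matrix has at most two nonzero entries
in each column. -/
def IsFrame (M : RepMatroid F E) : Prop :=
  ∃ (n : ℕ) (A : Matrix (Fin n) E F), ofMatrix A = M ∧ ∀ e, {i | A i e ≠ 0}.ncard ≤ 2

/-- A represented matroid is confined to a proper subfield if some representation matrix has
all its entries in a proper subfield. -/
def IsConfinedToProperSubfield (M : RepMatroid F E) : Prop :=
  ∃ K : Subfield F, K ≠ ⊤ ∧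
    ∃ (n : ℕ) (A : Matrix (Fin n) E F), ofMatrix A = M ∧ ∀ i e, A i e ∈ K

/-- `M₂` is a rank-`(≤ t)` perturbation of `M₁`: it is obtained by adding a matrix of rank at
most `t` to some representation matrix of `M₁`. -/
def IsPerturbation [Fintype E] (t : ℕ) (M₁ M₂ : RepMatroid F E) : Prop :=
  ∃ (n : ℕ) (A P : Matrix (Fin n) E F), ofMatrix A = M₁ ∧ P.rank ≤ t ∧ ofMatrix (A + P) = M₂

end RepMatroid

/-! ## Classes of represented matroids -/

/-- A class of `F`-represented matroids (on finite ground sets). -/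
abbrev RepMatroidClass (F : Type*) [Field F] : Type _ :=
  ∀ (E : Type) [Finite E], Set (RepMatroid F E)

namespace RepMatroidClass

variable {F : Type*} [Field F]

/-- A minor-closed class: closed under deletion, contraction and isomorphism (relabelling). -/
structure IsMinorClosed (𝓜 : RepMatroidClass F) : Prop where
  delete_mem : ∀ (E : Type) [Finite E] (M : RepMatroid F E) (X : Set E),
    M ∈ 𝓜 E → M.delete X ∈ 𝓜 {e : E // e ∉ X}
  contract_mem : ∀ (E : Type) [Finite E] (M : RepMatroid F E) (X : Set E),
    M ∈ 𝓜 E → M.contract X ∈ 𝓜 {e : E // e ∉ X}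
  relabel_mem : ∀ (E E' : Type) [Finite E] [Finite E'] (σ : E ≃ E') (M : RepMatroid F E),
    M ∈ 𝓜 E → M.relabel σ ∈ 𝓜 E'

/-- A proper class: some `F`-represented matroid is not in it. -/
def IsProper (𝓜 : RepMatroidClass F) : Prop :=
  ∃ (E : Type) (_ : Finite E) (M : RepMatroid F E), M ∉ 𝓜 E

end RepMatroidClass

/-- The class of dyadic matroids, as `GF(3)`-represented matroids. -/
def dyadicClass : RepMatroidClass (ZMod 3) := fun _ _ => {M | IsDyadic M.toMatroid}

/-- `N` satisfies one of the three structural outcomes: (i) `N` is a represented frame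
matroid, (ii) `N*` is a represented frame matroid, or (iii) `N` is confined to a proper
subfield. -/
def IsStructured {F E : Type*} [Field F] [Fintype E] (N : RepMatroid F E) : Prop :=
  N.IsFrame ∨ N.dual.IsFrame ∨ N.IsConfinedToProperSubfield

/-- The announced perturbation theorem over the finite field `F`: for every proper minor-closed class
of `F`-represented matroids there are positive integers `k` and `t` such that each vertically
`k`-connected member is a rank-`(≤ t)` perturbation of an `F`-represented matroid that
satisfies one of the three structural outcomes. -/
def PerturbationConjecture (F : Type*) [Field F] [Finite F] : Prop :=
  ∀ 𝓜 : RepMatroidClass F, 𝓜.IsMinorClosed → 𝓜.IsProper →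
    ∃ k t : ℕ, 0 < k ∧ 0 < t ∧ ∀ (E : Type) [Fintype E], ∀ M ∈ 𝓜 E,
      IsVerticallyConnected M.toMatroid k →
        ∃ N : RepMatroid F E, N.IsPerturbation t M ∧ IsStructured N

end

set_option linter.unusedSectionVars false

noncomputable section

/-! ## Vector matroids and row spaces -/

section RowSpaces

variable {F E : Type*} [Field F]

/-! Minors of a ternary and of a quinary representation of one matroid again have a common matroid,
so the dyadic class is minor-closed; it is proper because a ten-point ternary configuration forces
`3 = 0` over any field that represents it.

The counterexamples come from a cubic bipartite graph of large girth. Write `ν` for the dimension of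
the cycle space of an edge set. A minimal edge set `X` with `ν X ≥ 1` and `|X| < 3 ν X + 3 β`
(`Tight`) is highly connected and almost cubic: if two complementary parts both contain cycles, then
they share more than `β` vertices, and at most `3 β + 2` vertices have degree 2. Choose `m`
terminals of degree 3 in `X`, far apart. The row space `netSpace` consists of the functions on `X`
with zero sum at every nonterminal. Each terminal contributes four further elements that read off
the combinations `z₀ ± z₁ ± z₂` of its three edge values; three coordinates together with these
combinations are the non-Fano configuration.

Dyadic: a linear dependency is described by values on half-edges, and the coefficient of an edge is
the sum of its two half-edge values. Applying an odd map between fields to these values preserves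
zero coefficients, and at a terminal the four coefficients can be adjusted accordingly. So the
matroids over `GF(3)` and `GF(5)` agree (`exists_nonzero_dependency_map`).

Vertically connected: nonzero vectors of the row space have long support, so a low-order separation
with two nonspanning sides would cut `X` into two large parts, which tightness forbids
(`Tight.isVerticallyConnected`).

Far from the three outcomes: a rank-`t` perturbation yields row spaces meeting in codimension at
most `t` in each (`Close`), and this passes to orthogonal complements. In a frame space with basis
`b`, the total number of nonzero entries is at most twice the number of columns. The dimension of
`netSpace` is more than `|X|/3 - β`, so a frame space close to it has `t + 1` rows of bounded
weight; some combination of them is a nonzero vector of `netSpace` that is too light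
(`Tight.not_isFrameSpace`). The complement has dimension at least `2|X|/3 + 3m`, whereas rows of
weight at least 3 number at most `2|X|/3 + 8m/3`. The surplus `m/3` produces many rows of weight at
most 2, among them `t + 1` mutually distant ones; a combination of these gives a dependency of
weight at most 2 around nondeficient vertices, which a half-edge count excludes
(`Tight.card_active_add_two_le`, `Tight.card_light_rows_lt`). Finally, `GF(3)` has no proper
subfield. -/

/-- The vectors of `F^E` that vanish on `A`. -/
def zeroOn (F : Type*) {E : Type*} [Field F] (A : Set E) : Submodule F (E → F) where
  carrier := {u | ∀ e ∈ A, u e = 0}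
  add_mem' := fun {a b} ha hb e he => by rw [Pi.add_apply, ha e he, hb e he, add_zero]
  zero_mem' := fun _ _ => rfl
  smul_mem' := fun c u hu e he => by rw [Pi.smul_apply, hu e he, smul_zero]

@[simp] theorem mem_zeroOn {A : Set E} {u : E → F} : u ∈ zeroOn F A ↔ ∀ e ∈ A, u e = 0 := Iff.rfl

theorem linearMatroid_eRk [Finite E] {W : Type*} [AddCommGroup W] [Module F W] (v : E → W)
    (A : Set E) :
    (linearMatroid (K := F) v).eRk A = Module.finrank F (Submodule.span F (v '' A)) := by
  obtain ⟨I, hI⟩ := (linearMatroid (K := F) v).exists_isBasis' A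
  rw [← hI.encard_eq_eRk]
  have hIi : LinearIndepOn F v I := hI.indep
  have hspan : Submodule.span F (v '' I) = Submodule.span F (v '' A) := by
    refine le_antisymm (Submodule.span_mono (Set.image_mono hI.subset)) ?_
    rw [Submodule.span_le]
    rintro _ ⟨e, he, rfl⟩
    by_contra hne
    by_cases heI : e ∈ I
    · exact hne (Submodule.subset_span ⟨e, heI, rfl⟩)
    · exact hI.insert_not_indep ⟨he, heI⟩ (hIi.insert hne)
  rw [← hspan]
  have := Fintype.ofFinite I
  have h := finrank_span_eq_card (R := F) (b := fun x : I => v x) hIi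
  rw [Set.image_eq_range, h, ← Set.coe_fintypeCard]

/-- `U ⊓ zeroOn F A` is the common kernel of the coordinate functionals indexed by `A`, so its
codimension in `U` is the dimension of their span, which is the rank of `A`. -/
theorem eRk_toMatroid_ofSpace [Finite E] (U : Submodule F (E → F)) (A : Set E) :
    ∃ r : ℕ, (RepMatroid.ofSpace U).toMatroid.eRk A = r ∧
      r + Module.finrank F (U ⊓ zeroOn F A : Submodule F (E → F)) = Module.finrank F U := by
  refine ⟨_, linearMatroid_eRk (RepMatroid.coord U) A, ?_⟩
  rw [← Subspace.finrank_add_finrank_dualCoannihilator_eq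
    (Submodule.span F (RepMatroid.coord U '' A))]
  congr 1
  have : (U ⊓ zeroOn F A : Submodule F (E → F)) =
      (Submodule.span F (RepMatroid.coord U '' A)).dualCoannihilator.map U.subtype := by
    ext u
    simp only [Submodule.mem_inf, mem_zeroOn, Submodule.mem_map, Submodule.subtype_apply]
    constructor
    · rintro ⟨hu, h0⟩
      refine ⟨⟨u, hu⟩, ?_, rfl⟩
      rw [Submodule.mem_dualCoannihilator]
      intro φ hφ
      induction hφ using Submodule.span_induction with
      | mem x hx => obtain ⟨e, he, rfl⟩ := hx; exact h0 e he
      | zero => rfl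
      | add x y _ _ hx hy => rw [LinearMap.add_apply, hx, hy, add_zero]
      | smul c x _ hx => rw [LinearMap.smul_apply, hx, smul_zero]
    · rintro ⟨w, hw, rfl⟩
      rw [Submodule.mem_dualCoannihilator] at hw
      exact ⟨w.2, fun e he => hw _ (Submodule.subset_span ⟨e, he, rfl⟩)⟩
  rw [this]; exact Submodule.finrank_map_subtype_eq _ _

/-- A criterion for vertical connectivity in terms of the row space. -/
theorem isVerticallyConnected_ofSpace [Finite E] (U : Submodule F (E → F)) (k : ℕ)
    (h : ∀ A : Set E, U ⊓ zeroOn F A ≠ ⊥ → U ⊓ zeroOn F Aᶜ ≠ ⊥ →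
      Module.finrank F (U ⊓ zeroOn F A : Submodule F (E → F)) +
        Module.finrank F (U ⊓ zeroOn F Aᶜ : Submodule F (E → F)) + k ≤ Module.finrank F U + 1) :
    IsVerticallyConnected (RepMatroid.ofSpace U).toMatroid k := by
  set M := (RepMatroid.ofSpace U).toMatroid with hM
  have hE : M.E = Set.univ := rfl
  have hfin : M.Finite := ⟨by rw [hE]; exact Set.finite_univ⟩
  have hspan : ∀ A : Set E, U ⊓ zeroOn F A = ⊥ → M.Spanning A := by
    intro A hA
    rw [Matroid.spanning_iff_eRk_le (by rw [hE]; exact Set.subset_univ _), ← Matroid.eRk_ground, hE]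
    obtain ⟨r, hr, hr'⟩ := eRk_toMatroid_ofSpace U A
    obtain ⟨s, hs, hs'⟩ := eRk_toMatroid_ofSpace U Set.univ
    rw [← hM] at hr hs
    rw [hr, hs]
    rw [hA, finrank_bot] at hr'
    exact_mod_cast (by omega : s ≤ r)
  intro A _ hlt
  rw [hE, ← Set.compl_eq_univ_sdiff] at hlt ⊢
  by_cases hA : U ⊓ zeroOn F A = ⊥
  · exact Or.inl (hspan A hA)
  by_cases hB : U ⊓ zeroOn F Aᶜ = ⊥
  · exact Or.inr (hspan _ hB)
  exfalso
  have := h A hA hB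
  obtain ⟨r, hr, hr'⟩ := eRk_toMatroid_ofSpace U A
  obtain ⟨s, hs, hs'⟩ := eRk_toMatroid_ofSpace U Aᶜ
  obtain ⟨q, hq, hq'⟩ := eRk_toMatroid_ofSpace U Set.univ
  rw [← hM] at hr hs hq
  rw [← Matroid.eRk_ground, hE, hr, hs, hq] at hlt
  have hlt' : r + s + 1 < q + k := by exact_mod_cast hlt
  omega

theorem sum_coe_set_eq_sum [Fintype E] (I : Set E) [Fintype I] (f : E → F)
    (hf : ∀ e ∉ I, f e = 0) : ∑ e : I, f e = ∑ e, f e := by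
  classical
  rw [← Finset.sum_subset (Finset.subset_univ (Finset.univ.filter (· ∈ I)))
    (fun e _ he => hf e (by simpa using he))]
  exact (Finset.sum_subtype (Finset.univ.filter (· ∈ I)) (fun x => by simp) f).symm

/-- Independence in a represented matroid: no nonzero linear relation among the columns is
supported in the set. -/
theorem indep_ofSpace_iff [Fintype E] (U : Submodule F (E → F)) (I : Set E) :
    (RepMatroid.ofSpace U).toMatroid.Indep I ↔
      ∀ c : E → F, (∀ e ∉ I, c e = 0) → (∀ u ∈ U, c ⬝ᵥ u = 0) → c = 0 := by
  classical
  have key : (RepMatroid.ofSpace U).toMatroid.Indep I ↔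
      LinearIndependent F (fun e : I => RepMatroid.coord U e) := Iff.rfl
  rw [key, Fintype.linearIndependent_iff]
  constructor
  · intro h c hc hU
    have := h (fun e => c e) (by
      ext ⟨u, hu⟩
      have h1 := hU u hu
      rw [dotProduct, ← sum_coe_set_eq_sum I _ (fun e he => by rw [hc e he, zero_mul])] at h1
      simpa [LinearMap.sum_apply, RepMatroid.coord] using h1)
    funext e
    by_cases he : e ∈ I
    · exact this ⟨e, he⟩
    · exact hc e he
  · intro h g hg e
    have := h (fun e => if he : e ∈ I then g ⟨e, he⟩ else 0) (fun e he => by simp [he]) (by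
      intro u hu
      rw [dotProduct, ← sum_coe_set_eq_sum I _ (fun e he => by simp [he])]
      have h2 := LinearMap.congr_fun hg ⟨u, hu⟩
      simpa [LinearMap.sum_apply, RepMatroid.coord] using h2)
    have := congrFun this e
    simpa using this

/-- A functional that vanishes on the vectors of `U` that are zero on `X` agrees on `U` with
a combination of the coordinates in `X`. -/
theorem exists_supported_eq_on [Fintype E] (U : Submodule F (E → F)) (X : Set E) (c : E → F)
    (hc : ∀ u ∈ U, (∀ e ∈ X, u e = 0) → c ⬝ᵥ u = 0) :
    ∃ d : E → F, (∀ e ∉ X, d e = 0) ∧ ∀ u ∈ U, c ⬝ᵥ u = d ⬝ᵥ u := by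
  classical
  let K : U →ₗ[F] F :=
    { toFun := fun u => c ⬝ᵥ u.1
      map_add' := fun u w => dotProduct_add _ _ _
      map_smul' := fun a u => dotProduct_smul _ _ _ }
  have hK : K ∈ Submodule.span F (Set.range fun e : X => RepMatroid.coord U e) := by
    refine mem_span_of_iInf_ker_le_ker fun u hu => ?_
    rw [Submodule.mem_iInf] at hu
    exact hc u.1 u.2 fun e he => hu ⟨e, he⟩
  rw [Submodule.mem_span_range_iff_exists_fun] at hK
  obtain ⟨g, hg⟩ := hK
  refine ⟨fun e => if he : e ∈ X then g ⟨e, he⟩ else 0, fun e he => by simp [he], fun u hu => ?_⟩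
  have h2 := LinearMap.congr_fun hg ⟨u, hu⟩
  have h3 : K ⟨u, hu⟩ = c ⬝ᵥ u := rfl
  rw [← h3, ← h2, dotProduct, ← sum_coe_set_eq_sum X _ (fun e he => by simp [he])]
  simp [LinearMap.sum_apply, RepMatroid.coord]

theorem exists_ofSpace (M : RepMatroid F E) : ∃ U, RepMatroid.ofSpace U = M :=
  Quotient.exists_rep M

theorem isRepresentable_toMatroid [Finite E] (M : RepMatroid F E) :
    IsRepresentable F M.toMatroid := by
  obtain ⟨U, rfl⟩ := exists_ofSpace M
  let b := Module.finBasis F U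
  refine ⟨Module.finrank F U, Matrix.of fun i e => (b i : E → F) e, ?_⟩
  rw [← RepMatroid.toMatroid_ofMatrix]
  congr 1
  change RepMatroid.ofSpace _ = _
  congr 1
  have h : Submodule.span F (Set.range b) = ⊤ := b.span_eq
  have h2 := congrArg (Submodule.map U.subtype) h
  rw [Submodule.map_span, Submodule.map_top, Submodule.range_subtype, ← Set.range_comp] at h2
  exact h2

theorem isRepresentable_iff [Finite E] {N : Matroid E} :
    IsRepresentable F N ↔ ∃ M : RepMatroid F E, M.toMatroid = N := by
  constructor
  · rintro ⟨n, A, rfl⟩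
    exact ⟨RepMatroid.ofMatrix A, RepMatroid.toMatroid_ofMatrix A⟩
  · rintro ⟨M, rfl⟩
    exact isRepresentable_toMatroid M

theorem dotProduct_extend [Fintype E] (X : Set E) [Fintype {e // e ∉ X}]
    (c : {e // e ∉ X} → F) (u : E → F) :
    Function.extend Subtype.val c 0 ⬝ᵥ u = c ⬝ᵥ fun e => u e.1 := by
  classical
  have := sum_coe_set_eq_sum {e | e ∉ X} (fun e => Function.extend Subtype.val c 0 e * u e)
    (fun e he => by
      rw [Function.extend_apply', Pi.zero_apply, zero_mul]
      rintro ⟨a, rfl⟩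
      exact he a.2)
  rw [dotProduct, ← this, dotProduct]
  refine Eq.trans (Finset.sum_congr (by ext; simp) fun e _ => ?_) rfl
  rw [Subtype.val_injective.extend_apply]

/-! ### Independence in minors and relabellings. -/

theorem indep_delete_iff [Finite E] (M : RepMatroid F E) (X : Set E) (I : Set {e // e ∉ X}) :
    (M.delete X).toMatroid.Indep I ↔ M.toMatroid.Indep (Subtype.val '' I) := by
  classical
  have := Fintype.ofFinite E
  obtain ⟨U, rfl⟩ := exists_ofSpace M
  have hd : (RepMatroid.ofSpace U).delete X = RepMatroid.ofSpace
    (U.map (LinearMap.funLeft F F (Subtype.val : {e : E // e ∉ X} → E))) := rfl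
  rw [hd, indep_ofSpace_iff, indep_ofSpace_iff]
  constructor
  · intro h c hc hU
    have h0 : Function.extend Subtype.val (fun e : {e // e ∉ X} => c e.1) 0 = c := by
      funext e
      by_cases he : e ∈ X
      · rw [Function.extend_apply', hc, Pi.zero_apply]
        · rintro ⟨a, -, rfl⟩; exact a.2 he
        · rintro ⟨a, rfl⟩; exact a.2 he
      · exact Subtype.val_injective.extend_apply _ _ ⟨e, he⟩
    have := h (fun e => c e.1) (fun e he => hc _ (by
        rintro ⟨a, ha, hae⟩; exact he (Subtype.val_injective hae ▸ ha))) (by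
      rintro _ ⟨u, hu, rfl⟩
      have := hU u hu
      rw [← h0, dotProduct_extend] at this
      exact this)
    rw [← h0, this]
    funext e
    by_cases he : ∃ a : {e // e ∉ X}, a.1 = e
    · obtain ⟨a, rfl⟩ := he; rw [Subtype.val_injective.extend_apply]; rfl
    · rw [Function.extend_apply' _ _ _ he]
  · intro h c hc hU
    have := h (Function.extend Subtype.val c 0) (fun e he => by
      by_cases h' : ∃ a : {e // e ∉ X}, a.1 = e
      · obtain ⟨a, rfl⟩ := h'
        rw [Subtype.val_injective.extend_apply, hc]
        exact fun ha => he ⟨a, ha, rfl⟩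
      · rw [Function.extend_apply' _ _ _ h', Pi.zero_apply]) (by
      intro u hu
      rw [dotProduct_extend]
      exact hU _ ⟨u, hu, rfl⟩)
    funext e
    rw [← Subtype.val_injective.extend_apply c 0 e, this]; rfl

/-- Vectors of `U` that vanish on the basis `J` of `X` vanish on all of `X`. A relation holding on
those vectors therefore becomes a relation on all of `U` after correction by coordinates in `J`
(`exists_supported_eq_on`). The criterion depends only on the matroid, so contractions over
different fields can be compared. -/
theorem indep_contract_iff [Finite E] (M : RepMatroid F E) (X J : Set E)
    (hJ : Maximal (fun J => J ⊆ X ∧ M.toMatroid.Indep J) J) (I : Set {e // e ∉ X}) :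
    (M.contract X).toMatroid.Indep I ↔ M.toMatroid.Indep (Subtype.val '' I ∪ J) := by
  classical
  have := Fintype.ofFinite E
  obtain ⟨U, rfl⟩ := exists_ofSpace M
  have hd : (RepMatroid.ofSpace U).contract X = RepMatroid.ofSpace
    ((U ⊓ zeroOn F X).map (LinearMap.funLeft F F (Subtype.val : {e : E // e ∉ X} → E))) := rfl
  have hJX := hJ.prop.1
  have hJi := hJ.prop.2
  -- vectors of `U` that vanish on `J` vanish on `X`
  have hvan : ∀ u ∈ U, (∀ e ∈ J, u e = 0) → ∀ e ∈ X, u e = 0 := by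
    intro u hu h0 x hx
    by_cases hxJ : x ∈ J
    · exact h0 x hxJ
    have hni : ¬ (RepMatroid.ofSpace U).toMatroid.Indep (insert x J) := fun h =>
      hxJ (hJ.le_of_ge ⟨Set.insert_subset hx hJX, h⟩ (Set.subset_insert x J) (Set.mem_insert x J))
    rw [indep_ofSpace_iff] at hni hJi
    push Not at hni
    obtain ⟨c, hc, hcU, hc0⟩ := hni
    have hcx : c x ≠ 0 := fun hcx => hc0 (hJi c (fun e he => by
      by_cases hex : e = x
      · rw [hex, hcx]
      · exact hc e (by simp [he, hex])) hcU)
    have h1 := hcU u hu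
    rw [dotProduct, Finset.sum_eq_single x (fun e _ hex => by
      by_cases he : e ∈ J
      · rw [h0 e he, mul_zero]
      · rw [hc e (by simp [he, hex]), zero_mul]) (by simp)] at h1
    exact (mul_eq_zero.1 h1).resolve_left hcx
  rw [hd, indep_ofSpace_iff, indep_ofSpace_iff]
  rw [indep_ofSpace_iff] at hJi
  constructor
  · intro h c hc hU
    have hI0 : ∀ e ∉ X, c e = 0 := by
      have := h (fun e => c e.1) (fun e he => hc _ (by
        rintro (⟨a, ha, hae⟩ | h')
        · exact he (Subtype.val_injective hae ▸ ha)
        · exact e.2 (hJX h'))) (by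
        rintro _ ⟨u, ⟨hu, hu0⟩, rfl⟩
        have h2 := hU u hu
        rw [dotProduct, ← sum_coe_set_eq_sum {e | e ∉ X} _ (fun e he => by
          rw [mem_zeroOn.1 hu0 e (by simpa using he), mul_zero])] at h2
        rw [← h2]
        exact Fintype.sum_equiv (Equiv.refl _) _ _ fun e => rfl)
      exact fun e he => congrFun this ⟨e, he⟩
    refine hJi c (fun e he => ?_) hU
    by_cases heX : e ∈ X
    · exact hc e (by
        rintro (⟨a, ha, rfl⟩ | h')
        · exact a.2 heX
        · exact he h')
    · exact hI0 e heX
  · intro h c hc hU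
    obtain ⟨d, hd, hdU⟩ := exists_supported_eq_on U J (Function.extend Subtype.val c 0) (by
      intro u hu h0
      rw [dotProduct_extend]
      exact hU _ ⟨u, ⟨hu, hvan u hu h0⟩, rfl⟩)
    have := h (Function.extend Subtype.val c 0 - d) (fun e he => by
      rw [Pi.sub_apply, hd e (fun h' => he (Or.inr h')), sub_zero]
      by_cases h' : ∃ a : {e // e ∉ X}, a.1 = e
      · obtain ⟨a, rfl⟩ := h'
        rw [Subtype.val_injective.extend_apply, hc]
        exact fun ha => he (Or.inl ⟨a, ha, rfl⟩)
      · rw [Function.extend_apply' _ _ _ h', Pi.zero_apply]) (by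
      intro u hu
      rw [sub_dotProduct, hdU u hu, sub_self])
    funext e
    have h1 := congrFun this e.1
    rw [Pi.sub_apply, Subtype.val_injective.extend_apply, hd e.1 (fun h' => e.2 (hJX h'))] at h1
    simpa using h1

theorem indep_relabel_iff {E' : Type*} [Finite E] [Finite E'] (σ : E ≃ E') (M : RepMatroid F E)
    (I : Set E') : (M.relabel σ).toMatroid.Indep I ↔ M.toMatroid.Indep (σ ⁻¹' I) := by
  classical
  have := Fintype.ofFinite E
  have := Fintype.ofFinite E'
  obtain ⟨U, rfl⟩ := exists_ofSpace M
  have hd : (RepMatroid.ofSpace U).relabel σ = RepMatroid.ofSpace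
    (U.comap (LinearMap.funLeft F F σ)) := rfl
  rw [hd, indep_ofSpace_iff, indep_ofSpace_iff]
  have hdot : ∀ (c u : E' → F), c ⬝ᵥ u = (c ∘ σ) ⬝ᵥ (u ∘ σ) := fun c u =>
    (Fintype.sum_equiv σ _ _ fun e => rfl).symm
  constructor
  · intro h c hc hU
    have := h (c ∘ σ.symm) (fun e he => hc _ (by simpa using he)) (by
      intro u hu
      rw [hdot]
      have := hU _ hu
      rw [← this]
      congr 1
      funext e; simp)
    funext e
    simpa using congrFun this (σ e)
  · intro h c hc hU
    have := h (c ∘ σ) (fun e he => hc _ he) (by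
      intro u hu
      have := hU (u ∘ σ.symm) (by
        change (u ∘ σ.symm) ∘ σ ∈ U
        simpa [Function.comp_assoc] using hu)
      rw [hdot] at this
      simpa [Function.comp_assoc] using this)
    funext e
    simpa using congrFun this (σ.symm e)

end RowSpaces

/-! ## The class of dyadic matroids -/

/-- `M` is itself a ternary representation, so only the quinary one has to be found. -/
theorem exists_same_matroid_iff {E : Type*} [Finite E] {M : RepMatroid (ZMod 3) E} :
    IsDyadic M.toMatroid ↔ ∃ M' : RepMatroid (ZMod 5) E, M'.toMatroid = M.toMatroid :=
  ⟨fun h => isRepresentable_iff.1 h.2,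
    fun h => ⟨isRepresentable_toMatroid M, isRepresentable_iff.2 h⟩⟩

theorem toMatroid_eq_iff {F F' E : Type*} [Field F] [Field F'] [Finite E]
    {M : RepMatroid F E} {M' : RepMatroid F' E} :
    M'.toMatroid = M.toMatroid ↔ ∀ I, M'.toMatroid.Indep I ↔ M.toMatroid.Indep I := by
  refine ⟨fun h I => by rw [h], fun h => Matroid.ext_indep ?_ fun I _ => h I⟩
  obtain ⟨U, rfl⟩ := exists_ofSpace M
  obtain ⟨U', rfl⟩ := exists_ofSpace M'
  rfl

/-- The same operation is applied to a quinary representation; the criteria for independence in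
minors depend only on the common matroid. -/
theorem dyadicClass_isMinorClosed : dyadicClass.IsMinorClosed where
  delete_mem E _ M X hM := by
    obtain ⟨M', h⟩ := exists_same_matroid_iff.1 hM
    refine exists_same_matroid_iff.2 ⟨M'.delete X, toMatroid_eq_iff.2 fun I => ?_⟩
    rw [indep_delete_iff, indep_delete_iff, h]
  contract_mem E _ M X hM := by
    obtain ⟨M', h⟩ := exists_same_matroid_iff.1 hM
    refine exists_same_matroid_iff.2 ⟨M'.contract X, toMatroid_eq_iff.2 fun I => ?_⟩
    obtain ⟨J, hJ⟩ := M.toMatroid.exists_isBasis' X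
    have hJ' : Maximal (fun J => J ⊆ X ∧ M.toMatroid.Indep J) J := by
      have := hJ
      rw [Matroid.IsBasis'] at this
      exact ⟨⟨this.prop.2, this.prop.1⟩, fun K hK hle => this.le_of_ge ⟨hK.2, hK.1⟩ hle⟩
    rw [indep_contract_iff M X J hJ', indep_contract_iff M' X J (by rw [h]; exact hJ'), h]
  relabel_mem E E' _ _ σ M hM := by
    obtain ⟨M', h⟩ := exists_same_matroid_iff.1 hM
    refine exists_same_matroid_iff.2 ⟨M'.relabel σ, toMatroid_eq_iff.2 fun I => ?_⟩
    rw [indep_relabel_iff, indep_relabel_iff, h]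
end
noncomputable section

/-! ## The class of dyadic matroids is proper -/

/-- Collinearity is a property of the matroid, so it transfers between representations over
different fields. -/
theorem mem_span_pair_of_linearMatroid_eq {K K' E W W' : Type*} [Field K] [Field K'] [Finite E]
    [AddCommGroup W] [Module K W] [AddCommGroup W'] [Module K' W'] {v : E → W} {v' : E → W'}
    (h : linearMatroid (K := K) v = linearMatroid (K := K') v') {i j k : E}
    (hij : LinearIndepOn K v {i, j}) (hki : k ≠ i) (hkj : k ≠ j) :
    v' k ∈ Submodule.span K' {v' i, v' j} ↔ v k ∈ Submodule.span K {v i, v j} := by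
  have h1 : ∀ I, LinearIndepOn K v I ↔ LinearIndepOn K' v' I := fun I => by
    rw [← linearMatroid_indep, h, linearMatroid_indep]
  have hk : k ∉ ({i, j} : Set E) := by simp [hki, hkj]
  have h2 := h1 (insert k {i, j})
  rw [linearIndepOn_insert hk, linearIndepOn_insert hk, ← h1] at h2
  simp only [hij, true_and, Set.image_pair] at h2
  tauto

/-- Columns of a ternary matrix whose vector matroid is not representable over `GF(5)`. -/
def nonDyadicColumns : Fin 10 → Fin 3 → ZMod 3 :=
  ![![1, 0, 0], ![0, 1, 0], ![0, 0, 1], ![1, 1, 1], ![1, 1, 0], ![1, 0, 1], ![0, 1, 1],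
    ![1, 2, 0], ![1, 0, 2], ![1, 2, 2]]

/-- In a projective frame `v 0, v 1, v 2, v 3` the incidences determine the remaining points: with
`v 3` scaled to `(1,1,1)`, the points 4 to 9 become `(1,1,0)`, `(1,0,1)`, `(0,1,1)`, `(1,-1,0)`,
`(1,0,-1)`, `(1,-1,-1)`. The last one lies on the line through points 4 and 5 only if `3 = 0`. The
proof carries all scale factors along instead of normalizing. -/
theorem not_exists_quinary_configuration {W : Type*} [AddCommGroup W] [Module (ZMod 5) W]
    (v : Fin 10 → W)
    (hpos : ∀ i j k, (∃ x y : ZMod 3, x • nonDyadicColumns i + y • nonDyadicColumns j =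
      nonDyadicColumns k) → i ≠ j → k ≠ i → k ≠ j → ∃ x y : ZMod 5, x • v i + y • v j = v k)
    (hneg : ∀ i j k, (¬ ∃ x y : ZMod 3, x • nonDyadicColumns i + y • nonDyadicColumns j =
      nonDyadicColumns k) → i ≠ j → k ≠ i → k ≠ j → ¬ ∃ x y : ZMod 5, x • v i + y • v j = v k)
    (h4 : ∃ x y z : ZMod 5, x • v 0 + y • v 1 + z • v 2 = v 3)
    (h3 : ∀ x y z : ZMod 5, x • v 0 + y • v 1 + z • v 2 = 0 → x = 0 ∧ y = 0 ∧ z = 0) : False := by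
  obtain ⟨x, y, z, hD⟩ := h4
  have hx : x ≠ 0 := fun h => hneg 1 2 3 (by decide) (by decide) (by decide) (by decide)
    ⟨y, z, by rw [← hD, h]; simp⟩
  have hy : y ≠ 0 := fun h => hneg 0 2 3 (by decide) (by decide) (by decide) (by decide)
    ⟨x, z, by rw [← hD, h]; simp⟩
  have hz : z ≠ 0 := fun h => hneg 0 1 3 (by decide) (by decide) (by decide) (by decide)
    ⟨x, y, by rw [← hD, h]; simp⟩
  have hcoef : ∀ p q r p' q' r' : ZMod 5,
      p • v 0 + q • v 1 + r • v 2 = p' • v 0 + q' • v 1 + r' • v 2 → p = p' ∧ q = q' ∧ r = r' := by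
    intro p q r p' q' r' h
    have := h3 (p - p') (q - q') (r - r') (by
      rw [← sub_eq_zero] at h
      rw [← h]; module)
    simpa only [sub_eq_zero] using this
  obtain ⟨f1, f2, hF⟩ := hpos 0 1 4 (by decide) (by decide) (by decide) (by decide)
  obtain ⟨f3, f4, hF'⟩ := hpos 3 2 4 (by decide) (by decide) (by decide) (by decide)
  obtain ⟨g1, g2, hG⟩ := hpos 0 2 5 (by decide) (by decide) (by decide) (by decide)
  obtain ⟨g3, g4, hG'⟩ := hpos 3 1 5 (by decide) (by decide) (by decide) (by decide)
  obtain ⟨l1, l2, hL⟩ := hpos 1 2 6 (by decide) (by decide) (by decide) (by decide)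
  obtain ⟨l3, l4, hL'⟩ := hpos 3 0 6 (by decide) (by decide) (by decide) (by decide)
  obtain ⟨m1, m2, hH⟩ := hpos 0 1 7 (by decide) (by decide) (by decide) (by decide)
  obtain ⟨m3, m4, hH'⟩ := hpos 6 5 7 (by decide) (by decide) (by decide) (by decide)
  obtain ⟨k1, k2, hK⟩ := hpos 0 2 8 (by decide) (by decide) (by decide) (by decide)
  obtain ⟨k3, k4, hK'⟩ := hpos 6 4 8 (by decide) (by decide) (by decide) (by decide)
  obtain ⟨q1, q2, hQ⟩ := hpos 7 2 9 (by decide) (by decide) (by decide) (by decide)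
  obtain ⟨q3, q4, hQ'⟩ := hpos 8 1 9 (by decide) (by decide) (by decide) (by decide)
  obtain ⟨r1, r2, hR⟩ := hpos 4 5 9 (by decide) (by decide) (by decide) (by decide)
  have hQb : q1 ≠ 0 := fun h => hneg 0 2 9 (by decide) (by decide) (by decide) (by decide)
    ⟨0, q2, by rw [← hQ, h]; simp⟩
  have hHa : m1 ≠ 0 := fun h => hneg 2 1 7 (by decide) (by decide) (by decide) (by decide)
    ⟨0, m2, by rw [← hH, h]; simp⟩
  obtain ⟨F1, F2, F3⟩ := hcoef f1 f2 0 (f3 * x) (f3 * y) (f3 * z + f4) (by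
    rw [zero_smul, add_zero, hF, ← hF', ← hD]; module)
  obtain ⟨G1, G2, G3⟩ := hcoef g1 0 g2 (g3 * x) (g3 * y + g4) (g3 * z) (by
    rw [zero_smul, add_zero, hG, ← hG', ← hD]; module)
  obtain ⟨L1, L2, L3⟩ := hcoef 0 l1 l2 (l3 * x + l4) (l3 * y) (l3 * z) (by
    rw [zero_smul, zero_add, hL, ← hL', ← hD]; module)
  obtain ⟨M1, M2, M3⟩ := hcoef m1 m2 0 (m4 * g1) (m3 * l1) (m3 * l2 + m4 * g2) (by
    rw [zero_smul, add_zero, hH, ← hH', ← hL, ← hG]; module)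
  obtain ⟨K1, K2, K3⟩ := hcoef k1 0 k2 (k4 * f1) (k3 * l1 + k4 * f2) (k3 * l2) (by
    rw [zero_smul, add_zero, hK, ← hK', ← hL, ← hF]; module)
  obtain ⟨Q1, Q2, Q3⟩ := hcoef (q1 * m1) (q1 * m2) q2 (q3 * k1) (q4) (q3 * k2) (by
    rw [← hH, ← hK] at *; rw [← hQ] at hQ'; rw [add_assoc]
    refine Eq.trans ?_ (hQ'.symm.trans ?_) <;> module)
  obtain ⟨R1, R2, R3⟩ := hcoef (q1 * m1) (q1 * m2) q2 (r1 * f1 + r2 * g1) (r1 * f2) (r2 * g2) (by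
    rw [← hH] at hQ; rw [← hF, ← hG, ← hQ] at hR
    refine Eq.trans ?_ (hR.symm.trans ?_) <;> module)
  -- The identities are obtained by cancelling the nonzero coordinates `y`, `z` of `v 3`. In the end
  -- each of the two summands of `q1 * m1` in `R1` equals `-(q1 * m1)`, whence `3 * (q1 * m1) = 0`.
  have A1 : m3 * l3 = -(m4 * g3) := mul_right_cancel₀ hz (by linear_combination -M3 - m3 * L3 - m4 * G3)
  have A2 : k3 * l3 = -(k4 * f3) := mul_right_cancel₀ hy (by linear_combination -K2 - k3 * L2 - k4 * F2)
  have A3 : r1 * f3 * x = -(q1 * m1) := mul_right_cancel₀ hy (by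
    linear_combination -x * R2 + x * q1 * M2 + x * q1 * m3 * L2 + x * y * q1 * A1 -
      x * r1 * F2 + q1 * y * M1 + q1 * y * m4 * G1)
  have A4 : r2 * g3 * x = -(q1 * m1) := mul_right_cancel₀ hz (by
    linear_combination -x * R3 + x * Q3 - x * r2 * G3 + x * q3 * K3 + x * q3 * k3 * L3 +
      q3 * x * z * A2 + q3 * z * K1 + q3 * z * k4 * F1 + z * Q1)
  have h5 : (3 : ZMod 5) * (q1 * m1) = 0 := by
    linear_combination R1 + r1 * F1 + r2 * G1 + A3 + A4
  have h6 : (3 : ZMod 5) ≠ 0 := by decide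
  simp [hQb, hHa, h6] at h5

theorem dyadicClass_isProper : dyadicClass.IsProper := by
  refine ⟨Fin 10, inferInstance,
    RepMatroid.ofMatrix (Matrix.of fun i e => nonDyadicColumns e i), fun h => ?_⟩
  obtain ⟨-, n, A, hA⟩ := h
  rw [RepMatroid.toMatroid_ofMatrix] at hA
  have hM : linearMatroid (K := ZMod 3) nonDyadicColumns = linearMatroid (K := ZMod 5) A.col :=
    hA.symm
  have hind : ∀ i j : Fin 10, i ≠ j → LinearIndepOn (ZMod 3) nonDyadicColumns {i, j} := by
    intro i j hij
    rw [LinearIndepOn.pair_iff _ hij]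
    revert i j
    decide
  have key : ∀ i j k, i ≠ j → k ≠ i → k ≠ j →
      ((∃ x y : ZMod 5, x • A.col i + y • A.col j = A.col k) ↔
      ∃ x y : ZMod 3, x • nonDyadicColumns i + y • nonDyadicColumns j = nonDyadicColumns k) := by
    intro i j k hij hki hkj
    have := mem_span_pair_of_linearMatroid_eq hM (hind i j hij) hki hkj
    simpa only [Submodule.mem_span_pair] using this
  have hI : LinearIndepOn (ZMod 5) A.col {0, 1, 2} := by
    rw [← linearMatroid_indep, ← hM, linearMatroid_indep,
      show ({0, 1, 2} : Set (Fin 10)) = insert 2 {0, 1} by ext; simp; tauto,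
      linearIndepOn_insert (by simp), Set.image_pair, Submodule.mem_span_pair]
    exact ⟨hind 0 1 (by decide), by decide⟩
  have hD : ¬ LinearIndepOn (ZMod 5) A.col (insert 3 {0, 1, 2}) := by
    rw [← linearMatroid_indep, ← hM, linearMatroid_indep, linearIndepOn_insert (by simp)]
    rintro ⟨-, h⟩
    apply h
    rw [Set.image_insert_eq, Set.image_pair, Submodule.mem_span_insert]
    exact ⟨1, _, Submodule.mem_span_pair.2 ⟨1, 1, rfl⟩, by decide⟩
  refine not_exists_quinary_configuration A.col
    (fun i j k h h1 h2 h3 => (key i j k h1 h2 h3).2 h)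
    (fun i j k h h1 h2 h3 => mt (key i j k h1 h2 h3).1 h) ?_ ?_
  · rw [linearIndepOn_insert (by simp)] at hD
    have : A.col 3 ∈ Submodule.span (ZMod 5) (A.col '' {0, 1, 2}) := by tauto
    rw [Set.image_insert_eq, Set.image_pair, Submodule.mem_span_insert] at this
    obtain ⟨x, w, hw, h⟩ := this
    obtain ⟨y, z, rfl⟩ := Submodule.mem_span_pair.1 hw
    exact ⟨x, y, z, by rw [h, add_assoc]⟩
  · intro x y z h
    rw [linearIndepOn_iff''] at hI
    have h' := hI {0, 1, 2} (fun i => if i = 0 then x else if i = 1 then y else if i = 2 then z else 0)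
      (by simp) (by simp +contextual) (by simpa [add_assoc] using h)
    exact ⟨by simpa using h' 0, by simpa using h' 1, by simpa using h' 2⟩
end
noncomputable section

/-! ## Perturbations and frame matroids -/

section Perturbation

open Module

variable {F E : Type*} [Field F]

/-- The orthogonal complement of a row space. -/
def perp [Fintype E] (U : Submodule F (E → F)) : Submodule F (E → F) where
  carrier := {w | ∀ u ∈ U, w ⬝ᵥ u = 0}
  add_mem' := fun {a b} ha hb u hu => by rw [add_dotProduct, ha u hu, hb u hu, add_zero]
  zero_mem' := fun u _ => zero_dotProduct u
  smul_mem' := fun c w hw u hu => by rw [smul_dotProduct, hw u hu, smul_zero]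

theorem mem_perp [Fintype E] {U : Submodule F (E → F)} {w : E → F} :
    w ∈ perp U ↔ ∀ u ∈ U, w ⬝ᵥ u = 0 := Iff.rfl

theorem finrank_perp [Fintype E] (U : Submodule F (E → F)) :
    finrank F U + finrank F (perp U) = Fintype.card E := by
  classical
  have h := Subspace.finrank_add_finrank_dualAnnihilator_eq (K := F) U
  have h1 : (perp U).map (dotProductEquiv F E).toLinearMap = U.dualAnnihilator := by
    ext f
    rw [Submodule.mem_map, Submodule.mem_dualAnnihilator]
    constructor
    · rintro ⟨w, hw, rfl⟩ u hu
      exact hw u hu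
    · intro hf
      refine ⟨(dotProductEquiv F E).symm f, fun u hu => ?_, by simp⟩
      have : dotProductEquiv F E ((dotProductEquiv F E).symm f) u = 0 := by simpa using hf u hu
      exact this
  rw [← h1, LinearEquiv.finrank_map_eq, finrank_fintype_fun_eq_card] at h
  exact h

theorem perp_sup [Fintype E] (U V : Submodule F (E → F)) : perp (U ⊔ V) = perp U ⊓ perp V := by
  ext w
  rw [Submodule.mem_inf]
  refine ⟨fun h => ⟨fun u hu => h u (Submodule.mem_sup_left hu),
    fun u hu => h u (Submodule.mem_sup_right hu)⟩, fun h u hu => ?_⟩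
  obtain ⟨a, ha, b, hb, rfl⟩ := Submodule.mem_sup.1 hu
  rw [dotProduct_add, h.1 a ha, h.2 b hb, add_zero]

/-- Two subspaces whose intersection has codimension at most `t` in each of them. -/
def Close (t : ℕ) (W U : Submodule F (E → F)) : Prop :=
  finrank F W ≤ finrank F (W ⊓ U : Submodule F (E → F)) + t ∧
    finrank F U ≤ finrank F (W ⊓ U : Submodule F (E → F)) + t

/-- The codimension of `perp W ⊓ perp U = perp (W ⊔ U)` in `perp W` is `dim (W ⊔ U) - dim W = dim U
- dim (W ⊓ U)`; the roles of the two conditions are exchanged. -/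
theorem Close.perp [Fintype E] {t : ℕ} {W U : Submodule F (E → F)} (h : Close t W U) :
    Close t (perp W) (perp U) := by
  have h1 := finrank_perp W
  have h2 := finrank_perp U
  have h3 := finrank_perp (W ⊔ U)
  have h4 := Submodule.finrank_sup_add_finrank_inf_eq W U
  obtain ⟨h5, h6⟩ := h
  unfold Close
  rw [← perp_sup]
  omega

/-- Restricting a map to `K` lowers its rank by at most the codimension of `K`, as the image of a
complement shows. -/
theorem finrank_range_le_map {V V' : Type*} [AddCommGroup V] [Module F V] [AddCommGroup V']
    [Module F V'] [FiniteDimensional F V] (f : V →ₗ[F] V') (K : Submodule F V) :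
    finrank F (LinearMap.range f) + finrank F K ≤ finrank F (K.map f) + finrank F V := by
  obtain ⟨K', hK'⟩ := K.exists_isCompl
  have h1 : LinearMap.range f = K.map f ⊔ K'.map f := by
    rw [← Submodule.map_sup, hK'.sup_eq_top, LinearMap.range_eq_map]
  have h2 := Submodule.finrank_add_le_finrank_add_finrank (K.map f) (K'.map f)
  have h3 := Submodule.finrank_map_le f K'
  have h4 := Submodule.finrank_add_eq_of_isCompl hK'
  rw [h1]
  omega

/-- The linear equivalence scaling the columns. -/
def scaleColumns (d : E → Fˣ) : (E → F) ≃ₗ[F] (E → F) :=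
  LinearEquiv.piCongrRight fun e => LinearEquiv.smulOfUnit (d e)

theorem scaleColumns_apply (d : E → Fˣ) (u : E → F) (e : E) :
    scaleColumns d u e = (d e : F) * u e := rfl

theorem ScaleEquiv.exists_map {U V : Submodule F (E → F)} (h : ScaleEquiv U V) :
    ∃ d : E → Fˣ, U.map (scaleColumns d).toLinearMap = V := by
  obtain ⟨d, hd⟩ := h
  refine ⟨d, ?_⟩
  ext w
  rw [Submodule.mem_map]
  constructor
  · rintro ⟨u, hu, rfl⟩
    exact (hd u).1 hu
  · intro hw
    refine ⟨(scaleColumns d).symm w, (hd _).2 ?_, by simp⟩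
    have h1 : (fun e => (d e : F) * (scaleColumns d).symm w e) = w :=
      (scaleColumns d).apply_symm_apply w
    rwa [h1]

theorem scaleEquiv_map (U : Submodule F (E → F)) (d : E → Fˣ) :
    ScaleEquiv U (U.map (scaleColumns d).toLinearMap) := by
  refine ⟨d, fun u => ?_⟩
  have : (fun e => (d e : F) * u e) = (scaleColumns d).toLinearMap u := rfl
  rw [this, Submodule.mem_map]
  refine ⟨fun h => ⟨u, h, rfl⟩, ?_⟩
  rintro ⟨v, hv, h⟩
  exact (scaleColumns d).injective h ▸ hv

theorem span_row_eq_range {n : ℕ} (A : Matrix (Fin n) E F) :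
    Submodule.span F (Set.range A.row) = LinearMap.range A.vecMulLinear :=
  (range_vecMulLinear A).symm

/-- On the left kernel of `P`, whose codimension is the rank of `P`, left multiplication by `A` and
by `A + P` agree; the image lies in both row spaces. -/
theorem close_rowSpace_add [Fintype E] {n t : ℕ} (A P : Matrix (Fin n) E F) (hP : P.rank ≤ t) :
    Close t (Submodule.span F (Set.range A.row)) (Submodule.span F (Set.range (A + P).row)) := by
  classical
  set K := LinearMap.ker P.vecMulLinear with hK
  have h1 : n ≤ finrank F K + t := by
    have := LinearMap.finrank_range_add_finrank_ker P.vecMulLinear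
    rw [Matrix.rank_eq_finrank_span_row, span_row_eq_range] at hP
    rw [finrank_fin_fun, ← hK] at this
    omega
  have h2 : K.map A.vecMulLinear = K.map (A + P).vecMulLinear := by
    ext w
    simp only [Submodule.mem_map]
    refine exists_congr fun v => and_congr_right fun hv => ?_
    have hv' : Matrix.vecMul v P = 0 := hv
    simp [hv']
  have h3 := finrank_range_le_map A.vecMulLinear K
  have h4 := finrank_range_le_map (A + P).vecMulLinear K
  have h5 : K.map A.vecMulLinear ≤
      LinearMap.range A.vecMulLinear ⊓ LinearMap.range (A + P).vecMulLinear :=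
    le_inf LinearMap.map_le_range (h2 ▸ LinearMap.map_le_range)
  have h6 := Submodule.finrank_mono h5
  rw [← h2] at h4
  rw [finrank_fin_fun] at h3 h4
  unfold Close
  rw [span_row_eq_range, span_row_eq_range]
  omega

/-- The scaling that carries the row space of `A + P` to `U` is applied to the row space of `A` as
well, which does not change the class `N`. -/
theorem exists_close_of_isPerturbation [Fintype E] {t : ℕ} {N : RepMatroid F E}
    {U : Submodule F (E → F)} (h : N.IsPerturbation t (RepMatroid.ofSpace U)) :
    ∃ W, RepMatroid.ofSpace W = N ∧ Close t W U := by
  obtain ⟨n, A, P, rfl, hP, h2⟩ := h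
  obtain ⟨d, hd⟩ := ScaleEquiv.exists_map (Quotient.exact h2)
  refine ⟨_, (Quotient.sound (scaleEquiv_map (Submodule.span F (Set.range A.row)) d)).symm, ?_⟩
  have h3 := close_rowSpace_add A P hP
  rw [← hd]
  unfold Close at h3 ⊢
  rw [← Submodule.map_inf _ (scaleColumns d).injective]
  simpa only [LinearEquiv.finrank_map_eq] using h3

/-! ### Frame spaces and light combinations. -/

/-- The row spaces of matrices with at most two nonzero entries in each column. -/
def IsFrameSpace (W : Submodule F (E → F)) : Prop :=
  ∃ (κ : Type) (_ : Fintype κ) (b : κ → E → F), LinearIndependent F b ∧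
    Submodule.span F (Set.range b) = W ∧ ∀ e, {i | b i e ≠ 0}.ncard ≤ 2

/-- A maximal independent subfamily of the rows spans the same space and has no more nonzero entries
in any column. -/
theorem isFrameSpace_of_isFrame {W : Submodule F (E → F)}
    (h : (RepMatroid.ofSpace W).IsFrame) : IsFrameSpace W := by
  obtain ⟨n, A, hA, h2⟩ := h
  obtain ⟨d, hd⟩ := ScaleEquiv.exists_map (Quotient.exact hA)
  obtain ⟨κ, a, ha, hs, hli⟩ := exists_linearIndependent' F A.row
  have : Finite κ := Finite.of_injective a ha
  refine ⟨κ, Fintype.ofFinite κ, fun i => scaleColumns d (A.row (a i)), ?_, ?_, ?_⟩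
  · exact hli.map' _ (scaleColumns d).ker
  · rw [← hd, ← hs, Submodule.map_span, ← Set.range_comp]
    rfl
  · intro e
    refine le_trans ?_ (h2 e)
    refine Set.ncard_le_ncard_of_injOn a ?_ ha.injOn (Set.toFinite _)
    intro i hi
    simpa [scaleColumns_apply] using hi

theorem isFrameSpace_perp_of_isFrame_dual [Fintype E] {W : Submodule F (E → F)}
    (h : (RepMatroid.ofSpace W).dual.IsFrame) : IsFrameSpace (perp W) :=
  isFrameSpace_of_isFrame h

/-- Among more than `t` independent vectors of a space close to `U`, some nontrivial combination
lies in `U`. -/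
theorem Close.exists_combination [Finite E] {t : ℕ} {W U : Submodule F (E → F)}
    (h : Close t W U) {κ : Type*} [Fintype κ] {b : κ → E → F} (hb : LinearIndependent F b)
    (hW : ∀ i, b i ∈ W) (S : Finset κ) (hS : t < S.card) :
    ∃ c : κ → F, (∀ i ∉ S, c i = 0) ∧ ∑ i, c i • b i ∈ U ∧ ∑ i, c i • b i ≠ 0 := by
  classical
  set Y := Submodule.span F (Set.range fun i : S => b i) with hY
  have hYW : Y ≤ W := Submodule.span_le.2 (by rintro _ ⟨i, rfl⟩; exact hW i)
  have h1 : finrank F Y = S.card := by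
    have := finrank_span_eq_card (hb.comp (fun i : S => (i : κ)) Subtype.val_injective)
    rw [Fintype.card_coe] at this
    exact this
  have h2 := Submodule.finrank_sup_add_finrank_inf_eq Y (W ⊓ U)
  have h3 : finrank F (Y ⊔ (W ⊓ U) : Submodule F (E → F)) ≤ finrank F W :=
    Submodule.finrank_mono (sup_le hYW inf_le_left)
  have h4 := h.1
  have h5 : 0 < finrank F (Y ⊓ (W ⊓ U) : Submodule F (E → F)) := by omega
  obtain ⟨y, hy, hy0⟩ := Submodule.exists_mem_ne_zero_of_ne_bot
    (fun h0 : Y ⊓ (W ⊓ U) = ⊥ => by rw [h0, finrank_bot] at h5; exact absurd h5 (lt_irrefl _))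
  obtain ⟨c, hc⟩ := (Submodule.mem_span_range_iff_exists_fun F).1 hy.1
  have key : ∑ i, (fun i => if h : i ∈ S then c ⟨i, h⟩ else 0) i • b i = y := by
    rw [← hc, ← Finset.sum_subset (Finset.subset_univ S)]
    · rw [← Finset.sum_coe_sort]
      exact Finset.sum_congr rfl fun i _ => by simp
    · intro i _ hi
      simp [hi]
  exact ⟨fun i => if h : i ∈ S then c ⟨i, h⟩ else 0, fun i hi => by simp [hi],
    by rw [key]; exact hy.2.2, by rw [key]; exact hy0⟩

/-- A subfield contains all images of natural numbers, hence all of the prime field. -/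
theorem not_isConfinedToProperSubfield {N : RepMatroid (ZMod 3) E} :
    ¬ N.IsConfinedToProperSubfield := by
  rintro ⟨K, hK, -⟩
  refine hK (top_unique fun x _ => ?_)
  rw [← ZMod.natCast_zmod_val x]
  exact natCast_mem K _

end Perturbation
end
noncomputable section

/-! ## Bipartite cubic graphs of large girth -/

/-- A properly `3`-edge-coloured bipartite cubic (multi)graph: the vertices are the pairs
`(b, x)` with `b : Bool` and `x : P`, the edges are the pairs `(x, i)`, and `(x, i)` joins
`(false, x)` to `(true, s i x)`. -/
structure CubicGraph (P : Type) where
  s : Fin 3 → P → P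
  s_s : ∀ i x, s i (s i x) = x

namespace CubicGraph

variable {P : Type} (G : CubicGraph P)

/-- The end of an edge on the `false` side. -/
def endL (e : P × Fin 3) : Bool × P := (false, e.1)

/-- The end of an edge on the `true` side. -/
def endR (e : P × Fin 3) : Bool × P := (true, G.s e.2 e.1)

/-- The edge of colour `i` at the vertex `v`. -/
def ed (v : Bool × P) (i : Fin 3) : P × Fin 3 := (if v.1 then G.s i v.2 else v.2, i)

/-- The neighbour of `v` along the edge of colour `i`. -/
def step (i : Fin 3) (v : Bool × P) : Bool × P := (!v.1, G.s i v.2)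

theorem step_step (i : Fin 3) (v : Bool × P) : G.step i (G.step i v) = v := by
  obtain ⟨b, x⟩ := v
  simp [step, G.s_s]

@[simp] theorem ed_snd (v : Bool × P) (i : Fin 3) : (G.ed v i).2 = i := rfl

theorem ed_step (v : Bool × P) (i : Fin 3) : G.ed (G.step i v) i = G.ed v i := by
  obtain ⟨_ | _, x⟩ := v <;> simp [step, ed, G.s_s]

theorem ed_endL (e : P × Fin 3) : G.ed (endL e) e.2 = e := rfl

theorem ed_endR (e : P × Fin 3) : G.ed (G.endR e) e.2 = e := by
  simp [ed, endR, G.s_s]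

theorem eq_end_of_ed_eq {v : Bool × P} {i : Fin 3} {e : P × Fin 3} (h : G.ed v i = e) :
    e.2 = i ∧ (v = endL e ∨ v = G.endR e) := by
  subst h
  obtain ⟨_ | _, x⟩ := v <;> simp [ed, endL, endR, G.s_s]

theorem step_endL (e : P × Fin 3) : G.step e.2 (endL e) = G.endR e := rfl

theorem step_endR (e : P × Fin 3) : G.step e.2 (G.endR e) = endL e := by
  simp [endL, endR, step, G.s_s]

theorem ed_inj {v v' : Bool × P} {i i' : Fin 3} (h : G.ed v i = G.ed v' i') :
    i = i' ∧ (v = v' ∨ v' = G.step i v) := by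
  have h1 := G.eq_end_of_ed_eq h
  have h2 := G.eq_end_of_ed_eq (rfl : G.ed v' i' = _)
  have hi : i = i' := h1.1.symm.trans rfl
  refine ⟨hi, ?_⟩
  rcases h1.2 with a | a <;> rcases h2.2 with b | b
  · exact Or.inl (a.trans b.symm)
  · right; rw [b, a, hi]; exact (G.step_endL (G.ed v' i')).symm
  · right; rw [b, a, hi]; exact (G.step_endR (G.ed v' i')).symm
  · exact Or.inl (a.trans b.symm)

/-- Summing over edges is the same as summing over half-edges. -/
theorem sum_edges_eq_sum_half_edges [Fintype P] {R : Type*} [CommRing R] (z : P × Fin 3 → R)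
    (η : Bool × P → Fin 3 → R) :
    ∑ e, z e * (η (endL e) e.2 + η (G.endR e) e.2) = ∑ v, ∑ i, η v i * z (G.ed v i) := by
  simp only [mul_add, Finset.sum_add_distrib, Fintype.sum_prod_type, Fintype.sum_bool]
  rw [add_comm]
  congr 1
  -- For each colour `i`, the half-edges on the `true` side are reindexed by the involution `G.s i`.
  · rw [Finset.sum_comm, Finset.sum_comm (s := (Finset.univ : Finset P)) (f := fun x i =>
      η (true, x) i * z (G.ed (true, x) i))]
    refine Finset.sum_congr rfl fun i _ => ?_
    refine Finset.sum_nbij' (G.s i) (G.s i) (by simp) (by simp) (by simp [G.s_s]) (by simp [G.s_s])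
      fun x _ => ?_
    simp [endR, ed, G.s_s, mul_comm]
  · simp [endL, ed, mul_comm]

/-- Follow the edges with the colours in a word, the last letter first. -/
def act : List (Fin 3) → Bool × P → Bool × P
  | [], v => v
  | i :: w, v => G.step i (act w v)

@[simp] theorem act_nil (v : Bool × P) : G.act [] v = v := rfl

@[simp] theorem act_cons (i : Fin 3) (w : List (Fin 3)) (v : Bool × P) :
    G.act (i :: w) v = G.step i (G.act w v) := rfl

theorem act_append (u w : List (Fin 3)) (v : Bool × P) :
    G.act (u ++ w) v = G.act u (G.act w v) := by
  induction u with
  | nil => rfl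
  | cons i u ih => simp [ih]

/-- A word without two equal consecutive letters. -/
def Reduced (w : List (Fin 3)) : Prop := w.IsChain (· ≠ ·)

theorem Reduced.tail {i : Fin 3} {w : List (Fin 3)} (h : Reduced (i :: w)) : Reduced w :=
  List.IsChain.tail h

theorem Reduced.of_suffix {u w : List (Fin 3)} (h : Reduced w) (hu : u <:+ w) : Reduced u :=
  List.IsChain.suffix h hu

/-- Distinct reduced words of length at most `L` lead to distinct vertices. -/
def LargeGirth (L : ℕ) : Prop :=
  ∀ u w : List (Fin 3), Reduced u → Reduced w → u.length ≤ L → w.length ≤ L →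
    ∀ v, G.act u v = G.act w v → u = w

variable {G}

variable (G)

/-- Every word, acting after a reduced one, can be reduced. -/
theorem exists_reduced_append (w u : List (Fin 3)) (hu : Reduced u) :
    ∃ r, Reduced r ∧ (∀ v, G.act r v = G.act (w ++ u) v) ∧ r.length ≤ u.length + w.length ∧
      u.length ≤ r.length + w.length := by
  induction w with
  | nil => exact ⟨u, hu, fun v => rfl, by simp, by simp⟩
  | cons i w ih =>
    obtain ⟨r, hr, ha, h1, h2⟩ := ih
    rcases r with _ | ⟨j, r⟩
    · exact ⟨[i], List.isChain_singleton _, fun v => by simp [← ha], by simp; omega,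
        by simp at h2 ⊢; omega⟩
    · by_cases hij : i = j
      · refine ⟨r, hr.tail, fun v => ?_, by simp at h1 ⊢; omega, by simp at h2 ⊢; omega⟩
        rw [List.cons_append, act_cons, ← ha, act_cons, hij, step_step]
      · refine ⟨i :: j :: r, List.IsChain.cons_cons hij hr, fun v => ?_,
          by simp at h1 ⊢; omega, by simp at h2 ⊢; omega⟩
        rw [List.cons_append, act_cons, ha, act_cons]

/-! ### Walks -/

/-- The edges of the walk from `v` along a word. -/
def trail (v : Bool × P) : List (Fin 3) → List (P × Fin 3)
  | [] => []
  | i :: w => G.ed (G.act w v) i :: trail v w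

@[simp] theorem trail_length (v : Bool × P) (w : List (Fin 3)) :
    (G.trail v w).length = w.length := by
  induction w with
  | nil => rfl
  | cons i w ih => simp [trail, ih]

theorem exists_suffix_of_mem_trail {v : Bool × P} {w : List (Fin 3)} {e : P × Fin 3}
    (h : e ∈ G.trail v w) : ∃ i u, (i :: u) <:+ w ∧ e = G.ed (G.act u v) i := by
  induction w with
  | nil => simp [trail] at h
  | cons j w ih =>
    rcases List.mem_cons.1 h with h | h
    · exact ⟨j, w, List.suffix_refl _, h⟩
    · obtain ⟨i, u, hu, he⟩ := ih h
      exact ⟨i, u, hu.trans (List.suffix_cons _ _), he⟩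

variable {G}

/-- A repeated edge would bring two suffixes of different lengths to the same vertex, at one end of
the edge or the other, against `LargeGirth`. -/
theorem LargeGirth.trail_nodup {L : ℕ} (hG : G.LargeGirth L) (v : Bool × P) {w : List (Fin 3)}
    (hw : Reduced w) (hL : w.length ≤ L) : (G.trail v w).Nodup := by
  induction w with
  | nil => exact List.nodup_nil
  | cons j w ih =>
    refine List.nodup_cons.2 ⟨fun hmem => ?_, ih hw.tail (by simp at hL; omega)⟩
    obtain ⟨i, u, hu, he⟩ := G.exists_suffix_of_mem_trail hmem
    have hul := hu.length_le
    simp only [List.length_cons] at hul hL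
    have hur : Reduced u := (hw.tail.of_suffix hu).tail
    obtain ⟨rfl, h | h⟩ := G.ed_inj he
    · have := hG w u hw.tail hur (by omega) (by omega) v h
      rw [← this] at hul; omega
    · have := hG (j :: w) u hw hur (by simpa using hL) (by omega) v h.symm
      have := congrArg List.length this
      simp at this; omega

/-- In a set `S` of edges with at least two edges at every vertex that is not exempt, one can walk
along a reduced word until an exempt vertex is reached. -/
theorem exists_walk (S : Finset (P × Fin 3)) (exempt : Bool × P → Prop)
    (hS : ∀ v i, G.ed v i ∈ S → ¬ exempt v → ∃ j, j ≠ i ∧ G.ed v j ∈ S)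
    (v : Bool × P) (i : Fin 3) (hv : G.ed v i ∈ S) (n : ℕ) :
    ∃ w, Reduced (w ++ [i]) ∧ (∀ e ∈ G.trail v (w ++ [i]), e ∈ S) ∧ w.length ≤ n ∧
      (w.length = n ∨ exempt (G.act (w ++ [i]) v)) := by
  induction n with
  | zero => exact ⟨[], List.isChain_singleton _, by simpa [trail] using hv, by simp, Or.inl rfl⟩
  | succ n ih =>
    obtain ⟨w, hw, he, hn, h | h⟩ := ih
    · by_cases hex : exempt (G.act (w ++ [i]) v)
      · exact ⟨w, hw, he, by omega, Or.inr hex⟩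
      · obtain ⟨j, w', hjw⟩ : ∃ j w', w ++ [i] = j :: w' := by
          rcases w with _ | ⟨j, w⟩
          · exact ⟨i, [], rfl⟩
          · exact ⟨j, w ++ [i], rfl⟩
        have h1 : G.ed (G.act (w ++ [i]) v) j ∈ S := by
          have : G.ed (G.act w' v) j ∈ S := he _ (by rw [hjw]; simp [trail])
          rw [hjw, act_cons, ed_step]
          exact this
        obtain ⟨k, hk, hkS⟩ := hS _ j h1 hex
        refine ⟨k :: w, ?_, ?_, by simp; omega, Or.inl (by simp [h])⟩
        · rw [List.cons_append, hjw]
          rw [hjw] at hw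
          exact List.IsChain.cons_cons hk hw
        · intro e hmem
          rw [List.cons_append, trail] at hmem
          rcases List.mem_cons.1 hmem with h2 | h2
          · rw [h2]; exact hkS
          · exact he e h2
    · exact ⟨w, hw, he, by omega, Or.inr h⟩

theorem LargeGirth.length_le_card {L : ℕ} (hG : G.LargeGirth L) {S : Finset (P × Fin 3)}
    {v : Bool × P} {w : List (Fin 3)} (hw : Reduced w) (hL : w.length ≤ L)
    (he : ∀ e ∈ G.trail v w, e ∈ S) : w.length ≤ S.card := by
  classical
  rw [← G.trail_length v w, ← List.toFinset_card_of_nodup (hG.trail_nodup v hw hL)]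
  exact Finset.card_le_card fun e h => he e (List.mem_toFinset.1 h)

end CubicGraph

/-! ### Existence -/

/-- Reduced words of length at most `N`. -/
abbrev ReducedWord (N : ℕ) : Type :=
  {w : List (Fin 3) // CubicGraph.Reduced w ∧ w.length ≤ N}

instance (N : ℕ) : Finite (ReducedWord N) := by
  refine Set.Finite.subset (List.finite_length_le (Fin 3) N) ?_
  rintro w ⟨-, h⟩
  exact h

/-- Remove the letter `i` from the front of a reduced word, or add it if this is possible. -/
def toggleList (N : ℕ) (i : Fin 3) : List (Fin 3) → List (Fin 3)
  | [] => if 0 < N then [i] else []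
  | j :: w => if j = i then w else if (j :: w).length < N then i :: j :: w else j :: w

/-- A reduced word of full length that does not begin with `i` is fixed. This is what makes toggling
an involution on the finite set of words of length at most `N`. -/
theorem toggleList_spec {N : ℕ} {i : Fin 3} {w : List (Fin 3)}
    (h : CubicGraph.Reduced w ∧ w.length ≤ N) :
    (CubicGraph.Reduced (toggleList N i w) ∧ (toggleList N i w).length ≤ N) ∧
      toggleList N i (toggleList N i w) = w := by
  obtain ⟨h1, h2⟩ := h
  rcases w with _ | ⟨j, w⟩
  · by_cases hN : 0 < N
    · simp [toggleList, hN, CubicGraph.Reduced]; omega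
    · simp [toggleList, hN, CubicGraph.Reduced]
  · simp only [List.length_cons] at h2
    by_cases hj : j = i
    · subst hj
      refine ⟨by simpa [toggleList] using ⟨h1.tail, by omega⟩, ?_⟩
      rcases w with _ | ⟨k, w⟩
      · simp [toggleList]; omega
      · have hk : k ≠ j := fun h => (List.isChain_cons_cons.1 h1).1 h.symm
        simp only [List.length_cons] at h2
        simp [toggleList, hk]; omega
    · by_cases hN : w.length + 1 < N
      · refine ⟨?_, by simp [toggleList, hj, hN]⟩
        simp only [toggleList, hj, if_false, List.length_cons, hN, if_true]
        exact ⟨List.IsChain.cons_cons (fun h => hj h.symm) h1, by omega⟩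
      · simp [toggleList, hj, hN, h1, h2]

theorem toggleList_of_reduced {N : ℕ} {i : Fin 3} {w : List (Fin 3)}
    (h : CubicGraph.Reduced (i :: w)) (hN : w.length < N) : toggleList N i w = i :: w := by
  rcases w with _ | ⟨j, w⟩
  · simp at hN
    simp [toggleList, hN]
  · have : j ≠ i := fun hj => (List.isChain_cons_cons.1 h).1 hj.symm
    simp only [List.length_cons] at hN
    simp [toggleList, this, hN]

/-- `toggleList` as a permutation of the reduced words. -/
def toggle (N : ℕ) (i : Fin 3) : Equiv.Perm (ReducedWord N) :=
  Function.Involutive.toPerm (fun w => ⟨toggleList N i w.1, (toggleList_spec w.2).1⟩)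
    fun w => Subtype.ext (toggleList_spec w.2).2

theorem toggle_mul_self (N : ℕ) (i : Fin 3) : toggle N i * toggle N i = 1 := by
  refine Equiv.ext fun w => Subtype.ext ?_
  exact (toggleList_spec w.2).2

/-- The Cayley graph of the group generated by the toggles (on all permutations). -/
def cayleyGraph (N : ℕ) : CubicGraph (Equiv.Perm (ReducedWord N)) where
  s i x := toggle N i * x
  s_s i x := by rw [← mul_assoc, toggle_mul_self, one_mul]

/-- The product of toggles along a reduced word of length at most `N` sends the empty word to that
word, so distinct such words give distinct permutations. The starting vertex cancels on the right.
-/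
theorem cayleyGraph_largeGirth (N : ℕ) : (cayleyGraph N).LargeGirth N := by
  have h1 : ∀ (w : List (Fin 3)) v, ((cayleyGraph N).act w v).2 =
      (w.map (toggle N)).prod * v.2 := by
    intro w v
    induction w with
    | nil => simp
    | cons i w ih =>
      rw [CubicGraph.act_cons, List.map_cons, List.prod_cons, mul_assoc, ← ih]
      rfl
  have h2 : ∀ w : List (Fin 3), CubicGraph.Reduced w → w.length ≤ N →
      ((w.map (toggle N)).prod ⟨[], List.isChain_nil, by simp⟩).1 = w := by
    intro w hw hN
    induction w with
    | nil => simp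
    | cons i w ih =>
      simp only [List.length_cons] at hN
      rw [List.map_cons, List.prod_cons, Equiv.Perm.mul_apply]
      have := ih hw.tail (by omega)
      refine Eq.trans (?_ : _ = toggleList N i w) (toggleList_of_reduced hw (by omega))
      exact congrArg (toggleList N i) this
  intro u w hu hw hul hwl v hv
  have h3 := congrArg Prod.snd hv
  rw [h1, h1] at h3
  rw [← h2 u hu hul, ← h2 w hw hwl, mul_right_cancel h3]

end
noncomputable section

/-! ## The cycle space and tight sets of edges -/

section ZeroOn

open Module

variable {F α : Type*} [Field F]

theorem finrank_zeroOn [Fintype α] [DecidableEq α] (A : Finset α) :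
    finrank F (zeroOn F {e | e ∉ A}) = A.card := by
  have e : zeroOn F {e | e ∉ A} ≃ₗ[F] (A → F) :=
    { toFun := fun u a => u.1 a
      map_add' := fun _ _ => rfl
      map_smul' := fun _ _ => rfl
      invFun := fun g => ⟨fun a => if h : a ∈ A then g ⟨a, h⟩ else 0, fun a ha => by
        have : a ∉ A := ha
        simp [this]⟩
      left_inv := fun u => by
        ext a
        by_cases h : a ∈ A
        · simp [h]
        · simpa [h] using (u.2 a h).symm
      right_inv := fun g => by ext a; simp }
  rw [e.finrank_eq, finrank_fintype_fun_eq_card, Fintype.card_coe]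

theorem finrank_zeroOn_add [Fintype α] [DecidableEq α] (A : Finset α) :
    finrank F (zeroOn F (A : Set α)) + A.card = Fintype.card α := by
  have h := finrank_zeroOn (F := F) Aᶜ
  have h1 : {e | e ∉ Aᶜ} = (A : Set α) := by ext; simp
  rw [h1] at h
  rw [h, Finset.card_compl]
  have := Finset.card_le_univ A
  omega

end ZeroOn

namespace CubicGraph

open Module

variable {P : Type} (G : CubicGraph P) (F : Type*) [Field F]

/-- The sum of the values of `z` on the edges at each vertex. -/
def boundary : (P × Fin 3 → F) →ₗ[F] (Bool × P → F) where
  toFun z v := ∑ i, z (G.ed v i)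
  map_add' y z := by ext v; simp [Finset.sum_add_distrib]
  map_smul' a z := by ext v; simp [Finset.mul_sum]

theorem boundary_apply (z : P × Fin 3 → F) (v : Bool × P) :
    G.boundary F z v = ∑ i, z (G.ed v i) := rfl

/-- The functions supported in `A` with zero sum at every vertex. -/
def cyc (A : Finset (P × Fin 3)) : Submodule F (P × Fin 3 → F) :=
  zeroOn F {e | e ∉ A} ⊓ LinearMap.ker (G.boundary F)

variable {F} in
theorem mem_cyc {A : Finset (P × Fin 3)} {z : P × Fin 3 → F} :
    z ∈ G.cyc F A ↔ (∀ e ∉ A, z e = 0) ∧ ∀ v, ∑ i, z (G.ed v i) = 0 := by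
  rw [cyc, Submodule.mem_inf, LinearMap.mem_ker, funext_iff]
  rfl

/-- The cyclomatic number of a set of edges. -/
def nu (A : Finset (P × Fin 3)) : ℕ := finrank F (G.cyc F A)

/-- The functions on the vertices whose values cancel along the edges in `A`. -/
def potentials (A : Finset (P × Fin 3)) : Submodule F (Bool × P → F) where
  carrier := {p | ∀ e ∈ A, p (endL e) + p (G.endR e) = 0}
  add_mem' := fun {a b} ha hb e he => by
    simp only [Pi.add_apply]
    linear_combination ha e he + hb e he
  zero_mem' := fun e _ => by simp
  smul_mem' := fun c a ha e he => by
    simp only [Pi.smul_apply, smul_eq_mul]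
    linear_combination c * ha e he

variable [Fintype P] [DecidableEq P]

/-- Rank-nullity for `boundary` on functions supported in `A`: the kernel is the cycle space, and
the orthogonal complement of the image is the space of potentials. -/
theorem nu_add_card_vertices (A : Finset (P × Fin 3)) :
    G.nu F A + Fintype.card (Bool × P) = A.card + finrank F (G.potentials F A) := by
  set I := (zeroOn F {e | e ∉ A}).map (G.boundary F) with hI
  have h1 : perp I = G.potentials F A := by
    ext p
    rw [mem_perp, hI]
    have key : ∀ z : P × Fin 3 → F, p ⬝ᵥ G.boundary F z =
        ∑ e, z e * (p (endL e) + p (G.endR e)) := by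
      intro z
      rw [G.sum_edges_eq_sum_half_edges z fun v _ => p v]
      simp only [dotProduct, boundary_apply, Finset.mul_sum]
    constructor
    · intro h e he
      have := h _ (Submodule.mem_map_of_mem (p := zeroOn F {e | e ∉ A}) (r := Pi.single e 1)
        (fun e' he' => Pi.single_eq_of_ne (by rintro rfl; exact he' he) _))
      rw [key] at this
      simpa [Pi.single_apply] using this
    · rintro h _ ⟨z, hz, rfl⟩
      rw [key]
      refine Finset.sum_eq_zero fun e _ => ?_
      by_cases he : e ∈ A
      · rw [h e he, mul_zero]
      · rw [hz e he, zero_mul]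
  have h2 := finrank_perp I
  rw [h1] at h2
  have h3 := LinearMap.finrank_range_add_finrank_ker
    ((G.boundary F).comp (zeroOn F {e | e ∉ A}).subtype)
  rw [finrank_zeroOn, LinearMap.range_comp, Submodule.range_subtype, ← hI] at h3
  have h4 : finrank F (LinearMap.ker ((G.boundary F).comp (zeroOn F {e | e ∉ A}).subtype)) =
      G.nu F A := by
    rw [LinearMap.ker_comp, nu, cyc, ← Submodule.map_comap_subtype]
    exact (Submodule.finrank_map_subtype_eq _ _).symm
  omega

/-- The vertices incident with an edge in `A`. -/
def touched (A : Finset (P × Fin 3)) : Finset (Bool × P) :=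
  Finset.univ.filter fun v => ∃ i, G.ed v i ∈ A

theorem mem_touched {A : Finset (P × Fin 3)} {v : Bool × P} :
    v ∈ G.touched A ↔ ∃ i, G.ed v i ∈ A := by simp [touched]

theorem endL_mem_touched {A : Finset (P × Fin 3)} {e : P × Fin 3} (he : e ∈ A) :
    endL e ∈ G.touched A := G.mem_touched.2 ⟨e.2, by rwa [ed_endL]⟩

theorem endR_mem_touched {A : Finset (P × Fin 3)} {e : P × Fin 3} (he : e ∈ A) :
    G.endR e ∈ G.touched A := G.mem_touched.2 ⟨e.2, by rwa [ed_endR]⟩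

/-- The number of edges in `A` at a vertex. -/
def deg (A : Finset (P × Fin 3)) (v : Bool × P) : ℕ :=
  (Finset.univ.filter fun i => G.ed v i ∈ A).card

theorem deg_le_three (A : Finset (P × Fin 3)) (v : Bool × P) : G.deg A v ≤ 3 :=
  (Finset.card_filter_le _ _).trans (by simp)

theorem deg_pos {A : Finset (P × Fin 3)} {v : Bool × P} : 0 < G.deg A v ↔ v ∈ G.touched A := by
  rw [mem_touched, deg, Finset.card_pos]
  simp [Finset.Nonempty]

theorem sum_deg (A : Finset (P × Fin 3)) : ∑ v, G.deg A v = 2 * A.card := by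
  have h := G.sum_edges_eq_sum_half_edges (R := ℤ) (fun e => if e ∈ A then 1 else 0) fun _ _ => 1
  have h1 : ∀ v, (G.deg A v : ℤ) = ∑ i, 1 * (if G.ed v i ∈ A then (1 : ℤ) else 0) := by
    intro v
    simp [deg]
  zify
  rw [Finset.sum_congr rfl fun v _ => h1 v, ← h]
  simp [mul_comm]

theorem sum_deg_touched (A : Finset (P × Fin 3)) : ∑ v ∈ G.touched A, G.deg A v = 2 * A.card := by
  rw [← G.sum_deg A]
  refine Finset.sum_subset (Finset.subset_univ _) fun v _ hv => ?_
  by_contra h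
  exact hv (G.deg_pos.1 (Nat.pos_of_ne_zero h))

/-- Besides the functions that vanish on the touched vertices there is one more potential, equal to
`1` on one side of the bipartition and `-1` on the other. -/
theorem card_lt_nu_add_card_touched {A : Finset (P × Fin 3)} (hA : A.Nonempty) :
    A.card + 1 ≤ G.nu F A + (G.touched A).card := by
  have h := G.nu_add_card_vertices F A
  have h1 := finrank_zeroOn_add (F := F) (G.touched A)
  let p : Bool × P → F := fun v => if v.1 then 1 else -1
  have hle : zeroOn F (G.touched A : Set (Bool × P)) < G.potentials F A := by
    refine lt_of_le_of_ne (fun q hq e he => ?_) fun heq => ?_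
    · rw [hq _ (G.endL_mem_touched he), hq _ (G.endR_mem_touched he), add_zero]
    · obtain ⟨e, he⟩ := hA
      have hp : p ∈ zeroOn F (G.touched A : Set (Bool × P)) := heq ▸ (by
        intro e _
        simp [p, endL, endR])
      have := hp _ (G.endR_mem_touched he)
      simp [p, endR] at this
  have := Submodule.finrank_lt_finrank_of_lt hle
  omega

theorem nu_univ_pos [Nonempty P] : Fintype.card P + 1 ≤ G.nu F (Finset.univ) := by
  have h := G.card_lt_nu_add_card_touched F (A := Finset.univ) Finset.univ_nonempty
  have h1 := Finset.card_le_univ (G.touched Finset.univ)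
  rw [Finset.card_univ] at h
  simp only [Fintype.card_prod, Fintype.card_bool, Fintype.card_fin] at h h1
  omega

theorem restrict_mem_cyc {X A : Finset (P × Fin 3)} (hA : A ⊆ X) {z : P × Fin 3 → F}
    (hz : z ∈ G.cyc F X) (h : ∀ v, ∑ i, (if G.ed v i ∈ A then z (G.ed v i) else 0) = 0) :
    (fun e => if e ∈ A then z e else 0) ∈ G.cyc F A ∧
      (fun e => if e ∈ X \ A then z e else 0) ∈ G.cyc F (X \ A) := by
  refine ⟨G.mem_cyc.2 ⟨fun e he => by simp [he], h⟩,
    G.mem_cyc.2 ⟨fun e he => by simp only [he, if_false], fun v => ?_⟩⟩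
  rw [mem_cyc] at hz
  have h1 : ∑ i, z (G.ed v i) - ∑ i, (if G.ed v i ∈ A then z (G.ed v i) else 0) = 0 := by
    rw [hz.2, h, sub_zero]
  rw [← Finset.sum_sub_distrib] at h1
  refine Eq.trans (Finset.sum_congr rfl fun i _ => ?_) h1
  by_cases hX : G.ed v i ∈ X
  · by_cases hA' : G.ed v i ∈ A <;> simp [hX, hA']
  · have hA' : G.ed v i ∉ A := fun h' => hX (hA h')
    simp [hX, hA', hz.1 _ hX]

/-- Submodularity: cutting a set of edges in two costs at most one per shared vertex. -/
theorem nu_le_add {X A : Finset (P × Fin 3)} (hA : A ⊆ X) :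
    G.nu F X ≤ G.nu F A + G.nu F (X \ A) + (G.touched A ∩ G.touched (X \ A)).card := by
  set Sh := G.touched A ∩ G.touched (X \ A) with hSh
  -- The part inside `A` of a cycle can fail to be a cycle only at shared vertices; `f` records the
  -- failure, and its kernel splits into cycles of `A` and of `X \ A`.
  let f : G.cyc F X →ₗ[F] (Sh → F) :=
    { toFun := fun z v => ∑ i, if G.ed v i ∈ A then z.1 (G.ed v i) else 0
      map_add' := fun y z => by
        ext v
        simp only [Submodule.coe_add, Pi.add_apply, ← Finset.sum_add_distrib]
        exact Finset.sum_congr rfl fun i _ => by split_ifs <;> simp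
      map_smul' := fun c z => by
        ext v
        simp [Finset.mul_sum] }
  have h1 := LinearMap.finrank_range_add_finrank_ker f
  have h2 : finrank F (LinearMap.range f) ≤ Sh.card := by
    refine (Submodule.finrank_le _).trans ?_
    rw [finrank_fintype_fun_eq_card, Fintype.card_coe]
  have h3 : (LinearMap.ker f).map (G.cyc F X).subtype ≤ G.cyc F A ⊔ G.cyc F (X \ A) := by
    rintro _ ⟨z, hz, rfl⟩
    have hz' := LinearMap.mem_ker.1 hz
    obtain ⟨hz1, hz2⟩ := G.mem_cyc.1 z.2
    have key := G.restrict_mem_cyc F hA z.2 fun v => by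
      by_cases hv : v ∈ Sh
      · exact congrFun hz' ⟨v, hv⟩
      rw [hSh, Finset.mem_inter, mem_touched, mem_touched] at hv
      by_cases hvA : ∃ i, G.ed v i ∈ A
      · have hv' : ∀ i, G.ed v i ∈ X → G.ed v i ∈ A := by
          intro i hi
          by_contra hiA
          exact hv ⟨hvA, i, Finset.mem_sdiff.2 ⟨hi, hiA⟩⟩
        refine Eq.trans (Finset.sum_congr rfl fun i _ => ?_) (hz2 v)
        split_ifs with h
        · rfl
        · rw [hz1 _ fun h' => h (hv' i h')]
      · exact Finset.sum_eq_zero fun i _ => if_neg fun h => hvA ⟨i, h⟩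
    refine Submodule.mem_sup.2 ⟨_, key.1, _, key.2, ?_⟩
    ext e
    by_cases heX : e ∈ X
    · by_cases heA : e ∈ A <;> simp [heX, heA]
    · have heA : e ∉ A := fun h' => heX (hA h')
      simpa [heX, heA] using (hz1 _ heX).symm
  have h4 := Submodule.finrank_mono h3
  rw [Submodule.finrank_map_subtype_eq] at h4
  have h5 := Submodule.finrank_add_le_finrank_add_finrank (G.cyc F A) (G.cyc F (X \ A))
  unfold nu
  omega

/-! ### Tight edge sets: connectivity and degrees. -/

/-- The minimal sets of edges with a cycle and fewer than `3 ν + 3 β` edges. -/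
structure Tight (β : ℕ) (X : Finset (P × Fin 3)) : Prop where
  pos : 1 ≤ G.nu F X
  card_lt : X.card < 3 * G.nu F X + 3 * β
  le_card : ∀ A ⊂ X, 1 ≤ G.nu F A → 3 * G.nu F A + 3 * β ≤ A.card

/-- The full edge set is a candidate: it has `3 |P|` edges and `ν ≥ |P| + 1`. A candidate of least
cardinality is tight. -/
theorem exists_tight [Nonempty P] (β : ℕ) : ∃ X, G.Tight F β X := by
  let S : Set (Finset (P × Fin 3)) := {X | 1 ≤ G.nu F X ∧ X.card < 3 * G.nu F X + 3 * β}
  have hS : S.Nonempty := by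
    refine ⟨Finset.univ, ?_⟩
    have := G.nu_univ_pos F
    simp only [S, Set.mem_ofPred_eq, Finset.card_univ, Fintype.card_prod, Fintype.card_fin]
    omega
  obtain ⟨X, hX, hmin⟩ := WellFounded.has_min (measure Finset.card).wf S hS
  refine ⟨X, hX.1, hX.2, fun A hA h1 => ?_⟩
  by_contra! h2
  exact hmin A ⟨h1, h2⟩ (Finset.card_lt_card hA)

variable {G F}

/-- Minimality applied to both parts gives `|X| ≥ 3 (ν A + ν (X \ A)) + 6 β`, while `|X| < 3 ν X + 3
β`. -/
theorem Tight.nu_add_lt {β : ℕ} {X : Finset (P × Fin 3)} (hX : G.Tight F β X)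
    {A : Finset (P × Fin 3)} (hA : A ⊆ X) (h1 : 1 ≤ G.nu F A) (h2 : 1 ≤ G.nu F (X \ A)) :
    G.nu F A + G.nu F (X \ A) + β < G.nu F X := by
  have hempty : G.nu F ∅ = 0 := by
    have : G.cyc F ∅ = ⊥ := by
      rw [eq_bot_iff]
      intro z hz
      exact funext fun e => (G.mem_cyc.1 hz).1 e (by simp)
    rw [nu, this, finrank_bot]
  have hA' : A ⊂ X := by
    refine lt_of_le_of_ne hA ?_
    rintro rfl
    rw [sdiff_self, Finset.bot_eq_empty, hempty] at h2
    omega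
  have hB : X \ A ⊂ X := by
    refine Finset.sdiff_ssubset hA ?_
    rw [Finset.nonempty_iff_ne_empty]
    rintro rfl
    omega
  have h3 := hX.le_card A hA' h1
  have h4 := hX.le_card _ hB h2
  have h5 := Finset.card_sdiff_add_card_eq_card hA
  have h6 := hX.card_lt
  omega

theorem Tight.lt_card_shared {β : ℕ} {X : Finset (P × Fin 3)} (hX : G.Tight F β X)
    {A : Finset (P × Fin 3)} (hA : A ⊆ X) (h1 : 1 ≤ G.nu F A) (h2 : 1 ≤ G.nu F (X \ A)) :
    β < (G.touched A ∩ G.touched (X \ A)).card := by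
  have h3 := hX.nu_add_lt hA h1 h2
  have h4 := G.nu_le_add F hA
  omega

/-- An edge on no cycle could be erased without lowering `ν`, contradicting minimality. -/
theorem Tight.exists_mem_cyc {β : ℕ} {X : Finset (P × Fin 3)} (hX : G.Tight F β X)
    {e : P × Fin 3} (he : e ∈ X) : ∃ z ∈ G.cyc F X, z e ≠ 0 := by
  by_contra! h
  have h1 : G.cyc F X ≤ G.cyc F (X.erase e) := by
    intro z hz
    refine G.mem_cyc.2 ⟨fun e' he' => ?_, (G.mem_cyc.1 hz).2⟩
    by_cases hee : e' = e
    · rw [hee, h z hz]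
    · exact (G.mem_cyc.1 hz).1 e' fun h' => he' (Finset.mem_erase.2 ⟨hee, h'⟩)
  have h2 : G.nu F X ≤ G.nu F (X.erase e) := Submodule.finrank_mono h1
  have h3 := hX.le_card _ (Finset.erase_ssubset he) (hX.pos.trans h2)
  have h4 := hX.card_lt
  have h5 := Finset.card_erase_lt_of_mem he
  omega

theorem Tight.exists_other {β : ℕ} {X : Finset (P × Fin 3)} (hX : G.Tight F β X)
    {v : Bool × P} {i : Fin 3} (hv : G.ed v i ∈ X) : ∃ j, j ≠ i ∧ G.ed v j ∈ X := by
  obtain ⟨z, hz, hz0⟩ := hX.exists_mem_cyc hv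
  by_contra! h
  obtain ⟨h1, h2⟩ := G.mem_cyc.1 hz
  have := h2 v
  rw [Finset.sum_eq_single i (fun j _ hj => h1 _ (h j hj)) (by simp)] at this
  exact hz0 this

theorem Tight.two_le_deg {β : ℕ} {X : Finset (P × Fin 3)} (hX : G.Tight F β X)
    {v : Bool × P} (hv : v ∈ G.touched X) : 2 ≤ G.deg X v := by
  obtain ⟨i, hi⟩ := G.mem_touched.1 hv
  obtain ⟨j, hj, hjX⟩ := hX.exists_other hi
  exact Finset.one_lt_card.2 ⟨i, by simpa using hi, j, by simpa using hjX, hj.symm⟩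

/-- If `ν X ≥ 2`, erasing one edge lowers `ν` by at most one, and minimality of `X` gives `|X| - 1 ≥
3 (ν X - 1) + 3 β`. -/
theorem Tight.three_nu_le {β : ℕ} {X : Finset (P × Fin 3)} (hX : G.Tight F β X)
    (hβ : 1 ≤ β) (h3 : 3 ≤ X.card) : 3 * G.nu F X ≤ X.card := by
  by_cases h : G.nu F X = 1
  · omega
  obtain ⟨e, he⟩ : X.Nonempty := Finset.card_pos.1 (by omega)
  have h1 : G.nu F X ≤ G.nu F (X.erase e) + 1 := by
    let f : G.cyc F X →ₗ[F] F := (LinearMap.proj e).comp (G.cyc F X).subtype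
    have h1 := LinearMap.finrank_range_add_finrank_ker f
    have h2 : finrank F (LinearMap.range f) ≤ 1 :=
      (Submodule.finrank_le _).trans (finrank_self F).le
    have h3 : (LinearMap.ker f).map (G.cyc F X).subtype ≤ G.cyc F (X.erase e) := by
      rintro _ ⟨z, hz, rfl⟩
      refine G.mem_cyc.2 ⟨fun e' he' => ?_, (G.mem_cyc.1 z.2).2⟩
      by_cases hee : e' = e
      · rw [hee]; exact hz
      · exact (G.mem_cyc.1 z.2).1 e' fun h' => he' (Finset.mem_erase.2 ⟨hee, h'⟩)
    have h4 := Submodule.finrank_mono h3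
    rw [Submodule.finrank_map_subtype_eq] at h4
    unfold nu
    omega
  have := hX.pos
  have h2 := hX.le_card _ (Finset.erase_ssubset he) (by omega)
  rw [Finset.card_erase_of_mem he] at h2
  omega

/-- A tight set is connected. -/
theorem Tight.potential_eq_zero {β : ℕ} {X : Finset (P × Fin 3)} (hX : G.Tight F β X)
    {p : Bool × P → F} (hp : p ∈ G.potentials F X) {v : Bool × P} (hv : v ∈ G.touched X)
    (h0 : p v = 0) {w : Bool × P} (hw : w ∈ G.touched X) : p w = 0 := by
  classical
  by_contra hpw
  -- A potential vanishes at both ends of an edge of `X` or at neither. So `A` and `X \ A` have no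
  -- common vertex, although both contain cycles.
  set A := X.filter fun e => p (endL e) = 0 with hA
  have hAX : A ⊆ X := Finset.filter_subset _ _
  have hmem : ∀ u i, G.ed u i ∈ X → (G.ed u i ∈ A ↔ p u = 0) := by
    intro u i hi
    rw [hA, Finset.mem_filter, and_iff_right hi]
    have h1 := hp _ hi
    rcases (G.eq_end_of_ed_eq (rfl : G.ed u i = _)).2 with h | h
    · rw [← h]
    · rw [← h] at h1
      constructor
      · intro h2; rwa [h2, zero_add] at h1
      · intro h2; rwa [h2, add_zero] at h1
  have hsum : ∀ z ∈ G.cyc F X, ∀ u, ∑ i, (if G.ed u i ∈ A then z (G.ed u i) else 0) = 0 := by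
    intro z hz u
    obtain ⟨h1, h2⟩ := G.mem_cyc.1 hz
    by_cases hu : p u = 0
    · refine Eq.trans (Finset.sum_congr rfl fun i _ => ?_) (h2 u)
      split_ifs with h
      · rfl
      · rw [h1 _ fun h' => h ((hmem u i h').2 hu)]
    · exact Finset.sum_eq_zero fun i _ => if_neg fun h => hu ((hmem u i (hAX h)).1 h)
  have hpos : ∀ B : Finset (P × Fin 3), ∀ e ∈ B, ∀ z : P × Fin 3 → F, z e ≠ 0 →
      (fun e => if e ∈ B then z e else 0) ∈ G.cyc F B → 1 ≤ G.nu F B := by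
    intro B e he z hz hmem
    have : G.cyc F B ≠ ⊥ := fun hbot => by
      rw [hbot, Submodule.mem_bot] at hmem
      have := congrFun hmem e
      simp only [he, if_true, Pi.zero_apply] at this
      exact hz this
    exact Nat.one_le_iff_ne_zero.2 fun h => this (Submodule.finrank_eq_zero.1 h)
  obtain ⟨i, hi⟩ := G.mem_touched.1 hv
  obtain ⟨j, hj⟩ := G.mem_touched.1 hw
  obtain ⟨z, hz, hz0⟩ := hX.exists_mem_cyc hi
  obtain ⟨y, hy, hy0⟩ := hX.exists_mem_cyc hj
  have h1 := hpos A _ ((hmem v i hi).2 h0) z hz0 (G.restrict_mem_cyc F hAX hz (hsum z hz)).1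
  have h2 := hpos (X \ A) _ (Finset.mem_sdiff.2 ⟨hj, fun h => hpw ((hmem w j hj).1 h)⟩) y hy0
    (G.restrict_mem_cyc F hAX hy (hsum y hy)).2
  have h3 := hX.lt_card_shared hAX h1 h2
  have h4 : G.touched A ∩ G.touched (X \ A) = ∅ := by
    rw [Finset.eq_empty_iff_forall_notMem]
    intro u hu
    rw [Finset.mem_inter, mem_touched, mem_touched] at hu
    obtain ⟨⟨a, ha⟩, b, hb⟩ := hu
    rw [Finset.mem_sdiff] at hb
    exact hb.2 ((hmem u b hb.1).2 ((hmem u a (hAX ha)).1 ha))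
  rw [h4, Finset.card_empty] at h3
  omega

/-- By connectedness a potential is determined by its value at one touched vertex and its values at
the untouched vertices. -/
theorem Tight.nu_add_card_touched_le {β : ℕ} {X : Finset (P × Fin 3)} (hX : G.Tight F β X) :
    G.nu F X + (G.touched X).card ≤ X.card + 1 := by
  have h := G.nu_add_card_vertices F X
  have h1 := finrank_zeroOn_add (F := F) (G.touched X)
  obtain ⟨v, hv⟩ : (G.touched X).Nonempty := by
    by_contra hne
    rw [Finset.not_nonempty_iff_eq_empty] at hne
    have h2 := G.sum_deg_touched X
    rw [hne, Finset.sum_empty] at h2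
    have h3 := hX.pos
    have h4 : X = ∅ := Finset.card_eq_zero.1 (by omega)
    obtain ⟨z, hz, hz0⟩ := Submodule.exists_mem_ne_zero_of_ne_bot
      (fun h0 : G.cyc F X = ⊥ => by rw [nu, h0, finrank_bot] at h3; omega)
    exact hz0 (funext fun e => (G.mem_cyc.1 hz).1 e (by simp [h4]))
  let f : G.potentials F X →ₗ[F] F := (LinearMap.proj v).comp (G.potentials F X).subtype
  have h2 := LinearMap.finrank_range_add_finrank_ker f
  have h3 : finrank F (LinearMap.range f) ≤ 1 :=
    (Submodule.finrank_le _).trans (finrank_self F).le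
  have h4 : (LinearMap.ker f).map (G.potentials F X).subtype ≤
      zeroOn F (G.touched X : Set (Bool × P)) := by
    rintro _ ⟨p, hp, rfl⟩ w hw
    exact hX.potential_eq_zero p.2 hv hp hw
  have h5 := Submodule.finrank_mono h4
  rw [Submodule.finrank_map_subtype_eq] at h5
  omega

variable (G) in
/-- The vertices incident with exactly two edges of `X`. -/
def deficient (X : Finset (P × Fin 3)) : Finset (Bool × P) :=
  (G.touched X).filter fun v => G.deg X v ≤ 2

/-- All degrees are 2 or 3, so the number of deficient vertices is `3 |V| - 2 |X|`, where `V` is the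
set of touched vertices; here `|V| ≤ |X| + 1 - ν X` and `|X| < 3 ν X + 3 β`. -/
theorem Tight.card_deficient {β : ℕ} {X : Finset (P × Fin 3)} (hX : G.Tight F β X) :
    (G.deficient X).card ≤ 3 * β + 2 := by
  have h1 := G.sum_deg_touched X
  have h2 : ∑ v ∈ G.touched X, (G.deg X v + if G.deg X v ≤ 2 then 1 else 0) =
      3 * (G.touched X).card := by
    rw [Finset.sum_const_nat (m := 3), mul_comm]
    intro v hv
    have := hX.two_le_deg hv
    have := G.deg_le_three X v
    split_ifs <;> omega
  rw [Finset.sum_add_distrib, h1, ← Finset.card_filter] at h2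
  have h3 := hX.nu_add_card_touched_le
  have h4 := hX.card_lt
  unfold deficient
  omega

end CubicGraph
end
noncomputable section

/-! ## Terminals -/

namespace CubicGraph

variable {P : Type} (G : CubicGraph P)

/-- No short nontrivial reduced word leads from a terminal to a terminal. -/
def FarApart (g : ℕ) (T : Finset (Bool × P)) : Prop :=
  ∀ v ∈ T, ∀ w, Reduced w → w.length ≤ g → G.act w v ∈ T → w = []

variable {G} [Fintype P] [DecidableEq P] {F : Type*} [Field F]

theorem Tight.exists_walk {β : ℕ} {X : Finset (P × Fin 3)} (hX : G.Tight F β X) (n : ℕ) :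
    ∃ v w, Reduced w ∧ w.length = n + 1 ∧ ∀ e ∈ G.trail v w, e ∈ X := by
  obtain ⟨e, he⟩ : X.Nonempty := by
    by_contra hne
    rw [Finset.not_nonempty_iff_eq_empty] at hne
    have h := hX.pos
    have : G.cyc F X = ⊥ := by
      rw [eq_bot_iff]
      intro z hz
      exact funext fun e => (G.mem_cyc.1 hz).1 e (by simp [hne])
    rw [nu, this, finrank_bot] at h
    omega
  obtain ⟨w, h1, h2, -, h4 | h4⟩ := G.exists_walk X (fun _ => False)
    (fun v i hv _ => hX.exists_other hv) (endL e) e.2 (by rwa [ed_endL]) n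
  · exact ⟨_, _, h1, by simp [h4], h2⟩
  · exact h4.elim

theorem trail_of_suffix {v : Bool × P} {u w : List (Fin 3)} (h : u <:+ w) :
    G.trail v u <:+ G.trail v w := by
  obtain ⟨t, rfl⟩ := h
  induction t with
  | nil => exact List.suffix_refl _
  | cons i t ih => exact ih.trans (List.suffix_cons _ _)

/-- Every `(2 g + 1)`-st vertex of a long walk in `X` is taken, and the at most `3 β + 2` deficient
ones are discarded. -/
theorem Tight.exists_terminals {β : ℕ} {X : Finset (P × Fin 3)} (hX : G.Tight F β X)
    (m g : ℕ) {L : ℕ} (hG : G.LargeGirth L) (hL : (m + 3 * β + 2) * (2 * g + 1) + g + 1 ≤ L) :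
    ∃ T : Finset (Bool × P), T.card = m ∧ (∀ v ∈ T, G.deg X v = 3) ∧ G.FarApart g T := by
  set K := m + 3 * β + 2 with hK
  obtain ⟨v, w, hw, hlen, htr⟩ := hX.exists_walk (K * (2 * g + 1))
  let u : ℕ → List (Fin 3) := fun j => w.drop (w.length - (j + 1) * (2 * g + 1))
  have hu : ∀ j, u j <:+ w := fun j => List.drop_suffix _ _
  have hule : ∀ j < K, (j + 1) * (2 * g + 1) ≤ K * (2 * g + 1) := fun j hj =>
    Nat.mul_le_mul_right _ hj
  have hul : ∀ j < K, (u j).length = (j + 1) * (2 * g + 1) := by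
    intro j hj
    have := hule j hj
    simp only [u, List.length_drop]
    omega
  have hur : ∀ j, Reduced (u j) := fun j => hw.of_suffix (hu j)
  have hinj : Set.InjOn (fun j => G.act (u j) v) (Finset.range K : Set ℕ) := by
    intro i hi j hj hij
    have hi' := Finset.mem_range.1 (Finset.mem_coe.1 hi)
    have hj' := Finset.mem_range.1 (Finset.mem_coe.1 hj)
    have h1 := hule i hi'
    have h2 := hule j hj'
    have h3 := hG _ _ (hur i) (hur j) (by rw [hul i hi']; omega) (by rw [hul j hj']; omega) v hij
    have h4 := congrArg List.length h3
    rw [hul i hi', hul j hj'] at h4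
    have := Nat.eq_of_mul_eq_mul_right (by omega) h4
    omega
  set S := (Finset.range K).image fun j => G.act (u j) v with hS
  have hScard : S.card = K := by rw [hS, Finset.card_image_of_injOn hinj, Finset.card_range]
  have hST : ∀ x ∈ S, x ∈ G.touched X := by
    intro x hx
    obtain ⟨j, hj, rfl⟩ := Finset.mem_image.1 hx
    have hj' := hul j (Finset.mem_range.1 hj)
    rcases huj : u j with _ | ⟨i, t⟩
    · rw [huj] at hj'
      have : 0 < (j + 1) * (2 * g + 1) := by positivity
      simp at hj'
    · refine G.mem_touched.2 ⟨i, ?_⟩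
      rw [act_cons, ed_step]
      refine htr _ ((trail_of_suffix (hu j)).subset ?_)
      rw [huj]
      simp [trail]
  have hfar : G.FarApart g S := by
    intro x hx t ht htg htx
    obtain ⟨j, hj, rfl⟩ := Finset.mem_image.1 hx
    obtain ⟨l, hl, htl⟩ := Finset.mem_image.1 htx
    have hj1 := Finset.mem_range.1 hj
    have hl1 := Finset.mem_range.1 hl
    have h1 := hule j hj1
    have h2 := hule l hl1
    -- Reducing `t ++ u j` changes the length of `u j` by at most `g`, and large girth identifies
    -- the result with `u l`. The lengths of `u j` and `u l` differ by a multiple of `2 g + 1`, so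
    -- `j = l`.
    obtain ⟨r, hr, hra, hr1, hr2⟩ := G.exists_reduced_append t (u j) (hur j)
    rw [hul j hj1] at hr1 hr2
    have hrl : r = u l := hG _ _ hr (hur l) (by omega) (by rw [hul l hl1]; omega) v (by
      rw [hra, act_append]; exact htl.symm)
    rw [hrl, hul l hl1] at hr1 hr2
    have hjl : j = l := by
      rcases lt_trichotomy j l with h | h | h
      · have := Nat.mul_le_mul_right (2 * g + 1) (Nat.succ_le_succ h)
        rw [Nat.succ_eq_add_one, Nat.succ_eq_add_one, add_mul (j + 1)] at this
        omega
      · exact h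
      · have := Nat.mul_le_mul_right (2 * g + 1) (Nat.succ_le_succ h)
        rw [Nat.succ_eq_add_one, Nat.succ_eq_add_one, add_mul (l + 1)] at this
        omega
    subst hjl
    exact hG _ _ ht List.isChain_nil (by omega) (by simp) _ htl.symm
  have hD : m ≤ (S \ G.deficient X).card := by
    have h1 := hX.card_deficient
    have h2 := Finset.le_card_sdiff (G.deficient X) S
    omega
  obtain ⟨T, hTS, hTm⟩ := Finset.exists_subset_card_eq hD
  refine ⟨T, hTm, fun x hx => ?_, fun x hx t ht htg htx => ?_⟩
  · have h1 := Finset.mem_sdiff.1 (hTS hx)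
    have h2 := hST x h1.1
    have h3 : ¬ G.deg X x ≤ 2 := fun h => h1.2 (Finset.mem_filter.2 ⟨h2, h⟩)
    have h4 := G.deg_le_three X x
    omega
  · exact hfar x (Finset.mem_sdiff.1 (hTS hx)).1 t ht htg (Finset.mem_sdiff.1 (hTS htx)).1

end CubicGraph

/-! ## The represented matroid of a network with terminals -/

section Signs

variable {F F' : Type*} [Field F] [Field F']

/-- The four sign vectors of length three, up to negation. -/
def signRow (F : Type*) [Field F] : Fin 4 → Fin 3 → F :=
  ![![1, 1, 1], ![1, 1, -1], ![1, -1, 1], ![1, -1, -1]]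

theorem sum_mul_signRow (y : Fin 4 → F) :
    (∑ a, y a * signRow F a 0 = y 0 + y 1 + y 2 + y 3) ∧
    (∑ a, y a * signRow F a 1 = y 0 + y 1 - y 2 - y 3) ∧
    (∑ a, y a * signRow F a 2 = y 0 - y 1 + y 2 - y 3) := by
  refine ⟨?_, ?_, ?_⟩ <;> · simp [signRow, Fin.sum_univ_four]; try ring

/-- Linear combinations of sign vectors can be carried along any odd map of fields. -/
theorem exists_signRow_transport (h2' : (2 : F') ≠ 0) (φ : F → F')
    (hφ : ∀ x, φ (-x) = -φ x) (y : Fin 4 → F) :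
    ∃ y' : Fin 4 → F', (∀ a, y a = 0 → y' a = 0) ∧
      ∀ i, ∑ a, y' a * signRow F' a i = φ (∑ a, y a * signRow F a i) := by
  obtain ⟨e0, e1, e2⟩ := sum_mul_signRow y
  set h0 := ∑ a, y a * signRow F a 0
  set h1 := ∑ a, y a * signRow F a 1
  set hh := ∑ a, y a * signRow F a 2
  have heq : ∀ {s t : F}, s = -t → φ s + φ t = 0 := by
    rintro s t rfl
    rw [hφ, neg_add_cancel]
  have hne : ∀ {s t : F}, s = t → φ s - φ t = 0 := by
    rintro s t rfl
    rw [sub_self]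
  have fin : ∀ y' : Fin 4 → F', (y' 0 + y' 1 + y' 2 + y' 3 = φ h0) →
      (y' 0 + y' 1 - y' 2 - y' 3 = φ h1) → (y' 0 - y' 1 + y' 2 - y' 3 = φ hh) →
      ∀ i, ∑ a, y' a * signRow F' a i = φ (∑ a, y a * signRow F a i) := by
    intro y' k0 k1 k2 i
    obtain ⟨l0, l1, l2⟩ := sum_mul_signRow y'
    fin_cases i
    · exact l0.trans k0
    · exact l1.trans k1
    · exact l2.trans k2
  -- There are four coefficients and three equations, so one coordinate of `y'` may be set to zero
  -- where `y` vanishes. The others are then half-sums or half-differences of two of the three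
  -- prescribed values, and oddness of `φ` makes them vanish whenever those of `y` do.
  by_cases z0 : y 0 = 0
  · refine ⟨![0, (φ h0 + φ h1) / 2, (φ h0 + φ hh) / 2, -(φ h1 + φ hh) / 2], fun a ha => ?_,
      fin _ ?_ ?_ ?_⟩
    · fin_cases a
      · rfl
      · simp at ha ⊢; left; exact heq (by rw [e0, e1, z0, ha]; ring)
      · simp at ha ⊢; left; exact heq (by rw [e0, e2, z0, ha]; ring)
      · simp at ha ⊢; left
        have := heq (s := h1) (t := hh) (by rw [e1, e2, z0, ha]; ring)
        linear_combination -this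
    all_goals · simp; field_simp; ring
  by_cases z1 : y 1 = 0
  · refine ⟨![(φ h0 + φ h1) / 2, 0, (φ hh - φ h1) / 2, (φ h0 - φ hh) / 2], fun a ha => ?_,
      fin _ ?_ ?_ ?_⟩
    · fin_cases a
      · simp at ha ⊢; left; exact heq (by rw [e0, e1, z1, ha]; ring)
      · rfl
      · simp at ha ⊢; left; exact hne (by rw [e1, e2, z1, ha]; ring)
      · simp at ha ⊢; left; exact hne (by rw [e0, e2, z1, ha]; ring)
    all_goals · simp; field_simp; ring
  by_cases z2 : y 2 = 0
  · refine ⟨![(φ h0 + φ hh) / 2, (φ h1 - φ hh) / 2, 0, (φ h0 - φ h1) / 2], fun a ha => ?_,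
      fin _ ?_ ?_ ?_⟩
    · fin_cases a
      · simp at ha ⊢; left; exact heq (by rw [e0, e2, z2, ha]; ring)
      · simp at ha ⊢; left; exact hne (by rw [e1, e2, z2, ha]; ring)
      · rfl
      · simp at ha ⊢; left; exact hne (by rw [e0, e1, z2, ha]; ring)
    all_goals · simp; field_simp; ring
  -- Only `y 3` can vanish here, so `y' 3 = 0` meets every requirement, whether or not `y 3 = 0`.
  · refine ⟨![(φ h1 + φ hh) / 2, (φ h0 - φ hh) / 2, (φ h0 - φ h1) / 2, 0], fun a ha => ?_,
      fin _ ?_ ?_ ?_⟩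
    · fin_cases a
      · exact absurd ha z0
      · exact absurd ha z1
      · exact absurd ha z2
      · rfl
    all_goals · simp; field_simp; ring

/-- The only relations among the four sign vectors are the multiples of `(1, -1, -1, 1)`. -/
theorem ne_zero_of_sum_signRow_eq_zero (h2 : (2 : F) ≠ 0) {y : Fin 4 → F}
    (h : ∀ i, ∑ a, y a * signRow F a i = 0) {b : Fin 4} (hb : y b ≠ 0) (a : Fin 4) : y a ≠ 0 := by
  obtain ⟨e0, e1, e2⟩ := sum_mul_signRow y
  rw [h] at e0 e1 e2
  have k1 : y 1 = -y 0 := mul_left_cancel₀ h2 (by linear_combination -e0 - e1)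
  have k2 : y 2 = -y 0 := mul_left_cancel₀ h2 (by linear_combination -e0 - e2)
  have k3 : y 3 = y 0 := mul_left_cancel₀ h2 (by linear_combination e1 + e2)
  have h0 : y 0 ≠ 0 := by
    intro h0
    apply hb
    fin_cases b <;> simp [k1, k2, k3, h0]
  fin_cases a <;> simp [k1, k2, k3, h0]

end Signs

namespace CubicGraph

open Module

variable {P : Type} (G : CubicGraph P) (F : Type*) [Field F]

/-- The elements of the network matroid: the edges in `X` and four elements per terminal. -/
abbrev NetElt (X : Finset (P × Fin 3)) (T : Finset (Bool × P)) : Type :=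
  {e // e ∈ X} ⊕ ({v // v ∈ T} × Fin 4)

/-- The functions supported in `X` with zero sum at every vertex that is not a terminal. -/
def flows (X : Finset (P × Fin 3)) (T : Finset (Bool × P)) : Submodule F (P × Fin 3 → F) where
  carrier := {z | (∀ e ∉ X, z e = 0) ∧ ∀ v ∉ T, G.boundary F z v = 0}
  add_mem' := fun {a b} ha hb =>
    ⟨fun e he => by rw [Pi.add_apply, ha.1 e he, hb.1 e he, add_zero],
      fun v hv => by rw [map_add, Pi.add_apply, ha.2 v hv, hb.2 v hv, add_zero]⟩
  zero_mem' := ⟨fun _ _ => rfl, fun v _ => by simp⟩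
  smul_mem' := fun c a ha =>
    ⟨fun e he => by rw [Pi.smul_apply, ha.1 e he, smul_zero],
      fun v hv => by rw [map_smul, Pi.smul_apply, ha.2 v hv, smul_zero]⟩

variable {F} in
theorem mem_flows {X : Finset (P × Fin 3)} {T : Finset (Bool × P)} {z : P × Fin 3 → F} :
    z ∈ G.flows F X T ↔ (∀ e ∉ X, z e = 0) ∧ ∀ v ∉ T, ∑ i, z (G.ed v i) = 0 := Iff.rfl

/-- The values read off from a function on the edges. -/
def readout (X : Finset (P × Fin 3)) (T : Finset (Bool × P)) :
    (P × Fin 3 → F) →ₗ[F] (NetElt X T → F) where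
  toFun z := Sum.elim (fun e => z e) fun x => ∑ i, signRow F x.2 i * z (G.ed x.1 i)
  map_add' y z := by
    ext (e | x)
    · rfl
    · simp [mul_add, Finset.sum_add_distrib]
  map_smul' c z := by
    ext (e | x)
    · rfl
    · simp [Finset.mul_sum, mul_left_comm]

theorem readout_inl {X : Finset (P × Fin 3)} {T : Finset (Bool × P)} (z : P × Fin 3 → F)
    (e : {e // e ∈ X}) : G.readout F X T z (Sum.inl e) = z e := rfl

theorem readout_inr {X : Finset (P × Fin 3)} {T : Finset (Bool × P)} (z : P × Fin 3 → F)
    (x : {v // v ∈ T} × Fin 4) : G.readout F X T z (Sum.inr x) =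
      ∑ i, signRow F x.2 i * z (G.ed x.1 i) := rfl

/-- The row space of the network matroid. -/
def netSpace (X : Finset (P × Fin 3)) (T : Finset (Bool × P)) : Submodule F (NetElt X T → F) :=
  (G.flows F X T).map (G.readout F X T)

variable [DecidableEq P] {F}

/-- The contribution of a half-edge to a dependency: the vertex potential, or at a terminal the
combination of sign vectors. -/
def half {X : Finset (P × Fin 3)} {T : Finset (Bool × P)} (c : NetElt X T → F)
    (p : Bool × P → F) (v : Bool × P) (i : Fin 3) : F :=
  if h : v ∈ T then -∑ a, c (Sum.inr (⟨v, h⟩, a)) * signRow F a i else p v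

theorem half_of_mem {X : Finset (P × Fin 3)} {T : Finset (Bool × P)} (c : NetElt X T → F)
    (p : Bool × P → F) {v : Bool × P} (hv : v ∈ T) (i : Fin 3) :
    half c p v i = -∑ a, c (Sum.inr (⟨v, hv⟩, a)) * signRow F a i := dif_pos hv

theorem half_of_notMem {X : Finset (P × Fin 3)} {T : Finset (Bool × P)} (c : NetElt X T → F)
    (p : Bool × P → F) {v : Bool × P} (hv : v ∉ T) (i : Fin 3) : half c p v i = p v := dif_neg hv

variable [Fintype P]

theorem perp_perp {α : Type*} [Fintype α] (S : Submodule F (α → F)) : perp (perp S) = S := by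
  have h1 := finrank_perp S
  have h2 := finrank_perp (perp S)
  refine (Submodule.eq_of_le_of_finrank_eq (fun u hu w hw => ?_) (by omega)).symm
  rw [dotProduct_comm]
  exact hw u hu

theorem dotProduct_readout {X : Finset (P × Fin 3)} {T : Finset (Bool × P)} (c : NetElt X T → F)
    {z : P × Fin 3 → F} :
    c ⬝ᵥ G.readout F X T z = ∑ e : {e // e ∈ X}, c (Sum.inl e) * z e -
      ∑ v ∈ T, ∑ i, half c 0 v i * z (G.ed v i) := by
  rw [dotProduct, Fintype.sum_sum_type, ← Finset.sum_coe_sort T, Fintype.sum_prod_type,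
    sub_eq_add_neg, ← Finset.sum_neg_distrib]
  congr 1
  refine Finset.sum_congr rfl fun v _ => ?_
  rw [← Finset.sum_neg_distrib]
  simp only [readout_inr, half_of_mem c 0 v.2, Finset.mul_sum, Finset.sum_mul, neg_mul, neg_neg]
  rw [Finset.sum_comm]
  refine Finset.sum_congr rfl fun i _ => Finset.sum_congr rfl fun a _ => by ring

/-- Dependencies are sums of vertex potentials along edges, as for a graph without terminals, except
that at a terminal the half-edge values come from the four extra coefficients. -/
theorem mem_perp_netSpace {X : Finset (P × Fin 3)} {T : Finset (Bool × P)} {c : NetElt X T → F} :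
    c ∈ perp (G.netSpace F X T) ↔ ∃ p : Bool × P → F, ∀ e : {e // e ∈ X},
      c (Sum.inl e) = half c p (endL e.1) e.1.2 + half c p (G.endR e.1) e.1.2 := by
  have hpair : ∀ (z : P × Fin 3 → F), (∀ e ∉ X, z e = 0) → ∀ η : Bool × P → Fin 3 → F,
      ∑ e : {e // e ∈ X}, (η (endL e.1) e.1.2 + η (G.endR e.1) e.1.2) * z e =
        ∑ v, ∑ i, η v i * z (G.ed v i) := by
    intro z hz η
    rw [← G.sum_edges_eq_sum_half_edges z η, Finset.sum_coe_sort X fun e =>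
      (η (endL e) e.2 + η (G.endR e) e.2) * z e]
    refine Eq.trans (Finset.sum_subset (Finset.subset_univ X) fun e _ he => ?_) ?_
    · rw [hz e he, mul_zero]
    · exact Finset.sum_congr rfl fun e _ => mul_comm _ _
  constructor
  · intro hc
    -- `S` collects the edge functions that agree on `X` with a coboundary of a potential vanishing
    -- at the terminals; they are arbitrary off `X`. Its complement lies in `flows`, so the double
    -- complement puts the corrected edge part `c'` of `c` into `S`.
    let S : Submodule F (P × Fin 3 → F) :=
      { carrier := {w | ∃ p : Bool × P → F, (∀ v ∈ T, p v = 0) ∧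
          ∀ e ∈ X, w e = p (endL e) + p (G.endR e)}
        add_mem' := by
          rintro a b ⟨p, hp, hpa⟩ ⟨q, hq, hqb⟩
          refine ⟨p + q, fun v hv => by rw [Pi.add_apply, hp v hv, hq v hv, add_zero],
            fun e he => ?_⟩
          simp only [Pi.add_apply, hpa e he, hqb e he]
          ring
        zero_mem' := ⟨0, fun _ _ => rfl, fun e _ => by simp⟩
        smul_mem' := by
          rintro r a ⟨p, hp, hpa⟩
          refine ⟨r • p, fun v hv => by rw [Pi.smul_apply, hp v hv, smul_zero],
            fun e he => ?_⟩
          simp only [Pi.smul_apply, hpa e he, smul_add] }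
    have hS : perp S ≤ G.flows F X T := by
      intro z hz
      have hz0 : ∀ e ∉ X, z e = 0 := by
        intro e he
        have := hz (Pi.single e 1) ⟨0, fun _ _ => rfl, fun e' he' => by
          rw [Pi.single_eq_of_ne (by rintro rfl; exact he he')]; simp⟩
        simpa using this
      refine G.mem_flows.2 ⟨hz0, fun v hv => ?_⟩
      let q : Bool × P → F := Pi.single v 1
      have h1 := hz (fun e => q (endL e) + q (G.endR e)) ⟨q, fun u hu =>
        Pi.single_eq_of_ne (by rintro rfl; exact hv hu) _, fun e _ => rfl⟩
      have h2 := G.sum_edges_eq_sum_half_edges z fun v _ => q v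
      rw [dotProduct] at h1
      rw [h1, Finset.sum_eq_single v] at h2
      · simpa [q] using h2.symm
      · intro u _ hu
        simp [q, Pi.single_eq_of_ne hu]
      · simp
    let c' : P × Fin 3 → F := fun e => if h : e ∈ X then c (Sum.inl ⟨e, h⟩) -
      (half c 0 (endL e) e.2 + half c 0 (G.endR e) e.2) else 0
    have hc' : c' ∈ S := by
      rw [← perp_perp S]
      intro z hz
      have hzf := hS hz
      obtain ⟨hz0, hz1⟩ := G.mem_flows.1 hzf
      have h1 := hc _ (Submodule.mem_map_of_mem hzf)
      rw [dotProduct_readout] at h1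
      have h2 : c' ⬝ᵥ z = ∑ e : {e // e ∈ X}, c (Sum.inl e) * z e - ∑ e : {e // e ∈ X},
          (half c 0 (endL e.1) e.1.2 + half c 0 (G.endR e.1) e.1.2) * z e := by
        rw [← Finset.sum_sub_distrib, dotProduct,
          ← Finset.sum_subset (Finset.subset_univ X) (fun e _ he => by rw [hz0 e he, mul_zero]),
          ← Finset.sum_coe_sort]
        refine Finset.sum_congr rfl fun e _ => ?_
        simp only [c', dif_pos e.2]
        ring
      rw [h2, hpair z hz0, ← h1]
      congr 1
      symm
      refine Finset.sum_subset (Finset.subset_univ T) fun v _ hv => ?_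
      simp [half_of_notMem c 0 hv]
    obtain ⟨p, hp, hpc⟩ := hc'
    refine ⟨p, fun e => ?_⟩
    have h1 := hpc e e.2
    simp only [c', dif_pos e.2] at h1
    have h2 : ∀ v, half c p v e.1.2 = half c 0 v e.1.2 + p v := by
      intro v
      by_cases hv : v ∈ T
      · rw [half_of_mem c p hv, half_of_mem c 0 hv, hp v hv, add_zero]
      · rw [half_of_notMem c p hv, half_of_notMem c 0 hv, Pi.zero_apply, zero_add]
    rw [h2, h2]
    linear_combination h1
  · rintro ⟨p, hp⟩ _ ⟨z, hz, rfl⟩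
    obtain ⟨hz0, hz1⟩ := G.mem_flows.1 hz
    rw [dotProduct_readout, Finset.sum_congr rfl fun e _ => by rw [hp e], hpair z hz0, sub_eq_zero]
    symm
    refine Eq.trans ?_ (Finset.sum_subset (Finset.subset_univ T) fun v _ hv => ?_)
    · refine Finset.sum_congr rfl fun v hv => Finset.sum_congr rfl fun i _ => ?_
      rw [half_of_mem c p hv, half_of_mem c 0 hv]
    · simp only [half_of_notMem c p hv, ← Finset.mul_sum, hz1 v hv, mul_zero]

end CubicGraph
end
noncomputable section

/-! ## Network matroids are dyadic -/

namespace CubicGraph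

variable {P : Type} (G : CubicGraph P) [DecidableEq P] [Fintype P]
  {F F' : Type*} [Field F] [Field F'] {X : Finset (P × Fin 3)} {T : Finset (Bool × P)}

/-- Dependencies among the elements of a network matroid can be carried along odd maps. -/
theorem exists_dependency_map (h2' : (2 : F') ≠ 0) (φ : F → F') (hφ : ∀ x, φ (-x) = -φ x)
    (c : NetElt X T → F) (p : Bool × P → F)
    (hp : ∀ e : {e // e ∈ X},
      c (Sum.inl e) = half c p (endL e.1) e.1.2 + half c p (G.endR e.1) e.1.2) :
    ∃ c' ∈ perp (G.netSpace F' X T), (∀ x, c x = 0 → c' x = 0) ∧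
      (∀ e : {e // e ∈ X}, c' (Sum.inl e) =
        φ (half c p (endL e.1) e.1.2) + φ (half c p (G.endR e.1) e.1.2)) ∧
      ∀ v i, ∑ a, c' (Sum.inr (v, a)) * signRow F' a i =
        φ (∑ a, c (Sum.inr (v, a)) * signRow F a i) := by
  choose y hy0 hy using fun v : {v // v ∈ T} =>
    exists_signRow_transport h2' φ hφ fun a => c (Sum.inr (v, a))
  let c' : NetElt X T → F' := Sum.elim
    (fun e => φ (half c p (endL e.1) e.1.2) + φ (half c p (G.endR e.1) e.1.2)) fun x => y x.1 x.2
  have hhalf : ∀ v i, half c' (fun v => φ (p v)) v i = φ (half c p v i) := by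
    intro v i
    by_cases hv : v ∈ T
    · rw [half_of_mem _ _ hv, half_of_mem _ _ hv, hφ, ← hy]
      rfl
    · rw [half_of_notMem _ _ hv, half_of_notMem _ _ hv]
  refine ⟨c', G.mem_perp_netSpace.2 ⟨fun v => φ (p v), fun e => ?_⟩, ?_, fun e => rfl,
    fun v i => hy v i⟩
  · rw [hhalf, hhalf]
    rfl
  · rintro (e | ⟨v, a⟩) hx
    · rw [hp e] at hx
      change φ _ + φ _ = 0
      rw [eq_neg_of_add_eq_zero_left hx, hφ, neg_add_cancel]
    · exact hy0 v a hx

/-- The odd map is chosen to detect one nonzero half-edge value `a` by sending `a` to `1`, `-a` to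
`-1` and all else to `0`. At an edge with nonzero coefficient the other half-edge value is not `-a`,
so the image of the coefficient is not zero. -/
theorem exists_nonzero_dependency_map (h2 : (2 : F) ≠ 0) (h2' : (2 : F') ≠ 0)
    {c : NetElt X T → F} (hc : c ∈ perp (G.netSpace F X T)) (hc0 : c ≠ 0) :
    ∃ c' ∈ perp (G.netSpace F' X T), (∀ x, c x = 0 → c' x = 0) ∧ c' ≠ 0 := by
  classical
  obtain ⟨p, hp⟩ := G.mem_perp_netSpace.1 hc
  let φ : F → F → F' := fun a x => if x = a then 1 else if x = -a then -1 else 0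
  have hne : ∀ a : F, a ≠ 0 → a ≠ -a := by
    intro a ha h
    have : 2 * a = 0 := by linear_combination h
    exact (mul_ne_zero h2 ha) this
  have hφ : ∀ a : F, a ≠ 0 → ∀ x, φ a (-x) = -φ a x := by
    intro a ha x
    have h3 := hne a ha
    simp only [φ]
    by_cases h1 : x = a
    · subst h1
      simp [h3.symm]
    · by_cases h4 : x = -a
      · subst h4
        simp [h3.symm]
      · have h5 : -x ≠ a := fun h => h4 (by rw [← h, neg_neg])
        simp [h1, h4, h5]
  have hφa : ∀ a, φ a a = 1 := fun a => by simp [φ]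
  have hφne : ∀ a x : F, a + x ≠ 0 → φ a x ≠ -1 := by
    intro a x hax
    have h1 : x ≠ -a := fun h => hax (by rw [h, add_neg_cancel])
    simp only [φ, h1, if_false]
    split_ifs with h
    · intro h3
      apply h2'
      linear_combination h3
    · intro h3
      exact one_ne_zero (neg_eq_zero.1 h3.symm)
  by_cases hE : ∃ e : {e // e ∈ X}, c (Sum.inl e) ≠ 0
  · obtain ⟨e, he⟩ := hE
    have hsum := hp e
    by_cases hL : half c p (endL e.1) e.1.2 = 0
    · have hR : half c p (G.endR e.1) e.1.2 ≠ 0 := fun h => he (by rw [hsum, hL, h, add_zero])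
      obtain ⟨c', h1, h3, h4, -⟩ := G.exists_dependency_map h2' _ (hφ _ hR) c p hp
      refine ⟨c', h1, h3, fun h0 => ?_⟩
      have h5 := h4 e
      rw [h0, Pi.zero_apply, hφa] at h5
      refine hφne _ (half c p (endL e.1) e.1.2) (fun h => he ?_) (by linear_combination -h5)
      rw [hsum, add_comm, h]
    · obtain ⟨c', h1, h3, h4, -⟩ := G.exists_dependency_map h2' _ (hφ _ hL) c p hp
      refine ⟨c', h1, h3, fun h0 => ?_⟩
      have h5 := h4 e
      rw [h0, Pi.zero_apply, hφa] at h5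
      refine hφne _ (half c p (G.endR e.1) e.1.2) (fun h => he ?_) (by linear_combination -h5)
      rw [hsum, h]
  · push Not at hE
    obtain ⟨⟨v, b⟩, hvb⟩ : ∃ x, c (Sum.inr x) ≠ 0 := by
      by_contra! h
      exact hc0 (funext fun x => x.rec hE h)
    -- If all half-edge values at the terminal vanish, no odd map detects `c` there. But then all
    -- four coefficients are nonzero, and the relation `(1, -1, -1, 1)` at this terminal alone
    -- serves as `c'`.
    by_cases hh : ∀ i, ∑ a, c (Sum.inr (v, a)) * signRow F a i = 0
    · have hall := ne_zero_of_sum_signRow_eq_zero h2 hh hvb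
      let c' : NetElt X T → F' := Sum.elim (fun _ => 0) fun x =>
        if x.1 = v then ![1, -1, -1, 1] x.2 else 0
      have hhalf : ∀ u i, half c' 0 u i = 0 := by
        intro u i
        by_cases hu : u ∈ T
        · rw [half_of_mem _ _ hu]
          by_cases huv : (⟨u, hu⟩ : {v // v ∈ T}) = v
          · fin_cases i <;> simp [c', huv, signRow, Fin.sum_univ_four]
          · simp [c', huv]
        · rw [half_of_notMem _ _ hu, Pi.zero_apply]
      refine ⟨c', G.mem_perp_netSpace.2 ⟨0, fun e => ?_⟩, ?_, fun h0 => ?_⟩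
      · rw [hhalf, hhalf, add_zero]
        rfl
      · rintro (e | ⟨u, a⟩) hx
        · rfl
        · by_cases huv : u = v
          · subst huv
            exact absurd hx (hall a)
          · simp [c', huv]
      · have := congrFun h0 (Sum.inr (v, 0))
        simp [c'] at this
    · push Not at hh
      obtain ⟨i, hi⟩ := hh
      obtain ⟨c', h1, h3, -, h4⟩ := G.exists_dependency_map h2' _ (hφ _ hi) c p hp
      refine ⟨c', h1, h3, fun h0 => ?_⟩
      have h5 := h4 v i
      rw [hφa, h0] at h5
      simp at h5

/-- A set is dependent over one field exactly when it is over the other, since nonzero dependencies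
transfer in both directions without enlarging their supports. -/
theorem netSpace_mem_dyadicClass :
    RepMatroid.ofSpace (G.netSpace (ZMod 3) X T) ∈ dyadicClass (NetElt X T) := by
  refine exists_same_matroid_iff.2 ⟨RepMatroid.ofSpace (G.netSpace (ZMod 5) X T),
    toMatroid_eq_iff.2 fun I => ?_⟩
  rw [indep_ofSpace_iff, indep_ofSpace_iff]
  constructor
  · intro h c hcI hc
    by_contra hc0
    obtain ⟨c', h1, h2, h3⟩ := G.exists_nonzero_dependency_map (F' := ZMod 5) (by decide)
      (by decide) hc hc0
    exact h3 (h c' (fun e he => h2 e (hcI e he)) h1)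
  · intro h c hcI hc
    by_contra hc0
    obtain ⟨c', h1, h2, h3⟩ := G.exists_nonzero_dependency_map (F' := ZMod 3) (by decide)
      (by decide) hc hc0
    exact h3 (h c' (fun e he => h2 e (hcI e he)) h1)

end CubicGraph
end
noncomputable section

/-! ## Cocircuits and vertical connectivity of network matroids -/

namespace CubicGraph

open Module

variable {P : Type} {G : CubicGraph P} [DecidableEq P] [Fintype P]
  {F : Type*} [Field F] {X : Finset (P × Fin 3)} {T : Finset (Bool × P)}

theorem Tight.le_card_edges {β L : ℕ} (hX : G.Tight F β X) (hG : G.LargeGirth L) : L ≤ X.card := by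
  rcases L with _ | n
  · omega
  obtain ⟨v, w, hw, hl, he⟩ := hX.exists_walk n
  rw [← hl]
  exact hG.length_le_card hw hl.le he

/-- A set of edges in which only terminals can be ends contains a long walk. -/
theorem le_card_of_far {g L : ℕ} (hG : G.LargeGirth L) (hgL : g ≤ L) (hT : G.FarApart g T)
    {S : Finset (P × Fin 3)} (hS : S.Nonempty)
    (h2 : ∀ v i, G.ed v i ∈ S → v ∉ T → ∃ j, j ≠ i ∧ G.ed v j ∈ S) : g ≤ S.card := by
  rcases g with _ | n
  · omega
  obtain ⟨e, he⟩ := hS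
  have h3 : ∀ v i, G.ed v i ∈ S → ¬ v ∈ T → ∃ j, j ≠ i ∧ G.ed v j ∈ S := h2
  obtain ⟨w, hw, hwS, hn, hwl | hwT⟩ := G.exists_walk S (· ∈ T) h3 (endL e) e.2
    (by rwa [ed_endL]) n
  · have := hG.length_le_card hw (by simp; omega) hwS
    simpa [hwl] using this
  · obtain ⟨j, w', hjw⟩ : ∃ j w', w ++ [e.2] = j :: w' := by
      rcases w with _ | ⟨j, w⟩
      · exact ⟨e.2, [], rfl⟩
      · exact ⟨j, w ++ [e.2], rfl⟩
    have h1 : G.ed (G.act (w ++ [e.2]) (endL e)) j ∈ S := by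
      rw [hjw, act_cons, ed_step]
      exact hwS _ (by rw [hjw]; simp [trail])
    -- The first walk stopped early at a terminal. A second one starts there, back along the last
    -- edge; stopping early again would join terminals by a short nonempty reduced word.
    obtain ⟨u, hu, huS, hun, hul | huT⟩ := G.exists_walk S (· ∈ T) h3 _ j h1 n
    · have := hG.length_le_card hu (by simp; omega) huS
      simpa [hul] using this
    · have := hT _ hwT _ hu (by simp; omega) huT
      simp at this

/-- By conservation, the support of a flow has no vertex of degree 1 outside the terminals. -/
theorem le_card_support_of_mem_flows [DecidableEq F] {g L : ℕ} (hG : G.LargeGirth L) (hgL : g ≤ L)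
    (hT : G.FarApart g T) {z : P × Fin 3 → F} (hz : z ∈ G.flows F X T) (hz0 : z ≠ 0) :
    g ≤ (X.filter fun e => z e ≠ 0).card := by
  obtain ⟨h1, h2⟩ := G.mem_flows.1 hz
  have hmem : ∀ e, e ∈ X.filter (fun e => z e ≠ 0) ↔ z e ≠ 0 := by
    intro e
    rw [Finset.mem_filter, and_iff_right_iff_imp]
    intro h
    by_contra he
    exact h (h1 e he)
  refine le_card_of_far hG hgL hT ?_ fun v i hi hv => ?_
  · obtain ⟨e, he⟩ := Function.ne_iff.1 hz0
    exact ⟨e, (hmem e).2 he⟩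
  · by_contra! h
    have h3 := h2 v hv
    rw [Finset.sum_eq_single i (fun j _ hj => ?_) (by simp)] at h3
    · exact (hmem _).1 hi h3
    · by_contra h4
      exact h j hj ((hmem _).2 h4)

theorem le_card_support_of_mem_netSpace [DecidableEq F] {g L : ℕ} (hG : G.LargeGirth L)
    (hgL : g ≤ L) (hT : G.FarApart g T) {u : NetElt X T → F} (hu : u ∈ G.netSpace F X T)
    (hu0 : u ≠ 0) : g ≤ (Finset.univ.filter fun x => u x ≠ 0).card := by
  obtain ⟨z, hz, rfl⟩ := hu
  have hz0 : z ≠ 0 := by rintro rfl; exact hu0 (map_zero _)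
  refine (le_card_support_of_mem_flows hG hgL hT hz hz0).trans ?_
  rw [← Finset.card_attach]
  refine (Finset.card_le_card_of_injOn
    (fun e => (Sum.inl ⟨e.1, (Finset.mem_filter.1 e.2).1⟩ : NetElt X T)) ?_ ?_)
  · intro e _
    have := (Finset.mem_filter.1 e.2).2
    simpa [readout_inl] using this
  · intro e _ e' _ h
    have := Sum.inl_injective h
    exact Subtype.ext (congrArg (fun x : {e // e ∈ X} => x.1) this)

variable (G F) in
theorem readout_injOn {z : P × Fin 3 → F} (hz : z ∈ G.flows F X T)
    (h : G.readout F X T z = 0) : z = 0 := by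
  funext e
  by_cases he : e ∈ X
  · exact congrFun h (Sum.inl ⟨e, he⟩)
  · exact (G.mem_flows.1 hz).1 e he

theorem finrank_map_add_finrank_inf_ker {V V' : Type*} [AddCommGroup V] [Module F V]
    [AddCommGroup V'] [Module F V'] [FiniteDimensional F V] (f : V →ₗ[F] V') (S : Submodule F V) :
    finrank F (S.map f) + finrank F (S ⊓ LinearMap.ker f : Submodule F V) = finrank F S := by
  have h := LinearMap.finrank_range_add_finrank_ker (f.comp S.subtype)
  rw [LinearMap.range_comp, Submodule.range_subtype, LinearMap.ker_comp] at h
  rw [← h, ← Submodule.finrank_map_subtype_eq, Submodule.map_comap_subtype]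

variable (G F) in
theorem flows_inf_ker : G.flows F X T ⊓ LinearMap.ker (G.boundary F) = G.cyc F X := by
  ext z
  rw [Submodule.mem_inf, LinearMap.mem_ker, mem_flows, mem_cyc]
  constructor
  · rintro ⟨h1, h2⟩
    exact ⟨h1.1, fun v => congrFun h2 v⟩
  · rintro ⟨h1, h2⟩
    exact ⟨⟨h1, fun v _ => h2 v⟩, funext h2⟩

variable (G F) in
theorem finrank_netSpace : finrank F (G.netSpace F X T) = finrank F (G.flows F X T) := by
  have h := finrank_map_add_finrank_inf_ker (G.readout F X T) (G.flows F X T)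
  have h2 : G.flows F X T ⊓ LinearMap.ker (G.readout F X T) = ⊥ := by
    rw [eq_bot_iff]
    intro z hz
    exact G.readout_injOn F hz.1 hz.2
  rw [h2, finrank_bot, add_zero] at h
  exact h

variable (G F) in
theorem nu_le_finrank_netSpace : G.nu F X ≤ finrank F (G.netSpace F X T) := by
  rw [finrank_netSpace, nu, ← G.flows_inf_ker F (T := T)]
  exact Submodule.finrank_mono inf_le_left

variable (G F) in
-- The boundary of a flow is supported on the terminals, and flows with zero boundary are cycles.
theorem finrank_netSpace_le : finrank F (G.netSpace F X T) ≤ G.nu F X + T.card := by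
  rw [finrank_netSpace, nu, ← G.flows_inf_ker F (T := T),
    ← finrank_map_add_finrank_inf_ker (G.boundary F) (G.flows F X T), add_comm]
  gcongr
  rw [← finrank_zeroOn (F := F) T]
  refine Submodule.finrank_mono ?_
  rintro _ ⟨z, hz, rfl⟩ v hv
  exact hz.2 v hv

/-! ### Separations of network matroids. -/

/-- The edges outside a set of elements. -/
def edgesOff (A : Set (NetElt X T)) : Finset (P × Fin 3) := by
  classical
  exact X.filter fun e => ∃ h : e ∈ X, (Sum.inl ⟨e, h⟩ : NetElt X T) ∉ A

theorem mem_edgesOff {A : Set (NetElt X T)} {e : P × Fin 3} :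
    e ∈ edgesOff A ↔ ∃ h : e ∈ X, (Sum.inl ⟨e, h⟩ : NetElt X T) ∉ A := by
  simp only [edgesOff, Finset.mem_filter, and_iff_right_iff_imp]
  exact fun h => h.1

theorem edgesOff_subset (A : Set (NetElt X T)) : edgesOff A ⊆ X := fun _ he =>
  (mem_edgesOff.1 he).1

theorem sdiff_edgesOff (A : Set (NetElt X T)) : X \ edgesOff A = edgesOff Aᶜ := by
  ext e
  rw [Finset.mem_sdiff, mem_edgesOff, mem_edgesOff]
  simp only [Set.mem_compl_iff, not_not, not_exists]
  exact ⟨fun h => ⟨h.1, h.2 h.1⟩, fun ⟨h1, h2⟩ => ⟨h1, fun _ => h2⟩⟩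

variable (G F) in
/-- The flows whose readout vanishes on a set of elements. -/
def flowsOff (A : Set (NetElt X T)) : Submodule F (P × Fin 3 → F) :=
  G.flows F X T ⊓ (zeroOn F A).comap (G.readout F X T)

theorem eq_zero_of_mem_flowsOff {A : Set (NetElt X T)} {z : P × Fin 3 → F}
    (hz : z ∈ G.flowsOff F A) {e : P × Fin 3} (he : e ∉ edgesOff A) : z e = 0 := by
  by_cases h : e ∈ X
  · have : (Sum.inl ⟨e, h⟩ : NetElt X T) ∈ A := by
      by_contra h'
      exact he (mem_edgesOff.2 ⟨h, h'⟩)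
    exact hz.2 _ this
  · exact hz.1.1 e h

variable (G F) in
theorem netSpace_inf_zeroOn (A : Set (NetElt X T)) :
    G.netSpace F X T ⊓ zeroOn F A = (G.flowsOff F A).map (G.readout F X T) := by
  ext u
  constructor
  · rintro ⟨⟨z, hz, rfl⟩, h⟩
    exact ⟨z, ⟨hz, h⟩, rfl⟩
  · rintro ⟨z, ⟨hz, h⟩, rfl⟩
    exact ⟨⟨z, hz, rfl⟩, h⟩

variable (G F) in
theorem finrank_netSpace_inf_zeroOn (A : Set (NetElt X T)) :
    finrank F (G.netSpace F X T ⊓ zeroOn F A : Submodule F (NetElt X T → F)) =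
      finrank F (G.flowsOff F A) := by
  rw [netSpace_inf_zeroOn]
  have h := finrank_map_add_finrank_inf_ker (G.readout F X T) (G.flowsOff F A)
  have h2 : G.flowsOff F A ⊓ LinearMap.ker (G.readout F X T) = ⊥ := by
    rw [eq_bot_iff]
    intro z hz
    exact G.readout_injOn F hz.1.1 hz.2
  rw [h2, finrank_bot, add_zero] at h
  exact h

variable (G F) in
-- Modulo cycles, flows are measured by their boundaries, and the boundaries coming from the two
-- sides form independent subspaces. Hence the connectivity of a separation is controlled by the
-- cyclomatic numbers of the two edge sets.
theorem finrank_flowsOff_add_le (A : Set (NetElt X T)) :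
    finrank F (G.flowsOff F A) + finrank F (G.flowsOff F Aᶜ) + G.nu F X ≤
      finrank F (G.netSpace F X T) + G.nu F (edgesOff A) + G.nu F (edgesOff Aᶜ) := by
  have hle : ∀ B : Set (NetElt X T), finrank F (G.flowsOff F B) ≤
      finrank F ((G.flowsOff F B).map (G.boundary F)) + G.nu F (edgesOff B) := by
    intro B
    rw [← finrank_map_add_finrank_inf_ker (G.boundary F) (G.flowsOff F B)]
    gcongr
    refine Submodule.finrank_mono fun z hz => G.mem_cyc.2 ⟨fun e he => ?_, fun v => ?_⟩
    · exact eq_zero_of_mem_flowsOff hz.1 he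
    · exact congrFun hz.2 v
  have h1 := hle A
  have h2 := hle Aᶜ
  have h3 := finrank_map_add_finrank_inf_ker (G.boundary F) (G.flows F X T)
  rw [flows_inf_ker, ← finrank_netSpace] at h3
  have h4 : (G.flowsOff F A).map (G.boundary F) ⊔ (G.flowsOff F Aᶜ).map (G.boundary F) ≤
      (G.flows F X T).map (G.boundary F) :=
    sup_le (Submodule.map_mono inf_le_left) (Submodule.map_mono inf_le_left)
  have h5 : (G.flowsOff F A).map (G.boundary F) ⊓ (G.flowsOff F Aᶜ).map (G.boundary F) = ⊥ := by
    rw [eq_bot_iff]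
    rintro _ ⟨⟨y, hy, rfl⟩, z, hz, hyz⟩
    refine funext fun v => ?_
    -- The extra element with sign vector `(1, 1, 1)` reads off the boundary at its terminal. It
    -- lies in `A` or in `Aᶜ`, so a common boundary vanishes there.
    have hsum : ∀ (hv : v ∈ T) (x : P × Fin 3 → F),
        G.readout F X T x (Sum.inr (⟨v, hv⟩, 0)) = G.boundary F x v := by
      intro hv x
      rw [readout_inr, boundary_apply]
      refine Finset.sum_congr rfl fun i _ => ?_
      fin_cases i <;> simp [signRow]
    by_cases hv : v ∈ T
    · by_cases hA : (Sum.inr (⟨v, hv⟩, 0) : NetElt X T) ∈ A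
      · rw [← hsum hv]
        exact hy.2 _ hA
      · rw [← hyz, ← hsum hv]
        exact hz.2 _ hA
    · exact hy.1.2 v hv
  have h6 := Submodule.finrank_mono h4
  have h7 := Submodule.finrank_sup_add_finrank_inf_eq ((G.flowsOff F A).map (G.boundary F))
    ((G.flowsOff F Aᶜ).map (G.boundary F))
  rw [h5, finrank_bot] at h7
  unfold nu at *
  omega

theorem Tight.isVerticallyConnected {β g L k : ℕ} (hX : G.Tight F β X) (hG : G.LargeGirth L)
    (hgL : g ≤ L) (hT : G.FarApart g T) (hk : k ≤ β) (hg : 3 * k + 3 * β ≤ g) (hg0 : 0 < g) :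
    IsVerticallyConnected (RepMatroid.ofSpace (G.netSpace F X T)).toMatroid k := by
  classical
  refine isVerticallyConnected_ofSpace _ _ fun A hA hB => ?_
  rw [finrank_netSpace_inf_zeroOn, finrank_netSpace_inf_zeroOn]
  have hmain := G.finrank_flowsOff_add_le F A
  have hbig : ∀ B : Set (NetElt X T), G.netSpace F X T ⊓ zeroOn F B ≠ ⊥ →
      g ≤ (edgesOff B).card := by
    intro B hB
    rw [netSpace_inf_zeroOn] at hB
    obtain ⟨_, ⟨z, hz, rfl⟩, h0⟩ := Submodule.exists_mem_ne_zero_of_ne_bot hB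
    have hz0 : z ≠ 0 := by rintro rfl; exact h0 (map_zero _)
    refine (le_card_support_of_mem_flows hG hgL hT hz.1 hz0).trans (Finset.card_le_card ?_)
    intro e he
    by_contra h
    exact (Finset.mem_filter.1 he).2 (eq_zero_of_mem_flowsOff hz h)
  have h1 := hbig A hA
  have h2 := hbig Aᶜ hB
  have h3 := sdiff_edgesOff A
  have hAX := edgesOff_subset A
  have hBX := edgesOff_subset Aᶜ
  have h4 := Finset.card_sdiff_add_card_eq_card hAX
  rw [h3] at h4
  have h5 := hX.card_lt
  have hpos := hX.pos
  -- Each side has at least `g` edges. If at most one side has cycles, these `g` edges force `ν X`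
  -- to exceed the sum of both cyclomatic numbers by at least `k`; if both do, `Tight.nu_add_lt`
  -- gives an excess over `β ≥ k`.
  rcases Nat.eq_zero_or_pos (G.nu F (edgesOff A)) with hA0 | hA1
  · rcases Nat.eq_zero_or_pos (G.nu F (edgesOff Aᶜ)) with hB0 | hB1
    · omega
    · have := hX.le_card (edgesOff Aᶜ) (lt_of_le_of_ne hBX fun h => by rw [h] at h4 h2; omega) hB1
      omega
  · rcases Nat.eq_zero_or_pos (G.nu F (edgesOff Aᶜ)) with hB0 | hB1
    · have := hX.le_card (edgesOff A) (lt_of_le_of_ne hAX fun h => by rw [h] at h4 h1; omega) hA1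
      omega
    · have := hX.nu_add_lt hAX hA1 (by rwa [h3])
      rw [h3] at this
      omega

end CubicGraph

/-! ## Network matroids are far from frame matroids -/

section Weights

variable {F E κ : Type*} [Field F] [DecidableEq F] [Fintype E] [Fintype κ]

/-- The number of nonzero entries of a vector. -/
def weight (u : E → F) : ℕ := (Finset.univ.filter fun e => u e ≠ 0).card

theorem sum_weight_le {b : κ → E → F} {q : ℕ} (hb : ∀ e, {i | b i e ≠ 0}.ncard ≤ q) (D : Finset E) :
    ∑ i, (D.filter fun e => b i e ≠ 0).card ≤ q * D.card := by
  simp only [Finset.card_filter]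
  rw [Finset.sum_comm, mul_comm, ← smul_eq_mul, ← Finset.sum_const]
  refine Finset.sum_le_sum fun e _ => ?_
  rw [← Finset.card_filter]
  refine le_trans (le_of_eq ?_) (hb e)
  rw [Set.ncard_eq_toFinset_card']
  congr 1
  ext i
  simp

theorem weight_sum_le (c : κ → F) (b : κ → E → F) (S : Finset κ) (hc : ∀ i ∉ S, c i = 0) {q : ℕ}
    (hb : ∀ i ∈ S, weight (b i) ≤ q) : weight (∑ i, c i • b i) ≤ S.card * q := by
  classical
  have h1 : (Finset.univ.filter fun e => (∑ i, c i • b i) e ≠ 0) ⊆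
      S.biUnion fun i => Finset.univ.filter fun e => b i e ≠ 0 := by
    intro e he
    obtain ⟨i, -, hi⟩ := Finset.exists_ne_zero_of_sum_ne_zero
      (by simpa [Finset.sum_apply] using (Finset.mem_filter.1 he).2)
    refine Finset.mem_biUnion.2 ⟨i, ?_, ?_⟩
    · by_contra h
      exact hi (by simp [hc i h])
    · simp only [Finset.mem_filter, Finset.mem_univ, true_and]
      exact right_ne_zero_of_mul hi
  exact (Finset.card_le_card h1).trans (Finset.card_biUnion_le_card_mul _ _ _ hb)

end Weights

namespace CubicGraph

open Module

variable {P : Type} {G : CubicGraph P} [DecidableEq P] [Fintype P]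
  {F : Type*} [Field F] {X : Finset (P × Fin 3)} {T : Finset (Bool × P)}

theorem card_netElt : Fintype.card (NetElt X T) = X.card + 4 * T.card := by
  simp [mul_comm]

/-- A frame basis of `W` has more than `|X|/3 - β - t` rows but only about `2 |X|` nonzero entries,
so many rows are light. A combination of `t + 1` of them lies in `netSpace`, whose nonzero vectors
have weight at least `g`. -/
theorem Tight.not_isFrameSpace {β g L t : ℕ} (hX : G.Tight F β X) (hG : G.LargeGirth L)
    (hgL : g ≤ L) (hT : G.FarApart g T) (hg : 64 * (t + 1) < g)
    (hL : 9 * β + 8 * T.card + 130 * t + 65 ≤ L) {W : Submodule F (NetElt X T → F)}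
    (hW : Close t W (G.netSpace F X T)) : ¬ IsFrameSpace W := by
  classical
  rintro ⟨κ, _, b, hb, hbW, hcol⟩
  have hXc := hX.le_card_edges hG
  have hlt := hX.card_lt
  have h1 : finrank F W = Fintype.card κ := by rw [← hbW, finrank_span_eq_card hb]
  have h2 := G.nu_le_finrank_netSpace F (X := X) (T := T)
  have h3 := Submodule.finrank_mono (inf_le_left : W ⊓ G.netSpace F X T ≤ W)
  have h4 := hW.2
  have h5 := sum_weight_le hcol Finset.univ
  rw [Finset.card_univ, card_netElt] at h5
  -- The threshold 64 leaves ample room: at most about `2 |X| / 65` rows are heavier, compared with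
  -- `|X| / 3` rows in all.
  set light := Finset.univ.filter fun i => weight (b i) ≤ 64 with hlight
  have h6 : 65 * (Finset.univ.filter fun i => ¬ weight (b i) ≤ 64).card ≤
      2 * (X.card + 4 * T.card) := by
    refine le_trans ?_ h5
    rw [mul_comm, ← smul_eq_mul, ← Finset.sum_const]
    refine le_trans (Finset.sum_le_sum fun i hi => ?_)
      (Finset.sum_le_univ_sum_of_nonneg fun i => Nat.zero_le _)
    have := (Finset.mem_filter.1 hi).2
    unfold weight at this
    omega
  have h7 := Finset.card_filter_add_card_filter_not (s := (Finset.univ : Finset κ))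
    (fun i => weight (b i) ≤ 64)
  rw [← hlight, Finset.card_univ] at h7
  obtain ⟨S, hSl, hSc⟩ := Finset.exists_subset_card_eq (show t + 1 ≤ light.card by omega)
  obtain ⟨c, hc, hcU, hc0⟩ := hW.exists_combination hb
    (fun i => hbW ▸ Submodule.subset_span ⟨i, rfl⟩) S (by omega)
  have h8 := le_card_support_of_mem_netSpace hG hgL hT hcU hc0
  have h9 := weight_sum_le c b S hc (q := 64) fun i hi => (Finset.mem_filter.1 (hSl hi)).2
  unfold weight at h9
  rw [hSc] at h9
  omega

end CubicGraph
end
noncomputable section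

/-! ## Light dependencies of network matroids -/

namespace CubicGraph

open Module

variable {P : Type} (G : CubicGraph P) [DecidableEq P] [Fintype P]
  (X : Finset (P × Fin 3)) (T : Finset (Bool × P))

/-- The value of a dependency at a half-edge. -/
def halfValue (p : Bool × P → ZMod 3) (y : Bool × P → Fin 4 → ZMod 3) (v : Bool × P) (i : Fin 3) :
    ZMod 3 :=
  if v ∈ T then -∑ a, y v a * signRow (ZMod 3) a i else p v

/-- The dependency with vertex potentials `p` and terminal coefficients `y`. -/
def depVec (p : Bool × P → ZMod 3) (y : Bool × P → Fin 4 → ZMod 3) : NetElt X T → ZMod 3 :=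
  Sum.elim (fun e => halfValue T p y (endL e.1) e.1.2 + halfValue T p y (G.endR e.1) e.1.2)
    fun x => y x.1 x.2

/-- The vertices at which a dependency is not trivial. -/
def active (p : Bool × P → ZMod 3) (y : Bool × P → Fin 4 → ZMod 3) : Finset (Bool × P) :=
  (G.touched X).filter fun v => if v ∈ T then y v ≠ 0 else p v ≠ 0

variable {G X T} {p : Bool × P → ZMod 3} {y : Bool × P → Fin 4 → ZMod 3}

theorem halfValue_of_mem {v : Bool × P} (hv : v ∈ T) (i : Fin 3) :
    halfValue T p y v i = -∑ a, y v a * signRow (ZMod 3) a i := if_pos hv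

theorem halfValue_of_notMem {v : Bool × P} (hv : v ∉ T) (i : Fin 3) :
    halfValue T p y v i = p v := if_neg hv

theorem mem_active_of_mem {v : Bool × P} (hv : v ∈ T) :
    v ∈ G.active X T p y ↔ v ∈ G.touched X ∧ y v ≠ 0 := by
  simp [active, hv]

theorem mem_active_of_notMem {v : Bool × P} (hv : v ∉ T) :
    v ∈ G.active X T p y ↔ v ∈ G.touched X ∧ p v ≠ 0 := by
  simp [active, hv]

theorem mem_active_of_halfValue_ne_zero {v : Bool × P} {i : Fin 3} (hX : v ∈ G.touched X)
    (h : halfValue T p y v i ≠ 0) : v ∈ G.active X T p y := by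
  by_cases hv : v ∈ T
  · rw [mem_active_of_mem hv]
    refine ⟨hX, fun h0 => h ?_⟩
    rw [halfValue_of_mem hv, h0]
    simp
  · rw [mem_active_of_notMem hv]
    exact ⟨hX, by rwa [halfValue_of_notMem hv] at h⟩

theorem mem_perp_netSpace_iff_exists {c : NetElt X T → ZMod 3} :
    c ∈ perp (G.netSpace (ZMod 3) X T) ↔ ∃ p y, c = G.depVec X T p y := by
  rw [mem_perp_netSpace]
  constructor
  · rintro ⟨p, hp⟩
    refine ⟨p, fun v a => if h : v ∈ T then c (Sum.inr (⟨v, h⟩, a)) else 0, ?_⟩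
    have hh : ∀ v i, halfValue T p
        (fun v a => if h : v ∈ T then c (Sum.inr (⟨v, h⟩, a)) else 0) v i = half c p v i := by
      intro v i
      by_cases hv : v ∈ T
      · rw [halfValue_of_mem hv, half_of_mem c p hv]
        simp [hv]
      · rw [halfValue_of_notMem hv, half_of_notMem c p hv]
    funext x
    rcases x with e | ⟨v, a⟩
    · simp only [depVec, Sum.elim_inl, hh]
      exact hp e
    · simp [depVec]
  · rintro ⟨p, y, rfl⟩
    refine ⟨p, fun e => ?_⟩
    have hh : ∀ v i, half (G.depVec X T p y) p v i = halfValue T p y v i := by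
      intro v i
      by_cases hv : v ∈ T
      · rw [halfValue_of_mem hv, half_of_mem _ p hv]
        rfl
      · rw [halfValue_of_notMem hv, half_of_notMem _ p hv]
    rw [hh, hh]
    rfl

/-- This is the minimum distance of the code of relations of the seven points at a terminal: none is
zero and no two are parallel. It lets an active terminal count as much as an active vertex of degree
3. -/
theorem three_le_card_add_card (y : Fin 4 → ZMod 3) (hy : y ≠ 0) :
    3 ≤ (Finset.univ.filter fun i => -∑ a, y a * signRow (ZMod 3) a i ≠ 0).card +
      (Finset.univ.filter fun a => y a ≠ 0).card := by
  revert y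
  unfold signRow
  decide

theorem weight_depVec : weight (G.depVec X T p y) =
    (X.filter fun e => halfValue T p y (endL e) e.2 + halfValue T p y (G.endR e) e.2 ≠ 0).card +
      ∑ v ∈ T, (Finset.univ.filter fun a => y v a ≠ 0).card := by
  rw [weight, Finset.card_filter, Fintype.sum_sum_type, Fintype.sum_prod_type, Finset.card_filter,
    ← Finset.sum_coe_sort X, ← Finset.sum_coe_sort T]
  congr 1
  refine Finset.sum_congr rfl fun v _ => ?_
  rw [Finset.card_filter]
  rfl

variable (G X T p y) in
/-- The edges with two nontrivial half-edges. -/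
def fullEdges : Finset (P × Fin 3) :=
  X.filter fun e => halfValue T p y (endL e) e.2 ≠ 0 ∧ halfValue T p y (G.endR e) e.2 ≠ 0

theorem fullEdges_subset : G.fullEdges X T p y ⊆ X := Finset.filter_subset _ _

theorem halfValue_ne_zero_of_mem_fullEdges {v : Bool × P} {i : Fin 3}
    (h : G.ed v i ∈ G.fullEdges X T p y) : halfValue T p y v i ≠ 0 := by
  obtain ⟨-, h1, h2⟩ := Finset.mem_filter.1 h
  rcases (G.eq_end_of_ed_eq (rfl : G.ed v i = _)).2 with hv | hv
  · rw [← hv] at h1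
    exact h1
  · rw [← hv] at h2
    exact h2

theorem touched_fullEdges_subset : G.touched (G.fullEdges X T p y) ⊆ G.active X T p y := by
  intro v hv
  obtain ⟨i, hi⟩ := G.mem_touched.1 hv
  exact mem_active_of_halfValue_ne_zero (G.mem_touched.2 ⟨i, fullEdges_subset hi⟩)
    (halfValue_ne_zero_of_mem_fullEdges hi)

/-- Counting nontrivial half-edges. -/
theorem sum_halfDeg_le : ∑ v, (Finset.univ.filter fun i => G.ed v i ∈ X ∧
      halfValue T p y v i ≠ 0).card ≤ 2 * (G.fullEdges X T p y).card +
    (X.filter fun e => halfValue T p y (endL e) e.2 + halfValue T p y (G.endR e) e.2 ≠ 0).card := by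
  have h := G.sum_edges_eq_sum_half_edges (R := ℤ) (fun e => if e ∈ X then 1 else 0)
    fun v i => if halfValue T p y v i ≠ 0 then 1 else 0
  have h1 : ∀ v, ((Finset.univ.filter fun i => G.ed v i ∈ X ∧ halfValue T p y v i ≠ 0).card : ℤ) =
      ∑ i, (if halfValue T p y v i ≠ 0 then 1 else 0) * (if G.ed v i ∈ X then (1 : ℤ) else 0) := by
    intro v
    rw [Finset.card_filter]
    push_cast
    refine Finset.sum_congr rfl fun i _ => ?_
    by_cases a : G.ed v i ∈ X <;> by_cases b : halfValue T p y v i = 0 <;> simp [a, b]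
  zify
  rw [Finset.sum_congr rfl fun v _ => h1 v, ← h, fullEdges, Finset.card_filter, Finset.card_filter]
  push_cast
  rw [Finset.mul_sum, ← Finset.sum_add_distrib]
  refine le_trans (le_of_eq (Finset.sum_subset (Finset.subset_univ X)
    fun e _ he => by simp [he]).symm) (Finset.sum_le_sum fun e he => ?_)
  generalize halfValue T p y (endL e) e.2 = a
  generalize halfValue T p y (G.endR e) e.2 = b
  simp only [he, if_true]
  revert a b
  decide

/-- Active vertices at edges that are not full give rise to nonzero entries. -/
theorem card_active_inter_le :
    (G.active X T p y ∩ G.touched (X \ G.fullEdges X T p y)).card ≤ weight (G.depVec X T p y) := by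
  -- Each vertex is charged to a nonzero entry: a terminal to one of its four coefficients, another
  -- vertex to an edge that is not full. The opposite half-edge of such an edge is trivial, so no
  -- entry is charged twice.
  let r : Bool × P → NetElt X T → Prop := fun v x => Sum.elim
    (fun e => (v = endL e.1 ∨ v = G.endR e.1) ∧ halfValue T p y v e.1.2 ≠ 0 ∧
      e.1 ∉ G.fullEdges X T p y) (fun u => v = u.1.1) x
  refine Finset.card_le_card_of_forall_subsingleton r ?_ ?_
  · intro v hv
    rw [Finset.mem_inter] at hv
    obtain ⟨hv1, hv2⟩ := hv
    by_cases hT : v ∈ T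
    · obtain ⟨a, ha⟩ := Function.ne_iff.1 ((mem_active_of_mem hT).1 hv1).2
      exact ⟨Sum.inr (⟨v, hT⟩, a), Finset.mem_filter.2 ⟨Finset.mem_univ _, ha⟩, rfl⟩
    · obtain ⟨i, hi⟩ := G.mem_touched.1 hv2
      obtain ⟨hiX, hi1⟩ := Finset.mem_sdiff.1 hi
      have hpv : halfValue T p y v i ≠ 0 := by
        rw [halfValue_of_notMem hT]
        exact ((mem_active_of_notMem hT).1 hv1).2
      have hends := (G.eq_end_of_ed_eq (rfl : G.ed v i = _)).2
      refine ⟨Sum.inl ⟨_, hiX⟩, Finset.mem_filter.2 ⟨Finset.mem_univ _, ?_⟩, hends, hpv, hi1⟩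
      change halfValue T p y (endL (G.ed v i)) i + halfValue T p y (G.endR (G.ed v i)) i ≠ 0
      have hnot : ¬ (halfValue T p y (endL (G.ed v i)) i ≠ 0 ∧
          halfValue T p y (G.endR (G.ed v i)) i ≠ 0) :=
        fun h => hi1 (Finset.mem_filter.2 ⟨hiX, h⟩)
      rcases hends with h | h
      · rw [← h] at hnot ⊢
        have : halfValue T p y (G.endR (G.ed v i)) i = 0 := by tauto
        rwa [this, add_zero]
      · rw [← h] at hnot ⊢
        have : halfValue T p y (endL (G.ed v i)) i = 0 := by tauto
        rwa [this, zero_add]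
  · rintro (e | u) hx v ⟨hv, hrv⟩ w ⟨hw, hrw⟩
    · obtain ⟨h1, h2, h3⟩ := hrv
      obtain ⟨k1, k2, -⟩ := hrw
      have hfull : halfValue T p y (endL e.1) e.1.2 ≠ 0 →
          halfValue T p y (G.endR e.1) e.1.2 ≠ 0 → False :=
        fun a b => h3 (Finset.mem_filter.2 ⟨e.2, a, b⟩)
      rcases h1 with rfl | rfl <;> rcases k1 with rfl | rfl
      · rfl
      · exact (hfull h2 k2).elim
      · exact (hfull k2 h2).elim
      · rfl
    · exact hrv.trans hrw.symm

theorem card_terminals_inter_active_le :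
    (T ∩ G.active X T p y).card ≤ weight (G.depVec X T p y) := by
  rw [weight_depVec]
  refine le_trans ?_ (Nat.le_add_left _ _)
  rw [← mul_one (T ∩ _).card, ← smul_eq_mul, ← Finset.sum_const]
  refine le_trans (Finset.sum_le_sum fun v hv => ?_)
    (Finset.sum_le_sum_of_subset (Finset.inter_subset_left (s₂ := G.active X T p y)))
  rw [Finset.mem_inter] at hv
  obtain ⟨a, ha⟩ := Function.ne_iff.1 ((mem_active_of_mem hv.1).1 hv.2).2
  exact Finset.card_pos.2 ⟨a, by simpa using ha⟩

/-- The full edges form a forest on active vertices. If they contained a cycle, they could share at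
most `β` vertices with the remaining edges, so by tightness the remaining edges would have no cycle,
and then there would be too many terminals. -/
theorem Tight.card_fullEdges_lt {β : ℕ} (hX : G.Tight (ZMod 3) β X) (hT : ∀ v ∈ T, G.deg X v = 3)
    (hA : (G.active X T p y).Nonempty) (hw : weight (G.depVec X T p y) ≤ β)
    (hm : 2 * weight (G.depVec X T p y) < T.card) :
    (G.fullEdges X T p y).card + 1 ≤ (G.active X T p y).card := by
  set H := G.fullEdges X T p y with hH
  set A := G.active X T p y with hAdef
  have hHX : H ⊆ X := fullEdges_subset
  have hHA : G.touched H ⊆ A := touched_fullEdges_subset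
  have hB := card_active_inter_le (G := G) (X := X) (T := T) (p := p) (y := y)
  rw [← hH, ← hAdef] at hB
  rcases H.eq_empty_or_nonempty with hE | hE
  · rw [hE, Finset.card_empty]
    exact hA.card_pos
  have h1 := G.card_lt_nu_add_card_touched (ZMod 3) hE
  have h2 := Finset.card_le_card hHA
  rcases Nat.eq_zero_or_pos (G.nu (ZMod 3) H) with hnu | hnu
  · omega
  exfalso
  rcases Nat.eq_zero_or_pos (G.nu (ZMod 3) (X \ H)) with hnu' | hnu'
  · have h3 : (X \ H).card ≤ (G.touched (X \ H)).card := by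
      rcases (X \ H).eq_empty_or_nonempty with hR | hR
      · rw [hR]; simp
      · have := G.card_lt_nu_add_card_touched (ZMod 3) hR
        omega
    have hdeg : ∀ v ∉ A, G.deg (X \ H) v = G.deg X v := by
      intro v hv
      unfold deg
      congr 1
      ext i
      simp only [Finset.mem_filter, Finset.mem_univ, true_and, Finset.mem_sdiff, and_iff_left_iff_imp]
      exact fun _ hi => hv (hHA (G.mem_touched.2 ⟨i, hi⟩))
    -- Inactive vertices keep their whole degree in `X \ H`, which is 3 at terminals; active ones
    -- have degree at least 1. As `X \ H` is a forest, the inactive terminals number at most the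
    -- weight, like the active ones, against `hm`.
    have h4 : ∑ v ∈ G.touched (X \ H), (2 + if v ∈ T \ A then 1 else 0) ≤
        ∑ v ∈ G.touched (X \ H), (G.deg (X \ H) v + if v ∈ A then 1 else 0) := by
      refine Finset.sum_le_sum fun v hv => ?_
      by_cases hvA : v ∈ A
      · have := G.deg_pos.2 hv
        simp [hvA]
        omega
      · have h5 := hdeg v hvA
        have h6 := hX.two_le_deg (G.deg_pos.1 (by rw [← h5]; exact G.deg_pos.2 hv))
        by_cases hvT : v ∈ T
        · simp [hvA, hvT, h5, hT v hvT]
        · simp [hvA, hvT, h5, h6]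
    rw [Finset.sum_add_distrib, Finset.sum_add_distrib, G.sum_deg_touched, Finset.sum_const,
      smul_eq_mul, ← Finset.card_filter, ← Finset.card_filter] at h4
    have h5 : (G.touched (X \ H)).filter (· ∈ A) = A ∩ G.touched (X \ H) := by
      ext v
      rw [Finset.mem_filter, Finset.mem_inter, and_comm]
    have h6 : (G.touched (X \ H)).filter (· ∈ T \ A) = T \ A := by
      ext v
      rw [Finset.mem_filter, and_iff_right_iff_imp]
      intro hv
      rw [Finset.mem_sdiff] at hv
      exact G.deg_pos.1 (by rw [hdeg v hv.2, hT v hv.1]; norm_num)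
    rw [h5, h6] at h4
    have h7 := card_terminals_inter_active_le (G := G) (X := X) (T := T) (p := p) (y := y)
    rw [← hAdef] at h7
    have h8 := Finset.card_sdiff_add_card_inter T A
    omega
  · have h3 := hX.lt_card_shared hHX hnu hnu'
    have h4 := Finset.card_le_card (Finset.inter_subset_inter_right
      (u := G.touched (X \ H)) hHA)
    omega

/-- A light dependency is nontrivial only at few vertices, almost all of them deficient. -/
theorem Tight.card_active_add_two_le {β : ℕ} (hX : G.Tight (ZMod 3) β X)
    (hT : ∀ v ∈ T, G.deg X v = 3) (hA : (G.active X T p y).Nonempty)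
    (hw : weight (G.depVec X T p y) ≤ β) (hm : 2 * weight (G.depVec X T p y) < T.card) :
    (G.active X T p y).card + 2 ≤
      weight (G.depVec X T p y) + (G.active X T p y ∩ G.deficient X).card := by
  have h1 := hX.card_fullEdges_lt hT hA hw hm
  have h2 := sum_halfDeg_le (G := G) (X := X) (T := T) (p := p) (y := y)
  have h3 := weight_depVec (G := G) (X := X) (T := T) (p := p) (y := y)
  set A := G.active X T p y with hAdef
  -- Every active vertex accounts for 3: by its half-edges, by terminal coefficients, or by the unit
  -- granted to a deficient vertex. Summing gives `3 |A| ≤ 2 |H| + weight + |A ∩ D|`, with `H` the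
  -- full edges and `D` the deficient vertices, and `|H| ≤ |A| - 1`.
  have h4 : ∑ v ∈ A, 3 ≤ ∑ v ∈ A, ((Finset.univ.filter fun i => G.ed v i ∈ X ∧
      halfValue T p y v i ≠ 0).card + (if v ∈ T then (Finset.univ.filter fun a => y v a ≠ 0).card
        else 0) + if v ∈ G.deficient X then 1 else 0) := by
    refine Finset.sum_le_sum fun v hv => ?_
    by_cases hvT : v ∈ T
    · have h5 := three_le_card_add_card (y v) ((mem_active_of_mem hvT).1 hv).2
      have h6 : ∀ i, G.ed v i ∈ X := by
        have h7 := Finset.card_filter_eq_iff.1 (show (Finset.univ.filter fun i => G.ed v i ∈ X).card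
          = (Finset.univ : Finset (Fin 3)).card from hT v hvT)
        exact fun i => h7 i (Finset.mem_univ i)
      simp only [h6, true_and, hvT, if_true, halfValue_of_mem hvT]
      omega
    · have h5 := (mem_active_of_notMem hvT).1 hv
      have h6 : (Finset.univ.filter fun i => G.ed v i ∈ X ∧ halfValue T p y v i ≠ 0).card =
          G.deg X v := by
        unfold deg
        congr 1
        ext i
        simp [halfValue_of_notMem hvT, h5.2]
      rw [h6]
      have h7 := hX.two_le_deg h5.1
      by_cases hd : v ∈ G.deficient X
      · simp only [hd, if_true]
        omega
      · have : ¬ G.deg X v ≤ 2 := fun h => hd (Finset.mem_filter.2 ⟨h5.1, h⟩)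
        omega
  rw [Finset.sum_const, smul_eq_mul, Finset.sum_add_distrib, Finset.sum_add_distrib,
    ← Finset.card_filter, ← Finset.sum_filter, Finset.filter_mem_eq_inter,
    Finset.filter_mem_eq_inter] at h4
  have h5 := Finset.sum_le_univ_sum_of_nonneg (s := A) (f := fun v =>
    (Finset.univ.filter fun i => G.ed v i ∈ X ∧ halfValue T p y v i ≠ 0).card)
    (fun v => Nat.zero_le _)
  have h6 := Finset.sum_le_sum_of_subset (f := fun v =>
    (Finset.univ.filter fun a => y v a ≠ 0).card) (Finset.inter_subset_right (s₁ := A) (s₂ := T))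
  omega

end CubicGraph
end
noncomputable section

/-! ## Light dependencies are local -/

/-- Greedy choice: each selected element excludes itself and at most `d` others. -/
theorem exists_pairwise_not {κ : Type*} [DecidableEq κ] (r : κ → κ → Prop) [DecidableRel r]
    (hr : ∀ i j, r i j → r j i) (d : ℕ) (hd : ∀ i (S : Finset κ), (S.filter (r i)).card ≤ d) :
    ∀ (n : ℕ) (S : Finset κ), n * (d + 1) ≤ S.card →
      ∃ S' ⊆ S, S'.card = n ∧ ∀ i ∈ S', ∀ j ∈ S', r i j → i = j := by
  intro n
  induction n with
  | zero => exact fun S _ => ⟨∅, Finset.empty_subset _, rfl, by simp⟩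
  | succ n ih =>
    intro S hS
    rw [add_mul] at hS
    obtain ⟨i, hi⟩ : S.Nonempty := Finset.card_pos.1 (by omega)
    set S1 := (S.erase i).filter fun j => ¬ r i j with hS1
    have h1 := Finset.card_filter_add_card_filter_not (s := S.erase i) (r i)
    rw [← hS1, Finset.card_erase_of_mem hi] at h1
    have h2 := hd i (S.erase i)
    obtain ⟨S', h3, h4, h5⟩ := ih S1 (by omega)
    have hS1i : ∀ j ∈ S', j ≠ i ∧ j ∈ S ∧ ¬ r i j := by
      intro j hj
      have := Finset.mem_filter.1 (h3 hj)
      exact ⟨Finset.ne_of_mem_erase this.1, Finset.mem_of_mem_erase this.1, this.2⟩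
    refine ⟨insert i S', ?_, ?_, ?_⟩
    · exact Finset.insert_subset hi fun j hj => (hS1i j hj).2.1
    · rw [Finset.card_insert_of_notMem fun h => (hS1i i h).1 rfl, h4]
    · intro j hj k hk hjk
      rcases Finset.mem_insert.1 hj with rfl | hj' <;> rcases Finset.mem_insert.1 hk with rfl | hk'
      · rfl
      · exact absurd hjk (hS1i k hk').2.2
      · exact absurd (hr _ _ hjk) (hS1i j hj').2.2
      · exact h5 j hj' k hk' hjk

namespace CubicGraph

open Module

variable {P : Type} (G : CubicGraph P) [DecidableEq P]

/-- The vertices at distance at most `n` from `v`. -/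
def ball (v : Bool × P) : ℕ → Finset (Bool × P)
  | 0 => {v}
  | n + 1 => ball v n ∪ Finset.univ.biUnion fun i => (ball v n).image (G.step i)

theorem mem_ball_self (v : Bool × P) (n : ℕ) : v ∈ G.ball v n := by
  induction n with
  | zero => simp [ball]
  | succ n ih => exact Finset.mem_union_left _ ih

theorem ball_mono (v : Bool × P) : Monotone (G.ball v) :=
  monotone_nat_of_le_succ fun _ => Finset.subset_union_left

theorem step_mem_ball {u v : Bool × P} {n : ℕ} (h : u ∈ G.ball v n) (i : Fin 3) :
    G.step i u ∈ G.ball v (n + 1) :=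
  Finset.mem_union_right _ (Finset.mem_biUnion.2
    ⟨i, Finset.mem_univ i, Finset.mem_image_of_mem _ h⟩)

theorem card_ball_le (v : Bool × P) (n : ℕ) : (G.ball v n).card ≤ 4 ^ n := by
  induction n with
  | zero => simp [ball]
  | succ n ih =>
    have h1 : (Finset.univ.biUnion fun i => (G.ball v n).image (G.step i)).card ≤
        3 * (G.ball v n).card :=
      (Finset.card_biUnion_le_card_mul _ _ _ fun i _ => Finset.card_image_le).trans (by simp)
    have h2 := Finset.card_union_le (G.ball v n)
      (Finset.univ.biUnion fun i => (G.ball v n).image (G.step i))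
    rw [ball, pow_succ]
    omega

theorem mem_ball_of_mem_ball_step {u v : Bool × P} {n : ℕ} {i : Fin 3}
    (h : u ∈ G.ball (G.step i v) n) : u ∈ G.ball v (n + 1) := by
  induction n generalizing u with
  | zero =>
    rw [ball, Finset.mem_singleton] at h
    rw [h]
    exact G.step_mem_ball (G.mem_ball_self v 0) i
  | succ n ih =>
    rw [ball, Finset.mem_union] at h
    rcases h with h | h
    · exact G.ball_mono v (Nat.le_succ _) (ih h)
    · obtain ⟨j, -, hj⟩ := Finset.mem_biUnion.1 h
      obtain ⟨w, hw, rfl⟩ := Finset.mem_image.1 hj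
      exact G.step_mem_ball (ih hw) j

theorem mem_ball_comm {u v : Bool × P} {n : ℕ} (h : u ∈ G.ball v n) : v ∈ G.ball u n := by
  induction n generalizing u with
  | zero =>
    rw [ball, Finset.mem_singleton] at h ⊢
    exact h.symm
  | succ n ih =>
    rw [ball, Finset.mem_union] at h
    rcases h with h | h
    · exact G.ball_mono u (Nat.le_succ _) (ih h)
    · obtain ⟨j, -, hj⟩ := Finset.mem_biUnion.1 h
      obtain ⟨w, hw, rfl⟩ := Finset.mem_image.1 hj
      refine G.mem_ball_of_mem_ball_step (i := j) ?_
      rw [step_step]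
      exact ih hw

/-- As the radius grows, `K ∩ ball` gains a vertex at every step until it stabilizes; it is then
closed under adjacency inside `K`, so it is all of `K`. -/
theorem subset_ball_of_connected {K : Finset (Bool × P)} {X : Finset (P × Fin 3)}
    (hK : ∀ K' ⊆ K, K'.Nonempty →
      (∀ u ∈ K', ∀ i, G.ed u i ∈ X → G.step i u ∈ K → G.step i u ∈ K') → K' = K)
    {v : Bool × P} (hv : v ∈ K) : K ⊆ G.ball v K.card := by
  have h : ∀ n, K ⊆ G.ball v n ∨ n + 1 ≤ (K ∩ G.ball v n).card := by
    intro n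
    induction n with
    | zero =>
      right
      exact Finset.card_pos.2 ⟨v, Finset.mem_inter.2 ⟨hv, G.mem_ball_self v 0⟩⟩
    | succ n ih =>
      rcases ih with h | h
      · exact Or.inl (h.trans (G.ball_mono v (Nat.le_succ n)))
      · by_cases hsub : K ∩ G.ball v (n + 1) ⊆ K ∩ G.ball v n
        · left
          have := hK (K ∩ G.ball v n) Finset.inter_subset_left
            ⟨v, Finset.mem_inter.2 ⟨hv, G.mem_ball_self v n⟩⟩ fun u hu i _ hi =>
              hsub (Finset.mem_inter.2 ⟨hi, G.step_mem_ball (Finset.mem_inter.1 hu).2 i⟩)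
          rw [← this]
          exact Finset.inter_subset_right.trans (G.ball_mono v (Nat.le_succ n))
        · right
          have hss : K ∩ G.ball v n ⊂ K ∩ G.ball v (n + 1) :=
            ⟨Finset.inter_subset_inter_left (G.ball_mono v (Nat.le_succ n)), hsub⟩
          have := Finset.card_lt_card hss
          omega
  rcases h K.card with h | h
  · exact h
  · have := Finset.card_le_card (Finset.inter_subset_left (s₁ := K) (s₂ := G.ball v K.card))
    omega

variable {G} [Fintype P] {X : Finset (P × Fin 3)} {T : Finset (Bool × P)}
  {p : Bool × P → ZMod 3} {y : Bool × P → Fin 4 → ZMod 3}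

theorem halfValue_restrict (K : Finset (Bool × P)) (v : Bool × P) (i : Fin 3) :
    halfValue T (fun v => if v ∈ K then p v else 0) (fun v => if v ∈ K then y v else 0) v i =
      if v ∈ K then halfValue T p y v i else 0 := by
  by_cases hv : v ∈ T
  · rw [halfValue_of_mem hv, halfValue_of_mem hv]
    split_ifs <;> simp
  · rw [halfValue_of_notMem hv, halfValue_of_notMem hv]

theorem active_restrict {K : Finset (Bool × P)} (hK : K ⊆ G.active X T p y) :
    G.active X T (fun v => if v ∈ K then p v else 0) (fun v => if v ∈ K then y v else 0) = K := by
  ext v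
  by_cases hvK : v ∈ K
  · have h := Finset.mem_filter.1 (hK hvK)
    simp only [active, Finset.mem_filter, hvK, if_true, iff_true]
    exact h
  · simp [active, hvK]

theorem halfValue_eq_zero_of_notMem_active {v : Bool × P} {i : Fin 3} (hX : G.ed v i ∈ X)
    (h : v ∉ G.active X T p y) : halfValue T p y v i = 0 := by
  by_contra h0
  exact h (mem_active_of_halfValue_ne_zero (G.mem_touched.2 ⟨i, hX⟩) h0)

/-- Restricting a dependency to a union of components of its active set creates no new nonzero
entries, because an edge leaving `K` has an inactive other end. -/
theorem depVec_restrict_ne_zero {K : Finset (Bool × P)}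
    (hcl : ∀ u ∈ K, ∀ i, G.ed u i ∈ X → G.step i u ∈ G.active X T p y → G.step i u ∈ K)
    {x : NetElt X T} (hx : G.depVec X T (fun v => if v ∈ K then p v else 0)
      (fun v => if v ∈ K then y v else 0) x ≠ 0) : G.depVec X T p y x ≠ 0 := by
  rcases x with e | ⟨v, a⟩
  · simp only [depVec, Sum.elim_inl, halfValue_restrict] at hx ⊢
    have hL : G.ed (endL e.1) e.1.2 ∈ X := e.2
    have hR : G.ed (G.endR e.1) e.1.2 ∈ X := by rw [ed_endR]; exact e.2
    by_cases h1 : endL e.1 ∈ K <;> by_cases h2 : G.endR e.1 ∈ K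
    · simpa only [h1, h2, if_true] using hx
    · have h3 : G.endR e.1 ∉ G.active X T p y := fun h => h2 (hcl _ h1 _ hL h)
      rw [halfValue_eq_zero_of_notMem_active hR h3]
      simpa only [h1, h2, if_true, if_false] using hx
    · have h3 : endL e.1 ∉ G.active X T p y := fun h => by
        have := hcl _ h2 e.1.2 hR
        rw [step_endR] at this
        exact h1 (this h)
      rw [halfValue_eq_zero_of_notMem_active hL h3]
      simpa only [h1, h2, if_true, if_false] using hx
    · simp [h1, h2] at hx
  · simp only [depVec, Sum.elim_inr] at hx ⊢
    split_ifs at hx with h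
    · exact hx
    · simp at hx

/-- A dependency can be replaced by one that lives in a small ball. -/
theorem exists_local_dependency {Z : Finset (NetElt X T)} (hA : (G.active X T p y).Nonempty)
    (hZ : ∀ x, G.depVec X T p y x ≠ 0 → x ∈ Z) :
    ∃ p y, (G.active X T p y).Nonempty ∧ (∀ x, G.depVec X T p y x ≠ 0 → x ∈ Z) ∧
      ∀ v ∈ G.active X T p y, G.active X T p y ⊆ G.ball v (G.active X T p y).card := by
  classical
  -- A dependency with the fewest active vertices has a connected active set: otherwise its
  -- restriction to a component would be smaller.
  have hex : ∃ n, ∃ p y, (G.active X T p y).Nonempty ∧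
    (∀ x, G.depVec X T p y x ≠ 0 → x ∈ Z) ∧ (G.active X T p y).card = n := ⟨_, p, y, hA, hZ, rfl⟩
  obtain ⟨p', y', h1, h2, h3⟩ := Nat.find_spec hex
  refine ⟨p', y', h1, h2, fun v hv => G.subset_ball_of_connected (X := X) ?_ hv⟩
  intro K hK hne hcl
  refine Finset.eq_of_subset_of_card_le hK ?_
  rw [h3]
  refine Nat.find_min' hex ⟨_, _, ?_, fun x hx => h2 x (depVec_restrict_ne_zero hcl hx), ?_⟩
  · rw [active_restrict hK]
    exact hne
  · rw [active_restrict hK]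

variable (G X T) in
/-- The vertices at which an element of the network matroid is located. -/
def eltVertices : NetElt X T → Finset (Bool × P) :=
  Sum.elim (fun e => {endL e.1, G.endR e.1}) fun u => {u.1.1}

theorem card_eltVertices_le (x : NetElt X T) : (G.eltVertices X T x).card ≤ 2 := by
  rcases x with e | u
  · exact Finset.card_le_two
  · simp [eltVertices]

theorem exists_mem_active (hT : T ⊆ G.touched X) {x : NetElt X T} (hx : G.depVec X T p y x ≠ 0) :
    ∃ v ∈ G.eltVertices X T x, v ∈ G.active X T p y := by
  rcases x with e | ⟨v, a⟩
  · simp only [depVec, Sum.elim_inl] at hx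
    by_cases h : halfValue T p y (endL e.1) e.1.2 = 0
    · rw [h, zero_add] at hx
      exact ⟨_, by simp [eltVertices],
        mem_active_of_halfValue_ne_zero (G.endR_mem_touched e.2) hx⟩
    · exact ⟨_, by simp [eltVertices],
        mem_active_of_halfValue_ne_zero (G.endL_mem_touched e.2) h⟩
  · refine ⟨v, by simp [eltVertices], (mem_active_of_mem v.2).2 ⟨hT v.2, fun h => hx ?_⟩⟩
    simp [depVec, h]

/-- Three edge colours and four sign vectors distinguish the elements located at a vertex. -/
theorem card_elts_at_le (v : Bool × P) :
    (Finset.univ.filter fun x => v ∈ G.eltVertices X T x).card ≤ 7 := by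
  have h7 : (Finset.univ : Finset (Fin 3 ⊕ Fin 4)).card = 7 := rfl
  rw [← h7]
  refine Finset.card_le_card_of_injOn (Sum.map (fun e => e.1.2) fun u => u.2)
    (fun _ _ => Finset.mem_coe.2 (Finset.mem_univ _)) ?_
  have hed : ∀ e : {e // e ∈ X}, v ∈ G.eltVertices X T (Sum.inl e) → e.1 = G.ed v e.1.2 := by
    intro e he
    simp only [eltVertices, Sum.elim_inl, Finset.mem_insert, Finset.mem_singleton] at he
    rcases he with h | h
    · rw [h, ed_endL]
    · rw [h, ed_endR]
  rintro (e | u) hx (e' | u') hx' h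
  · have h1 := hed e (Finset.mem_filter.1 (Finset.mem_coe.1 hx)).2
    have h2 := hed e' (Finset.mem_filter.1 (Finset.mem_coe.1 hx')).2
    have h3 : e.1.2 = e'.1.2 := Sum.inl_injective h
    exact congrArg _ (Subtype.ext (by rw [h1, h2, h3]))
  · simp at h
  · simp at h
  · have h1 := (Finset.mem_filter.1 (Finset.mem_coe.1 hx)).2
    have h2 := (Finset.mem_filter.1 (Finset.mem_coe.1 hx')).2
    simp only [eltVertices, Sum.elim_inr, Finset.mem_singleton] at h1 h2
    have h3 : u.2 = u'.2 := Sum.inr_injective h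
    exact congrArg _ (Prod.ext (Subtype.ext (h1.symm.trans h2)) h3)

variable (G X T) in
/-- Two elements located at vertices at distance at most `n`. -/
def Near (n : ℕ) (x x' : NetElt X T) : Prop :=
  ∃ v ∈ G.eltVertices X T x, ∃ v' ∈ G.eltVertices X T x', v' ∈ G.ball v n

theorem Near.symm {n : ℕ} {x x' : NetElt X T} (h : G.Near X T n x x') : G.Near X T n x' x := by
  obtain ⟨v, hv, v', hv', hb⟩ := h
  exact ⟨v', hv', v, hv, G.mem_ball_comm hb⟩

open Classical in
theorem card_near_le (n : ℕ) (x : NetElt X T) :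
    (Finset.univ.filter (G.Near X T n x)).card ≤ 14 * 4 ^ n := by
  have h1 : Finset.univ.filter (G.Near X T n x) ⊆ (G.eltVertices X T x).biUnion fun v =>
      (G.ball v n).biUnion fun v' => Finset.univ.filter fun x' => v' ∈ G.eltVertices X T x' := by
    intro x' hx'
    obtain ⟨v, hv, v', hv', hb⟩ := (Finset.mem_filter.1 hx').2
    exact Finset.mem_biUnion.2 ⟨v, hv, Finset.mem_biUnion.2 ⟨v', hb,
      Finset.mem_filter.2 ⟨Finset.mem_univ _, hv'⟩⟩⟩
  refine (Finset.card_le_card h1).trans ((Finset.card_biUnion_le_card_mul _ _ (4 ^ n * 7)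
    fun v _ => ?_).trans ?_)
  · refine (Finset.card_biUnion_le_card_mul _ _ 7 fun v' _ => ?_).trans
      (Nat.mul_le_mul_right _ (G.card_ball_le v n))
    exact card_elts_at_le v'
  · have := Nat.mul_le_mul_right (4 ^ n * 7) (card_eltVertices_le (G := G) x)
    omega

/-! ## Network matroids are far from the duals of frame matroids -/

/-- Among many light rows, `t + 1` are mutually far apart and some combination of them is a
dependency. A local dependency inside its support has to live on a single row, so its weight is at
most 2, which forces its active vertices to be deficient. -/
theorem Tight.card_light_rows_lt {β t : ℕ} (hX : G.Tight (ZMod 3) β X)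
    (hT : ∀ v ∈ T, G.deg X v = 3) (hβ : 2 * (t + 1) ≤ β) (hm : 4 * (t + 1) < T.card)
    {W : Submodule (ZMod 3) (NetElt X T → ZMod 3)}
    (hW : Close t W (perp (G.netSpace (ZMod 3) X T))) {κ : Type*} [Fintype κ]
    {b : κ → NetElt X T → ZMod 3} (hb : LinearIndependent (ZMod 3) b) (hbW : ∀ i, b i ∈ W)
    (hcol : ∀ x, {i | b i x ≠ 0}.ncard ≤ 2) (S : Finset κ) (hS2 : ∀ i ∈ S, weight (b i) ≤ 2)
    (hSD : ∀ i ∈ S, ∀ x, b i x ≠ 0 → ∀ v ∈ G.eltVertices X T x, v ∉ G.deficient X) :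
    S.card < (t + 1) * (56 * 4 ^ (2 * (t + 1) + (3 * β + 2)) + 1) := by
  classical
  set w := 2 * (t + 1) + (3 * β + 2) with hw
  by_contra! hcon
  let r : κ → κ → Prop := fun i j => weight (b i) ≤ 2 ∧ weight (b j) ≤ 2 ∧
    ∃ x, b i x ≠ 0 ∧ ∃ x', b j x' ≠ 0 ∧ G.Near X T w x x'
  have hrsymm : ∀ i j, r i j → r j i := by
    rintro i j ⟨h1, h2, x, hx, x', hx', h⟩
    exact ⟨h2, h1, x', hx', x, hx, h.symm⟩
  -- A light row has at most 2 nonzero entries, each is near at most `14 * 4 ^ w` elements, and each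
  -- of those belongs to at most 2 rows.
  have hrcard : ∀ i (S : Finset κ), (S.filter (r i)).card ≤ 56 * 4 ^ w := by
    intro i S
    by_cases hi : weight (b i) ≤ 2
    · have h1 : S.filter (r i) ⊆ (Finset.univ.filter fun x => b i x ≠ 0).biUnion fun x =>
          (Finset.univ.filter (G.Near X T w x)).biUnion fun x' =>
            Finset.univ.filter fun j => b j x' ≠ 0 := by
        intro j hj
        obtain ⟨-, -, x, hx, x', hx', h⟩ := (Finset.mem_filter.1 hj).2
        simp only [Finset.mem_biUnion, Finset.mem_filter, Finset.mem_univ, true_and]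
        exact ⟨x, hx, x', h, hx'⟩
      refine (Finset.card_le_card h1).trans ((Finset.card_biUnion_le_card_mul _ _
        (14 * 4 ^ w * 2) fun x _ => ?_).trans ?_)
      · refine (Finset.card_biUnion_le_card_mul _ _ 2 fun x' _ => ?_).trans
          (Nat.mul_le_mul_right _ (card_near_le w x))
        refine le_trans (le_of_eq ?_) (hcol x')
        rw [Set.ncard_eq_toFinset_card']
        congr 1
        ext j
        simp
      · have := Nat.mul_le_mul_right (14 * 4 ^ w * 2) hi
        unfold weight at this
        omega
    · rw [Finset.filter_false_of_mem fun j _ h => hi h.1]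
      simp
  obtain ⟨S', hS'S, hS'c, hS'⟩ := exists_pairwise_not r hrsymm _ hrcard (t + 1) S hcon
  obtain ⟨c, hc, hcQ, hc0⟩ := hW.exists_combination hb hbW S' (by omega)
  obtain ⟨p, y, hpy⟩ := mem_perp_netSpace_iff_exists.1 hcQ
  have hTX : T ⊆ G.touched X := fun v hv => G.deg_pos.1 (by rw [hT v hv]; norm_num)
  set Z : Finset (NetElt X T) := S'.biUnion fun i => Finset.univ.filter fun x => b i x ≠ 0 with hZ
  have hmemZ : ∀ x, x ∈ Z → ∃ i ∈ S', b i x ≠ 0 := by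
    intro x hx
    obtain ⟨i, hi, h⟩ := Finset.mem_biUnion.1 hx
    exact ⟨i, hi, (Finset.mem_filter.1 h).2⟩
  have hZc : Z.card ≤ (t + 1) * 2 := by
    rw [← hS'c]
    exact Finset.card_biUnion_le_card_mul _ _ _ fun i hi => hS2 i (hS'S hi)
  have hA : (G.active X T p y).Nonempty := by
    rw [hpy] at hc0
    obtain ⟨x, hx⟩ := Function.ne_iff.1 hc0
    obtain ⟨v, -, hv⟩ := exists_mem_active hTX hx
    exact ⟨v, hv⟩
  have hsupp : ∀ x, G.depVec X T p y x ≠ 0 → x ∈ Z := by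
    intro x hx
    rw [← hpy, Finset.sum_apply] at hx
    obtain ⟨i, -, hi⟩ := Finset.exists_ne_zero_of_sum_ne_zero hx
    refine Finset.mem_biUnion.2 ⟨i, ?_, ?_⟩
    · by_contra h
      exact hi (by simp [hc i h])
    · simp only [Finset.mem_filter, Finset.mem_univ, true_and]
      exact right_ne_zero_of_mul hi
  obtain ⟨q, u, hA', hsupp', hball⟩ := exists_local_dependency hA hsupp
  have hwt : weight (G.depVec X T q u) ≤ Z.card :=
    Finset.card_le_card fun x hx => hsupp' x (Finset.mem_filter.1 hx).2
  have hkey := hX.card_active_add_two_le hT hA' (by omega) (by omega)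
  have hD := hX.card_deficient
  have hAD := Finset.card_le_card (Finset.inter_subset_right (s₁ := G.active X T q u)
    (s₂ := G.deficient X))
  have hAw : (G.active X T q u).card ≤ w := by omega
  -- Any two elements of the support have active vertices within distance `w`, so the rows
  -- containing them are related and therefore equal.
  have hwt2 : weight (G.depVec X T q u) ≤ 2 := by
    by_cases hz : ∃ x, G.depVec X T q u x ≠ 0
    · obtain ⟨x, hx⟩ := hz
      obtain ⟨i, hi, hix⟩ := hmemZ x (hsupp' x hx)
      refine le_trans (Finset.card_le_card fun x' hx' => ?_) (hS2 i (hS'S hi))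
      have hx'0 := (Finset.mem_filter.1 hx').2
      obtain ⟨j, hj, hjx⟩ := hmemZ x' (hsupp' x' hx'0)
      obtain ⟨v, hv, hvA⟩ := exists_mem_active hTX hx
      obtain ⟨v', hv', hvA'⟩ := exists_mem_active hTX hx'0
      have hij := hS' i hi j hj ⟨hS2 i (hS'S hi), hS2 j (hS'S hj), x, hix, x', hjx, v, hv, v', hv',
        G.ball_mono v hAw (hball v hvA hvA')⟩
      rw [hij]
      exact Finset.mem_filter.2 ⟨Finset.mem_univ _, hjx⟩
    · push Not at hz
      simp [weight, hz]
  -- With weight at most 2, `hkey` reads `|A| ≤ |A ∩ D|` for the active vertices `A` and the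
  -- deficient ones `D`; it also forces the weight to be positive.
  have hsub : G.active X T q u ⊆ G.deficient X := by
    have h1 : G.active X T q u ∩ G.deficient X = G.active X T q u :=
      Finset.eq_of_subset_of_card_le Finset.inter_subset_left (by omega)
    rw [← h1]
    exact Finset.inter_subset_right
  have hpos : 0 < weight (G.depVec X T q u) := by
    have := Finset.card_le_card (Finset.inter_subset_left (s₁ := G.active X T q u)
      (s₂ := G.deficient X))
    omega
  obtain ⟨x, hx⟩ := Finset.card_pos.1 hpos
  have hx0 := (Finset.mem_filter.1 hx).2
  obtain ⟨v, hv, hvA⟩ := exists_mem_active hTX hx0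
  obtain ⟨i, hi, hix⟩ := hmemZ x (hsupp' x hx0)
  exact hSD i (hS'S hi) x hix v hv (hsub hvA)

/-- There are at least `2 |X| / 3 + 3 |T| - t` rows and at most `(2 |X| + 8 |T|) / 3` of weight 3 or
more, so at least `|T| / 3 - t` are light. At most `14 (3 β + 2)` rows meet an element at a
deficient vertex, and the rest are too many for `Tight.card_light_rows_lt`. -/
theorem Tight.not_isFrameSpace_of_close_perp {β t : ℕ} (hX : G.Tight (ZMod 3) β X)
    (hX3 : 3 ≤ X.card) (hT : ∀ v ∈ T, G.deg X v = 3) (hβ : 2 * (t + 1) ≤ β)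
    (hm : 4 * (t + 1) < T.card)
    (hm' : 3 * t + 42 * (3 * β + 2) +
      3 * ((t + 1) * (56 * 4 ^ (2 * (t + 1) + (3 * β + 2)) + 1)) < T.card)
    {W : Submodule (ZMod 3) (NetElt X T → ZMod 3)}
    (hW : Close t W (perp (G.netSpace (ZMod 3) X T))) : ¬ IsFrameSpace W := by
  classical
  rintro ⟨κ, _, b, hb, hbW, hcol⟩
  have hmem : ∀ i, b i ∈ W := fun i => hbW ▸ Submodule.subset_span ⟨i, rfl⟩
  have h1 : finrank (ZMod 3) W = Fintype.card κ := by rw [← hbW, finrank_span_eq_card hb]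
  have h2 := finrank_perp (G.netSpace (ZMod 3) X T)
  rw [card_netElt] at h2
  have h3 := G.finrank_netSpace_le (ZMod 3) (X := X) (T := T)
  have h4 := hX.three_nu_le (by omega) hX3
  have h5 := hW.2
  have h6 := Submodule.finrank_mono
    (inf_le_left : W ⊓ perp (G.netSpace (ZMod 3) X T) ≤ W)
  have hD := hX.card_deficient
  set ED : Finset (NetElt X T) := (G.deficient X).biUnion fun v =>
    Finset.univ.filter fun x => v ∈ G.eltVertices X T x with hED
  have hEDc : ED.card ≤ (G.deficient X).card * 7 :=
    Finset.card_biUnion_le_card_mul _ _ _ fun v _ => card_elts_at_le v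
  set bad := Finset.univ.filter fun i => ∃ x ∈ ED, b i x ≠ 0 with hbad
  have h7 : bad.card ≤ 2 * ED.card := by
    refine le_trans ?_ (sum_weight_le hcol ED)
    rw [← mul_one bad.card, ← smul_eq_mul, ← Finset.sum_const]
    refine le_trans (Finset.sum_le_sum fun i hi => ?_)
      (Finset.sum_le_univ_sum_of_nonneg fun i => Nat.zero_le _)
    obtain ⟨x, hx, hix⟩ := (Finset.mem_filter.1 hi).2
    exact Finset.card_pos.2 ⟨x, Finset.mem_filter.2 ⟨hx, hix⟩⟩
  set light := Finset.univ.filter fun i => weight (b i) ≤ 2 with hlight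
  set heavy := Finset.univ.filter fun i => ¬ weight (b i) ≤ 2 with hheavy
  have h8 : 3 * heavy.card ≤ 2 * (X.card + 4 * T.card) := by
    have h := sum_weight_le hcol Finset.univ
    rw [Finset.card_univ, card_netElt] at h
    refine le_trans ?_ h
    rw [mul_comm, ← smul_eq_mul, ← Finset.sum_const]
    refine le_trans (Finset.sum_le_sum fun i hi => ?_)
      (Finset.sum_le_univ_sum_of_nonneg fun i => Nat.zero_le _)
    have := (Finset.mem_filter.1 hi).2
    unfold weight at this
    omega
  have h9 := Finset.card_filter_add_card_filter_not (s := (Finset.univ : Finset κ))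
    (fun i => weight (b i) ≤ 2)
  rw [← hlight, ← hheavy, Finset.card_univ] at h9
  have h10 := hX.card_light_rows_lt hT hβ hm hW hb hmem hcol (light \ bad)
    (fun i hi => (Finset.mem_filter.1 (Finset.mem_sdiff.1 hi).1).2)
    (fun i hi x hx v hv hvD => (Finset.mem_sdiff.1 hi).2 (Finset.mem_filter.2
      ⟨Finset.mem_univ _, x, Finset.mem_biUnion.2 ⟨v, hvD, Finset.mem_filter.2
        ⟨Finset.mem_univ _, hv⟩⟩, hx⟩))
  have h11 := Finset.le_card_sdiff bad light
  omega

end CubicGraph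

/-! ## The counterexample to the perturbation conjecture -/

theorem exists_dyadic_counterexample (k t : ℕ) :
    ∃ (E : Type) (_ : Fintype E), ∃ M ∈ dyadicClass E,
      IsVerticallyConnected M.toMatroid k ∧
      ∀ N : RepMatroid (ZMod 3) E, N.IsPerturbation t M →
        ¬ N.IsFrame ∧ ¬ N.dual.IsFrame ∧ ¬ N.IsConfinedToProperSubfield := by
  classical
  -- `β` dominates `k` and the weight of `t + 1` light rows; `s` bounds the number of usable light
  -- rows; `m / 3` exceeds `t + 14 (3 β + 2) + s`; `g` exceeds both `64 (t + 1)` and `3 k + 3 β`;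
  -- `L` makes room for the terminals and makes `X` large enough.
  obtain ⟨β, hβ⟩ : ∃ β, β = 2 * (t + 1) + k := ⟨_, rfl⟩
  obtain ⟨s, hs⟩ : ∃ s, s = (t + 1) * (56 * 4 ^ (2 * (t + 1) + (3 * β + 2)) + 1) := ⟨_, rfl⟩
  obtain ⟨m, hm⟩ : ∃ m, m = 3 * t + 42 * (3 * β + 2) + 3 * s + 4 * (t + 1) + 1 := ⟨_, rfl⟩
  obtain ⟨g, hg⟩ : ∃ g, g = 64 * (t + 1) + 3 * k + 3 * β + 1 := ⟨_, rfl⟩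
  obtain ⟨L, hL⟩ : ∃ L, L = (m + 3 * β + 2) * (2 * g + 1) + g + 1 +
    (9 * β + 8 * m + 130 * t + 65) := ⟨_, rfl⟩
  have hG := cayleyGraph_largeGirth L
  have : Fintype (Equiv.Perm (ReducedWord L)) := Fintype.ofFinite _
  obtain ⟨X, hX⟩ := (cayleyGraph L).exists_tight (ZMod 3) β
  obtain ⟨T, hTm, hT3, hTg⟩ := hX.exists_terminals m g hG (by omega)
  have hXL := hX.le_card_edges hG
  have hgL : g ≤ L := by omega
  refine ⟨CubicGraph.NetElt X T, inferInstance, RepMatroid.ofSpace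
    ((cayleyGraph L).netSpace (ZMod 3) X T), (cayleyGraph L).netSpace_mem_dyadicClass,
    hX.isVerticallyConnected hG hgL hTg (by omega) (by omega) (by omega), fun N hN => ?_⟩
  obtain ⟨W, rfl, hW⟩ := exists_close_of_isPerturbation hN
  refine ⟨fun h => ?_, fun h => ?_, not_isConfinedToProperSubfield⟩
  · exact hX.not_isFrameSpace hG hgL hTg (t := t) (by omega) (by rw [hTm]; omega) hW
      (isFrameSpace_of_isFrame h)
  · exact hX.not_isFrameSpace_of_close_perp (t := t) (by omega) hT3 (by omega)
      (by omega) (by rw [← hs]; omega) hW.perp (isFrameSpace_perp_of_isFrame_dual h)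

theorem corollary3p5 :
    dyadicClass.IsMinorClosed ∧ dyadicClass.IsProper ∧
    (∀ k t : ℕ, 0 < k → 0 < t →
      ∃ (E : Type) (_ : Fintype E), ∃ M ∈ dyadicClass E,
        IsVerticallyConnected M.toMatroid k ∧
        ∀ N : RepMatroid (ZMod 3) E, N.IsPerturbation t M →
          ¬ N.IsFrame ∧ ¬ N.dual.IsFrame ∧ ¬ N.IsConfinedToProperSubfield) ∧
    ¬ PerturbationConjecture (ZMod 3) := by
  have h := fun k t : ℕ => fun (_ : 0 < k) (_ : 0 < t) => exists_dyadic_counterexample k t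
  refine ⟨dyadicClass_isMinorClosed, dyadicClass_isProper, h, fun hconj => ?_⟩
  obtain ⟨k, t, hk, ht, hkt⟩ := hconj dyadicClass dyadicClass_isMinorClosed dyadicClass_isProper
  obtain ⟨E, _, M, hM, hconn, hfar⟩ := h k t hk ht
  obtain ⟨N, hN, hstruct⟩ := hkt E M hM hconn
  obtain ⟨h1, h2, h3⟩ := hfar N hN
  rcases hstruct with h' | h' | h'
  · exact h1 h'
  · exact h2 h'
  · exact h3 h'

end
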